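/- **Setting.** Fix $T\in\mathbb N$, $\mathbb T=\{0,\dots,T\}$, $d\ge 1$, a complete probability space $(\Omega,\mathcal F,\mathbb P)$ and a filtration $\mathbb H=(\mathcal H_t)_{t\in\mathbb T}$ with $\mathcal H_T\subset\mathcal F$. Equalities, inequalities and inclusions between random variables hold a.s.; $L^0(E;\mathcal G)$ is the set of $E$-valued $\mathcal G$-measurable random variables (up to a.s. equality). $\mathbb M^d$ is the space of real $d\times d$ matrices, $e_{ij}$ its canonical basis, and $\mathcal A\subset\mathbb M^d$ is a closed convex cone (containing $0$). $\mathbb L^0(\mathcal A;\mathbb H)$ is the set of $\mathbb H$-adapted $\mathcal A$-valued processes. Let $\mathbf F$ be the set of sequences $F=(F_t)_{t\in\mathbb T}$ of $\mathcal F$-measurable random maps (not necessarily $\mathbb H$-adapted) such that a.s. $F_t:\mathbb M^d\to\mathbb R^d$ is continuous, $F_t(\lambda a)=\lambda F_t(a)$ for $\lambda\ge0$, $a\in\mathbb M^d$, and $F_t(\lambda a+\beta a')-\lambda F_t(a)-\beta F_t(a')\in\mathbb R^d_+$ for $\lambda,\beta\ge0$, $a,a'\in\mathcal A$. For $F\in\mathbf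 F$ and $t\in\mathbb T$ set $$N_t(F)=\{F_t(\eta):\eta\in L^0(\mathcal A;\mathcal H_t)\},\qquad N^0_t(F)=N_t(F)\cap(-N_t(F)),$$ $$A_t(F)=\Big\{\sum_{s=0}^t\xi_s-r:\ \xi_s\in N_s(F)\text{ for all }s\in\mathbb T,\ r\in L^0(\mathbb R^d_+;\mathcal F)\Big\}.$$ **Conditions.** - $\mathbf{HN^0}$: for all $t$ and $\eta\in L^0(\mathcal A;\mathcal H_t)$, $F_t(\eta)\in N_t^0(F)$ implies $F_t(-\eta)=-F_t(\eta)$ and $-\eta\in L^0(\mathcal A;\mathcal H_t)$. - $\mathbf{H}\mathcal A$: for all $t$, $F_t(\delta e_{ij})=0$ whenever $\delta\in\{-1,1\}$ and $\delta e_{ij}\notin\mathcal A$; and $F_t(\eta)=\sum_{i,j\le d}(\eta^{ij})^+F_t(e_{ij})+(\eta^{ij})^-F_t(-e_{ij})$ for all $\eta\in L^0(\mathbb M^d;\mathcal F)$. - $\mathbf{NA}^w$: $A_T(F)\cap L^0(\mathbb R^d_+;\mathcal F)=\{0\}$. - $\mathbf{NA}^s$: $A_t(F)\cap(-N_t(F)+L^0(\mathbb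 R^d_+;\mathcal F))\subset N^0_t(F)$ for all $t\in\mathbb T$. - $\mathbf{EF}$: $N^0_t(F)=\{0\}$ for all $t\in\mathbb T$. - $\mathbf{NA}^r$: there is $G\in\mathbf F$ such that for all $\eta\in\mathbb L^0(\mathcal A;\mathbb H)$ and $t\in\mathbb T$: (1) $G^i_t(\eta_t)\ge F^i_t(\eta_t)$ for all $i\le d$; (2) if $F_t(\eta_t)\notin N^0_t(F)$, then with positive probability $G^k_t(\eta_t)>F^k_t(\eta_t)$ for some $k\le d$; and (3) $\mathbf{NA}^w$ holds for $G$. When $\mathbf H\mathcal A$ holds and all $F_t(\pm e_{ij})$ are integrable, put $\bar F_t(\eta_t;Z)=\mathbb E[Z\cdot F_t(\eta_t)\mid\mathcal H_t]$ for bounded $Z$ and $\eta\in\mathbb L^0(\mathcal A;\mathbb H)$ (generalized conditional expectation, i.e. $\mathbb E[X^+|\mathcal H_t]-\mathbb E[X^-|\mathcal H_t]$, both terms being a.s. finite for $X=Z\cdot F_t(\eta_t)$). Let $\mathcal D(F)$ be the set of $Z\in L^\infty(\mathbb R^d;\mathcal F)$ with $Z^i>0$ for all $i\le d$ such that, for all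 $\eta\in\mathbb L^0(\mathcal A;\mathbb H)$ and $t\in\mathbb T$, $\bar F_t(\eta_t;Z)\le0$ and $F_t(\eta_t)\mathbf 1_{\{\bar F_t(\eta_t;Z)=0\}}\in N^0_t(F)$. **Theorem.** Let $F\in\mathbf F$ satisfy $\mathbf{HN^0}$ and $\mathbf H\mathcal A$, and assume $F_t(e_{ij}),F_t(-e_{ij})\in L^1(\mathbb R^d;\mathcal F)$ for all $i,j\le d$, $t\in\mathbb T$. Then: (i) If either $\mathbf{NA}^r$ holds, or $\mathbf{NA}^s$ and $\mathbf{EF}$ hold, then $\mathcal D(F)\neq\emptyset$ and $A_T(F)$ is closed in probability. (ii) If $\mathcal D(F)\neq\emptyset$, then $\mathbf{NA}^s$ and $\mathbf{NA}^r$ hold. -/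

import Mathlib

open MeasureTheory Filter

namespace ImperfectInfo

/-- The space of square `d × d` real matrices. -/
abbrev Mat (d : ℕ) : Type := Matrix (Fin d) (Fin d) ℝ

/-- The matrix `e_{ij}`: its `(i,j)` entry is `1` and all the others are `0`. -/
abbrev e {d : ℕ} (i j : Fin d) : Mat d := Matrix.single i j 1

/-- `L⁰(E; m)`: the `E`-valued `m`-measurable random variables. Random variables are identified when
they are a.s. equal, so the condition reads: `X` is a.s. equal to an `m`-measurable
function, and `X ∈ E` a.s. -/
def L0 {Ω V : Type*} [TopologicalSpace V] {mΩ : MeasurableSpace Ω} (μ : Measure Ω)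
    (E : Set V) (m : MeasurableSpace Ω) : Set (Ω → V) :=
  {X | AEStronglyMeasurable[m] X μ ∧ ∀ᵐ ω ∂μ, X ω ∈ E}

/-- The nonnegative orthant of `ℝ^d`. -/
def orthant (d : ℕ) : Set (Fin d → ℝ) := {x | ∀ i, 0 ≤ x i}

/-- The set of continuous maps `f` from `d × d` matrices to `ℝ^d` that are positively homogeneous and
are superadditive on the cone `A` with respect to the componentwise order. -/
structure IsTransferMap {d : ℕ} (A : ProperCone ℝ (Mat d)) (f : Mat d → Fin d → ℝ) : Prop where
  continuous : Continuous f
  homogeneous : ∀ c : ℝ, 0 ≤ c → ∀ a : Mat d, c • f a = f (c • a)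
  superadditive : ∀ c b : ℝ, 0 ≤ c → 0 ≤ b → ∀ a ∈ A, ∀ a' ∈ A,
    f (c • a + b • a') - (c • f a + b • f a') ∈ orthant d

/-- The value `F_t(η)` of a random map at a random matrix. -/
def app {Ω : Type*} {d : ℕ} (f : Ω → Mat d → Fin d → ℝ) (η : Ω → Mat d) : Ω → Fin d → ℝ :=
  fun ω => f ω (η ω)

section

variable {Ω : Type*} {mΩ : MeasurableSpace Ω} (μ : Measure Ω) {d T : ℕ}
  (H : Filtration (Fin (T + 1)) mΩ) (A : ProperCone ℝ (Mat d))
  (F : Fin (T + 1) → Ω → Mat d → Fin d → ℝ)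

/-- The class of models: measurable sequences `F = (F_t)` of random maps that
take a.s. values in the set of transfer maps. No adaptedness is required. -/
def IsModel : Prop :=
  (∀ t a, Measurable fun ω => F t ω a) ∧ ∀ t, ∀ᵐ ω ∂μ, IsTransferMap A (F t ω)

/-- `𝕃⁰(A; ℍ)`: adapted processes with values in `A`. -/
def Strategies : Set (Fin (T + 1) → Ω → Mat d) :=
  {η | ∀ t, η t ∈ L0 μ (A : Set (Mat d)) (H t)}

/-- `N_t(F) = {F_t(η) : η ∈ L⁰(A; H_t)}`. -/
def N (t : Fin (T + 1)) : Set (Ω → Fin d → ℝ) :=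
  {ξ | ∃ η ∈ L0 μ (A : Set (Mat d)) (H t), ξ =ᵐ[μ] app (F t) η}

/-- `N⁰_t(F) = N_t(F) ∩ (-N_t(F))`. -/
def N0 (t : Fin (T + 1)) : Set (Ω → Fin d → ℝ) :=
  {ξ | ξ ∈ N μ H A F t ∧ -ξ ∈ N μ H A F t}

/-- `V_t(ξ) = ∑_{s ≤ t} ξ_s`. -/
def V (ξ : Fin (T + 1) → Ω → Fin d → ℝ) (t : Fin (T + 1)) : Ω → Fin d → ℝ :=
  ∑ s ∈ Finset.Iic t, ξ s

/-- `A_t(F) = {V_t(ξ) - r : ξ ∈ N(F), r ∈ L⁰(ℝ^d_+; 𝓕)}`. -/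
def Attainable (t : Fin (T + 1)) : Set (Ω → Fin d → ℝ) :=
  {g | ∃ ξ : Fin (T + 1) → Ω → Fin d → ℝ, (∀ s, ξ s ∈ N μ H A F s) ∧
    ∃ r ∈ L0 μ (orthant d) mΩ, g =ᵐ[μ] V ξ t - r}

/-- Condition HN⁰: if `η ∈ L⁰(A; H_t)` and `F_t(η) ∈ N⁰_t(F)`, then
`F_t(-η) = -F_t(η)` and `-η ∈ L⁰(A; H_t)`. -/
def HN0 : Prop :=
  ∀ t, ∀ η ∈ L0 μ (A : Set (Mat d)) (H t), app (F t) η ∈ N0 μ H A F t →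
    app (F t) (-η) =ᵐ[μ] -app (F t) η ∧ -η ∈ L0 μ (A : Set (Mat d)) (H t)

/-- Condition HA: `F(±e_{ij}) = 0` if `±e_{ij} ∉ A`, and
`F(η) = ∑_{i,j} (η^{ij})⁺ F(e_{ij}) + (η^{ij})⁻ F(-e_{ij})` for all random matrices `η`. -/
def HA : Prop :=
  (∀ t (i j : Fin d),
    (e i j ∉ A → (fun ω => F t ω (e i j)) =ᵐ[μ] 0) ∧
    (-e i j ∉ A → (fun ω => F t ω (-e i j)) =ᵐ[μ] 0)) ∧
  ∀ t, ∀ η ∈ L0 μ (Set.univ : Set (Mat d)) mΩ, app (F t) η =ᵐ[μ] fun ω =>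
    ∑ i, ∑ j, ((η ω i j)⁺ • F t ω (e i j) + (η ω i j)⁻ • F t ω (-e i j))

/-- The standing integrability assumption `F_t(e_{ij}), F_t(-e_{ij}) ∈ L¹(ℝ^d; 𝓕)`. -/
def UnitIntegrable : Prop :=
  ∀ t (i j : Fin d), Integrable (fun ω => F t ω (e i j)) μ ∧
    Integrable (fun ω => F t ω (-e i j)) μ

/-- The weak no-arbitrage condition `A_T(F) ∩ L⁰(ℝ^d_+; 𝓕) = {0}`. -/
def NAw : Prop :=
  Attainable μ H A F (Fin.last T) ∩ L0 μ (orthant d) mΩ = {g | g =ᵐ[μ] 0}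

/-- The strict no-arbitrage condition `A_t(F) ∩ (-N_t(F) + L⁰(ℝ^d_+; 𝓕)) ⊆ N⁰_t(F)` for all `t`. -/
def NAs : Prop :=
  ∀ t, Attainable μ H A F t ∩
      {g | ∃ ζ ∈ N μ H A F t, ∃ r ∈ L0 μ (orthant d) mΩ, g =ᵐ[μ] -ζ + r} ⊆ N0 μ H A F t

/-- Efficient frictions: `N⁰_t(F) = {0}` for all `t`. -/
def EF : Prop :=
  ∀ t, N0 μ H A F t = {ξ | ξ =ᵐ[μ] 0}

/-- The robust no-arbitrage condition: some model `G` satisfies, for all strategies `η` and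
all `t`, `G_t(η_t) ≥ F_t(η_t)` componentwise a.s.; if `F_t(η_t) ∉ N⁰_t(F)` then
with positive probability some component of `G_t(η_t)` exceeds that of `F_t(η_t)`;
and weak no-arbitrage holds for `G`. -/
def NAr : Prop :=
  ∃ G : Fin (T + 1) → Ω → Mat d → Fin d → ℝ, IsModel μ A G ∧
    (∀ η ∈ Strategies μ H A, ∀ t,
      (∀ i, ∀ᵐ ω ∂μ, F t ω (η t ω) i ≤ G t ω (η t ω) i) ∧
      (app (F t) (η t) ∉ N0 μ H A F t →
        0 < μ {ω | ∃ k, F t ω (η t ω) k < G t ω (η t ω) k})) ∧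
    NAw μ H A G

/-- The conditional expectation `E[X | m] = E[X⁺ | m] - E[X⁻ | m]` in the generalized sense,
where `E[X⁺ | m]` and `E[X⁻ | m]` are the conditional expectations of `[0,∞]`-valued random
variables. It is meaningful as soon as these two are a.s. finite, even when `X` is not
integrable, and is the usual conditional expectation when `X` is integrable. -/
noncomputable def genCondExp (m : MeasurableSpace Ω) (X : Ω → ℝ) : Ω → ℝ :=
  fun ω => (condLExp m μ (fun ω' => ENNReal.ofReal (X ω')) ω).toReal -
    (condLExp m μ (fun ω' => ENNReal.ofReal (-X ω')) ω).toReal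

/-- `F̄_t(η; Z) = E[Z · F_t(η) | H_t]`. -/
noncomputable def Fbar (Z : Ω → Fin d → ℝ) (t : Fin (T + 1)) (η : Ω → Mat d) : Ω → ℝ :=
  genCondExp μ (H t) fun ω => Z ω ⬝ᵥ F t ω (η ω)

/-- The dual set `D(F)`: bounded `Z` with a.s. positive components such that, for all strategies
`η` and all `t`, `F̄_t(η_t; Z) ≤ 0` a.s. and `F_t(η_t) 1_{F̄_t(η_t; Z) = 0} ∈ N⁰_t(F)`. -/
def D : Set (Ω → Fin d → ℝ) :=
  {Z | MemLp Z ⊤ μ ∧ (∀ᵐ ω ∂μ, ∀ i, 0 < Z ω i) ∧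
    ∀ η ∈ Strategies μ H A, ∀ t,
      (∀ᵐ ω ∂μ, Fbar μ H F Z t (η t) ω ≤ 0) ∧
      {ω | Fbar μ H F Z t (η t) ω = 0}.indicator (app (F t) (η t)) ∈ N0 μ H A F t}

/-- A set of random vectors is closed in probability: it contains the limits in probability
of its sequences. -/
def ClosedInProbability (S : Set (Ω → Fin d → ℝ)) : Prop :=
  ∀ (g : ℕ → Ω → Fin d → ℝ) (g' : Ω → Fin d → ℝ), (∀ n, g n ∈ S) →
    g' ∈ L0 μ Set.univ mΩ → TendstoInMeasure μ g atTop g' → g' ∈ S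

end

end ImperfectInfo

namespace ImperfectInfo
open scoped Topology

/-! Everything passes through the property `Reversible`: a strategy whose total transfer is a.s.
nonnegative has zero total, and each of its transfers lies in `N0`. It follows from NA^r by
comparison with the dominating model (`reversible_of_NAr`), from NA^s and EF by going backwards in
time (`reversible_of_NAs_EF`), and from an element of `D` by a supermartingale argument
(`reversible_of_mem_D`). Combined with HN⁰, it gives closedness, a dual element and NA^s.

Closedness. The cone of transfers from date `k` on is built backwards, adding one date at a time. In
a convergent sequence, the strategies at the new date either converge along a random subsequence or,
after normalisation, converge to a nonzero direction whose transfer is offset by later ones.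
Reversibility allows multiples of that direction to be added so as to cancel a matrix entry, and
induction on the set of nonzero entries concludes (`valueSum_of_tendsto`).

Dual element. The integrable part of the closed cone `A_T` is separated in `L¹` from points outside
it by bounded nonnegative vectors. Under HA the conditional value of a strategy is a combination,
with nonnegative coefficients, of the prices of the finitely many signed units `±e_{ij}`. An
exhaustion argument gives a polar element for which positivity of the components and strict
negativity of the unit prices hold on maximal events; maximality and separation then put it in `D`
(`Reversible.D_nonempty`).

Robustness. Given `Z` in `D`, the dominating model is `F` plus a small random multiple of a bonus,
made of the directional derivatives of `F` minus `F` itself, plus a linear functional. The bonus is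
nonnegative on the cone and vanishes only at reversible matrices. Zero-price matrices are
reversible, so by compactness the value of the bonus is at most a random multiple of minus the
price. A small factor therefore leaves the supermartingale argument intact (`NAr_of_mem_D`). -/

instance {d : ℕ} : SecondCountableTopology (Mat d) :=
  inferInstanceAs (SecondCountableTopology (Fin d → Fin d → ℝ))

instance {d : ℕ} : TopologicalSpace.MetrizableSpace (Mat d) :=
  inferInstanceAs (TopologicalSpace.MetrizableSpace (Fin d → Fin d → ℝ))

/-- The index set of the signed matrix units `±e_{ij}`. -/
abbrev Idx (d : ℕ) : Type := (Fin d × Fin d) × Bool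

/-- The signed matrix units. -/
def unit {d : ℕ} (k : Idx d) : Mat d := if k.2 then e k.1.1 k.1.2 else -e k.1.1 k.1.2

/-- The nonnegative coordinates of a matrix with respect to the signed matrix units. -/
def coef {d : ℕ} (k : Idx d) (a : Mat d) : ℝ := if k.2 then (a k.1.1 k.1.2)⁺ else (a k.1.1 k.1.2)⁻

/-- The sum of the absolute values of the entries. -/
def nrm {d : ℕ} (a : Mat d) : ℝ := ∑ k, coef k a

/-! ### Coordinates with respect to the signed matrix units. -/

section Coordinates

variable {d : ℕ}

lemma coef_nonneg (k : Idx d) (a : Mat d) : 0 ≤ coef k a := by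
  unfold coef; split_ifs
  · exact posPart_nonneg _
  · exact negPart_nonneg _

lemma coef_smul (k : Idx d) {c : ℝ} (hc : 0 ≤ c) (a : Mat d) : coef k (c • a) = c * coef k a := by
  unfold coef
  split_ifs
  · simp only [Matrix.smul_apply, smul_eq_mul, posPart_def]
    rw [mul_max_of_nonneg _ _ hc]; simp
  · simp only [Matrix.smul_apply, smul_eq_mul, negPart_def]
    rw [← mul_neg, mul_max_of_nonneg _ _ hc]; simp

lemma continuous_entry (i j : Fin d) : Continuous fun a : Mat d => a i j :=
  continuous_id.matrix_elem i j

lemma continuous_coef (k : Idx d) : Continuous (coef k : Mat d → ℝ) := by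
  have h := continuous_entry k.1.1 k.1.2
  by_cases hk : k.2 = true
  · have : (coef k : Mat d → ℝ) = fun a => max (a k.1.1 k.1.2) 0 := by
      ext a; simp [coef, hk, posPart_def]
    rw [this]; fun_prop
  · have : (coef k : Mat d → ℝ) = fun a => max (-a k.1.1 k.1.2) 0 := by
      ext a; simp [coef, hk, negPart_def]
    rw [this]; fun_prop

lemma continuous_nrm : Continuous (nrm : Mat d → ℝ) :=
  continuous_finsetSum _ fun k _ => continuous_coef k

lemma nrm_nonneg (a : Mat d) : 0 ≤ nrm a := Finset.sum_nonneg fun k _ => coef_nonneg k a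

lemma nrm_smul {c : ℝ} (hc : 0 ≤ c) (a : Mat d) : nrm (c • a) = c * nrm a := by
  simp [nrm, coef_smul _ hc, Finset.mul_sum]

lemma coef_le_nrm (k : Idx d) (a : Mat d) : coef k a ≤ nrm a :=
  Finset.single_le_sum (f := fun k => coef k a) (fun k _ => coef_nonneg k a) (Finset.mem_univ k)

lemma abs_entry_le_nrm (i j : Fin d) (a : Mat d) : |a i j| ≤ nrm a := by
  rcases le_total 0 (a i j) with h | h
  · have := coef_le_nrm ((i, j), true) a
    simpa [coef, abs_of_nonneg h, posPart_eq_self.2 h] using this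
  · have := coef_le_nrm ((i, j), false) a
    simpa [coef, abs_of_nonpos h, negPart_eq_neg.2 h] using this

lemma eq_zero_of_nrm {a : Mat d} (h : nrm a = 0) : a = 0 := by
  ext i j
  have := abs_entry_le_nrm i j a
  rw [h] at this
  simpa using this

lemma sum_idx {M : Type*} [AddCommMonoid M] (g : Idx d → M) :
    ∑ k, g k = ∑ i, ∑ j, (g ((i, j), true) + g ((i, j), false)) := by
  rw [Fintype.sum_prod_type, Fintype.sum_prod_type]
  simp

end Coordinates

/-! ### Elementary properties of transfer maps. -/

section TransferMap

variable {d : ℕ} {A : ProperCone ℝ (Mat d)} {f : Mat d → Fin d → ℝ}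

lemma IsTransferMap.map_smul (hf : IsTransferMap A f) {c : ℝ} (hc : 0 ≤ c) (a : Mat d) :
    f (c • a) = c • f a := (hf.homogeneous c hc a).symm

lemma IsTransferMap.map_zero (hf : IsTransferMap A f) : f 0 = 0 := by
  simpa using hf.map_smul le_rfl 0

lemma IsTransferMap.le_add (hf : IsTransferMap A f) {a b : Mat d} (ha : a ∈ A) (hb : b ∈ A)
    (i : Fin d) : f a i + f b i ≤ f (a + b) i := by
  have := hf.superadditive 1 1 zero_le_one zero_le_one a ha b hb i
  simp at this
  linarith

/-- A reversible direction is one along which superadditivity is an equality: adding `c • b` and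
then removing it gives inequalities both ways. Negative `c` reduces to positive `c` by exchanging
`b` and `-b`. -/
lemma IsTransferMap.add_smul_of_neg (hf : IsTransferMap A f) {a b : Mat d} (ha : a ∈ A)
    (hb : b ∈ A) (hb' : -b ∈ A) (hn : f (-b) = -f b) (c : ℝ) :
    c • b ∈ A ∧ f (c • b) = c • f b ∧ f (a + c • b) = f a + c • f b := by
  have key : ∀ b : Mat d, b ∈ A → -b ∈ A → f (-b) = -f b → ∀ c : ℝ, 0 ≤ c →
      c • b ∈ A ∧ f (c • b) = c • f b ∧ f (a + c • b) = f a + c • f b := by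
    intro b hb hb' hn c hc
    have h1 := A.smul_mem hb hc
    have h2 : -(c • b) ∈ A := by simpa using A.smul_mem hb' hc
    have h3 : f (-(c • b)) = -(c • f b) := by
      rw [← smul_neg, hf.map_smul hc, hn, smul_neg]
    refine ⟨h1, hf.map_smul hc b, ?_⟩
    ext i
    have e1 := hf.le_add ha h1 i
    have e2 := hf.le_add (A.add_mem ha h1) h2 i
    rw [hf.map_smul hc] at e1
    rw [h3] at e2
    simp at e1 e2 ⊢
    linarith
  rcases le_total 0 c with hc | hc
  · exact key b hb hb' hn c hc
  · have := key (-b) hb' (by simpa using hb) (by simp [hn]) (-c) (by linarith)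
    simpa [hn] using this

end TransferMap

/-- A single random transfer map. -/
structure IsRandomTransferMap {Ω : Type*} {mΩ : MeasurableSpace Ω} (μ : Measure Ω) {d : ℕ}
    (A : ProperCone ℝ (Mat d)) (f : Ω → Mat d → Fin d → ℝ) : Prop where
  measurable : ∀ a, Measurable fun ω => f ω a
  transfer : ∀ᵐ ω ∂μ, IsTransferMap A (f ω)

/-! ### Random matrices, random transfer maps and measurability. -/

section Measurability

variable {Ω : Type*} {mΩ : MeasurableSpace Ω} {μ : Measure Ω} {d : ℕ}
  {A : ProperCone ℝ (Mat d)} {f : Ω → Mat d → Fin d → ℝ}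

lemma L0.congr {m : MeasurableSpace Ω} {V : Type*} [TopologicalSpace V] {E : Set V} {η η' : Ω → V}
    (h : η ∈ L0 μ E m) (h' : η =ᵐ[μ] η') : η' ∈ L0 μ E m :=
  ⟨h.1.congr h', by filter_upwards [h.2, h'] with ω h1 h2; rwa [← h2]⟩

lemma L0.add {m : MeasurableSpace Ω} {η η' : Ω → Mat d} (h : η ∈ L0 μ (A : Set (Mat d)) m)
    (h' : η' ∈ L0 μ (A : Set (Mat d)) m) : η + η' ∈ L0 μ (A : Set (Mat d)) m :=
  ⟨h.1.add h'.1, by filter_upwards [h.2, h'.2] with ω h1 h2 using A.add_mem h1 h2⟩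

lemma L0.smul {m : MeasurableSpace Ω} {η : Ω → Mat d} (h : η ∈ L0 μ (A : Set (Mat d)) m) {c : Ω → ℝ}
    (hc : AEStronglyMeasurable[m] c μ) (hc0 : ∀ᵐ ω ∂μ, 0 ≤ c ω) :
    (fun ω => c ω • η ω) ∈ L0 μ (A : Set (Mat d)) m :=
  ⟨hc.smul h.1, by filter_upwards [h.2, hc0] with ω h1 h2 using A.smul_mem h1 h2⟩

lemma L0.zero {m : MeasurableSpace Ω} : (0 : Ω → Mat d) ∈ L0 μ (A : Set (Mat d)) m :=
  ⟨aestronglyMeasurable_zero, by filter_upwards with ω using A.zero_mem⟩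

lemma L0.const {m : MeasurableSpace Ω} {a : Mat d} (ha : a ∈ A) : (fun _ => a : Ω → Mat d) ∈ L0 μ (A : Set (Mat d)) m :=
  ⟨aestronglyMeasurable_const, by filter_upwards with ω using ha⟩

/-- A random element of the cone has a version that is measurable and lies in the cone everywhere. -/
lemma L0.exists_version {m : MeasurableSpace Ω} {η : Ω → Mat d} (h : η ∈ L0 μ (A : Set (Mat d)) m) :
    ∃ η' : Ω → Mat d, StronglyMeasurable[m] η' ∧ (∀ ω, η' ω ∈ A) ∧ η =ᵐ[μ] η' := by
  obtain ⟨g, hg, hgη⟩ := h.1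
  classical
  borelize (Mat d)
  have hS : MeasurableSet[m] (g ⁻¹' (A : Set (Mat d))) := hg.measurable A.isClosed.measurableSet
  refine ⟨(g ⁻¹' (A : Set (Mat d))).indicator g, hg.indicator hS, fun ω => ?_, ?_⟩
  · by_cases hω : ω ∈ g ⁻¹' (A : Set (Mat d))
    · rw [Set.indicator_of_mem hω]; exact hω
    · rw [Set.indicator_of_notMem hω]; exact A.zero_mem
  · filter_upwards [hgη, h.2] with ω h1 h2
    rw [Set.indicator_of_mem, h1]
    change g ω ∈ (A : Set (Mat d))
    rwa [← h1]

lemma orthant_add {m : MeasurableSpace Ω} {r r' : Ω → Fin d → ℝ} (h : r ∈ L0 μ (orthant d) m)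
    (h' : r' ∈ L0 μ (orthant d) m) : r + r' ∈ L0 μ (orthant d) m :=
  ⟨h.1.add h'.1, by filter_upwards [h.2, h'.2] with ω h1 h2 i using add_nonneg (h1 i) (h2 i)⟩

lemma orthant_zero {m : MeasurableSpace Ω} : (0 : Ω → Fin d → ℝ) ∈ L0 μ (orthant d) m :=
  ⟨aestronglyMeasurable_zero, by filter_upwards with ω i using le_rfl⟩

/-- Measurability in `ω` and continuity in the matrix give joint measurability (a Carathéodory map),
once `f` is set to zero on a null set containing all discontinuous paths. -/
lemma IsRandomTransferMap.app_aestronglyMeasurable (hf : IsRandomTransferMap μ A f)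
    {η : Ω → Mat d} (hη : AEStronglyMeasurable η μ) : AEStronglyMeasurable (app f η) μ := by
  classical
  borelize (Mat d)
  obtain ⟨S, hS, hSm, hSμ⟩ := exists_measurable_superset_of_null (ae_iff.1 hf.transfer)
  let u : Mat d → Ω → Fin d → ℝ := fun a => Sᶜ.indicator fun ω => f ω a
  have hu : Measurable (Function.uncurry u) := by
    refine measurable_uncurry_of_continuous_of_measurable (fun ω => ?_) fun a =>
      (hf.measurable a).indicator hSm.compl
    by_cases hω : ω ∈ S
    · simp only [u, Set.indicator_of_notMem (Set.notMem_compl_iff.2 hω)]; exact continuous_const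
    · simp only [u, Set.indicator_of_mem (show ω ∈ Sᶜ from hω)]
      by_contra hc
      exact hω (hS fun h => hc h.continuous)
  have h1 : Measurable fun ω => u (hη.mk η ω) ω :=
    hu.comp (hη.stronglyMeasurable_mk.measurable.prodMk measurable_id)
  refine ⟨_, h1.stronglyMeasurable, ?_⟩
  filter_upwards [hη.ae_eq_mk, measure_eq_zero_iff_ae_notMem.1 hSμ] with ω h1 h2
  simp [u, app, ← h1, h2]

end Measurability

/-! ### Convergence along measurable random subsequences. -/

section RandomSubsequence

variable {Ω : Type*} {m : MeasurableSpace Ω}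

lemma measurable_random_index {E : Type*} [MeasurableSpace E] {x : ℕ → Ω → E}
    (hx : ∀ n, Measurable (x n)) {σ : Ω → ℕ} (hσ : Measurable σ) :
    Measurable fun ω => x (σ ω) ω := by
  have : Measurable fun p : ℕ × Ω => x p.1 p.2 := measurable_from_prod_countable_right hx
  exact this.comp (hσ.prodMk measurable_id)

lemma frequently_near_liminf {x : ℕ → ℝ} (hx : ∀ n, |x n| ≤ 1) {ε : ℝ} (hε : 0 < ε) :
    ∃ᶠ n in atTop, |x n - liminf x atTop| < ε := by
  have hb1 : IsBoundedUnder (· ≥ ·) atTop x :=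
    isBoundedUnder_of ⟨-1, fun n => (abs_le.1 (hx n)).1⟩
  have hb2 : IsCoboundedUnder (· ≥ ·) atTop x :=
    (isBoundedUnder_of ⟨1, fun n => (abs_le.1 (hx n)).2⟩ :
      IsBoundedUnder (· ≤ ·) atTop x).isCoboundedUnder_ge
  have h1 : ∃ᶠ n in atTop, x n < liminf x atTop + ε :=
    frequently_lt_of_liminf_lt hb2 (by linarith)
  have h2 : ∀ᶠ n in atTop, liminf x atTop - ε < x n :=
    eventually_lt_of_lt_liminf (by linarith) hb1
  refine (h1.and_eventually h2).mono fun n hn => ?_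
  rw [abs_lt]
  constructor <;> linarith [hn.1, hn.2]

/-- A bounded sequence of random variables converges along a random subsequence. -/
lemma exists_random_subseq {x : ℕ → Ω → ℝ} (hx : ∀ n, Measurable (x n))
    (hb : ∀ n ω, |x n ω| ≤ 1) :
    ∃ σ : ℕ → Ω → ℕ, (∀ k, Measurable (σ k)) ∧ (∀ ω, StrictMono fun k => σ k ω) ∧
      ∀ ω, ∃ y, Tendsto (fun k => x (σ k ω) ω) atTop (𝓝 y) := by
  classical
  let L : Ω → ℝ := fun ω => liminf (fun n => x n ω) atTop
  have hL : Measurable L := Measurable.liminf hx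
  have step : ∀ (N : {N : Ω → ℕ // Measurable N}) (k : ℕ), ∃ N' : {N : Ω → ℕ // Measurable N},
      ∀ ω, N.1 ω < N'.1 ω ∧ |x (N'.1 ω) ω - L ω| < 1 / ((k : ℝ) + 1) := by
    rintro ⟨N, hN⟩ k
    have hp : ∀ ω, ∃ n, N ω < n ∧ |x n ω - L ω| < 1 / ((k : ℝ) + 1) := fun ω => by
      obtain ⟨n, hn, h⟩ := ((frequently_near_liminf (fun n => hb n ω)
        (show (0 : ℝ) < 1 / ((k : ℝ) + 1) by positivity)).and_eventually
        (eventually_gt_atTop (N ω))).exists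
      exact ⟨n, h, hn⟩
    refine ⟨⟨fun ω => Nat.find (hp ω), measurable_find hp fun n => ?_⟩,
      fun ω => Nat.find_spec (hp ω)⟩
    exact (measurableSet_lt hN measurable_const).inter
      (measurableSet_lt ((hx n).sub hL).abs measurable_const)
  choose next hnext using step
  let σ : ℕ → {N : Ω → ℕ // Measurable N} := fun k =>
    Nat.rec ⟨fun _ => 0, measurable_const⟩ (fun k N => next N k) k
  have hσ : ∀ k, σ (k + 1) = next (σ k) k := fun k => rfl
  -- The shift by one drops the initial index `0`, which need not be close to the lower limit.
  refine ⟨fun k => (σ (k + 1)).1, fun k => (σ (k + 1)).2, fun ω => strictMono_nat_of_lt_succ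
    fun k => (hnext (σ (k + 1)) (k + 1) ω).1, fun ω => ⟨L ω, ?_⟩⟩
  rw [tendsto_iff_dist_tendsto_zero]
  refine squeeze_zero (fun _ => dist_nonneg) (fun k => ?_) tendsto_one_div_add_atTop_nhds_zero_nat
  rw [Real.dist_eq]
  exact (hnext (σ k) k ω).2.le

lemma exists_random_subseq_finite {ι : Type*} (s : Finset ι) {x : ι → ℕ → Ω → ℝ}
    (hx : ∀ i n, Measurable (x i n)) (hb : ∀ i n ω, |x i n ω| ≤ 1) :
    ∃ σ : ℕ → Ω → ℕ, (∀ k, Measurable (σ k)) ∧ (∀ ω, StrictMono fun k => σ k ω) ∧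
      ∀ i ∈ s, ∀ ω, ∃ y, Tendsto (fun k => x i (σ k ω) ω) atTop (𝓝 y) := by
  classical
  induction s using Finset.induction_on with
  | empty => exact ⟨fun k _ => k, fun k => measurable_const, fun ω => strictMono_id, by simp⟩
  | insert i s _ ih =>
    obtain ⟨σ, h1, h2, h3⟩ := ih
    obtain ⟨τ, k1, k2, k3⟩ := exists_random_subseq
      (x := fun n ω => x i (σ n ω) ω) (fun n => measurable_random_index (hx i) (h1 n))
      fun n ω => hb _ _ _
    refine ⟨fun k ω => σ (τ k ω) ω, fun k => measurable_random_index h1 (k1 k),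
      fun ω => (h2 ω).comp (k2 ω), fun l hl ω => ?_⟩
    rcases Finset.mem_insert.1 hl with rfl | hl
    · exact k3 ω
    · obtain ⟨y, hy⟩ := h3 l hl ω
      exact ⟨y, hy.comp (k2 ω).tendsto_atTop⟩

/-- Along a random subsequence, a sequence of random matrices and its norms converge after
normalisation. -/
lemma exists_random_subseq_matrix {d : ℕ} {η : ℕ → Ω → Mat d}
    (hη : ∀ n, StronglyMeasurable (η n)) :
    ∃ σ : ℕ → Ω → ℕ, (∀ k, Measurable (σ k)) ∧ (∀ ω, StrictMono fun k => σ k ω) ∧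
      ∃ (y : Ω → ℝ) (ν : Ω → Mat d), ∀ ω,
        Tendsto (fun k => (1 + nrm (η (σ k ω) ω))⁻¹) atTop (𝓝 (y ω)) ∧
        Tendsto (fun k => (1 + nrm (η (σ k ω) ω))⁻¹ • η (σ k ω) ω) atTop (𝓝 (ν ω)) := by
  have hn : ∀ n, Measurable fun ω => nrm (η n ω) := fun n =>
    (continuous_nrm.comp_stronglyMeasurable (hη n)).measurable
  have he : ∀ n i j, Measurable fun ω => η n ω i j := fun n i j =>
    ((continuous_entry i j).comp_stronglyMeasurable (hη n)).measurable
  -- The index `none` records the normalising factor itself, the others the normalised entries; all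
  -- are bounded by one.
  let x : Option (Fin d × Fin d) → ℕ → Ω → ℝ := fun o n ω =>
    (1 + nrm (η n ω))⁻¹ * o.elim 1 fun p => η n ω p.1 p.2
  have hpos : ∀ n ω, 0 < 1 + nrm (η n ω) := fun n ω => by linarith [nrm_nonneg (η n ω)]
  obtain ⟨σ, h1, h2, h3⟩ := exists_random_subseq_finite Finset.univ (x := x)
    (fun o n => by
      refine ((hn n).const_add 1).inv.mul ?_
      cases o with
      | none => exact measurable_const
      | some p => exact he n p.1 p.2)
    (fun o n ω => by
      simp only [x, abs_mul, abs_inv, abs_of_pos (hpos n ω)]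
      rw [inv_mul_le_iff₀ (hpos n ω)]
      cases o with
      | none => simpa using nrm_nonneg _
      | some p => simpa using (abs_entry_le_nrm p.1 p.2 (η n ω)).trans (by linarith))
  choose y hy using h3
  refine ⟨σ, h1, h2, y none (Finset.mem_univ _),
    fun ω => Matrix.of fun i j => y (some (i, j)) (Finset.mem_univ _) ω, fun ω => ⟨?_, ?_⟩⟩
  · simpa [x] using hy none (Finset.mem_univ _) ω
  · refine tendsto_pi_nhds.2 fun i => tendsto_pi_nhds.2 fun j => ?_
    simpa [x] using hy (some (i, j)) (Finset.mem_univ _) ω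

end RandomSubsequence

/-- Convex cones of random vectors that are closed under almost sure convergence, stable under
multiplication by nonnegative `m`-measurable scalars, and solid downwards. -/
structure IsClosedCone {Ω : Type*} {mΩ : MeasurableSpace Ω} (μ : Measure Ω) {d : ℕ}
    (m : MeasurableSpace Ω) (C : Set (Ω → Fin d → ℝ)) : Prop where
  aestronglyMeasurable : ∀ c ∈ C, AEStronglyMeasurable[mΩ] c μ
  congr : ∀ c ∈ C, ∀ c', c =ᵐ[μ] c' → c' ∈ C
  zero : 0 ∈ C
  add : ∀ c ∈ C, ∀ c' ∈ C, c + c' ∈ C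
  smul : ∀ l : Ω → ℝ, AEStronglyMeasurable[m] l μ → (∀ᵐ ω ∂μ, 0 ≤ l ω) → ∀ c ∈ C,
    (fun ω => l ω • c ω) ∈ C
  sub : ∀ c ∈ C, ∀ r ∈ L0 μ (orthant d) mΩ, c - r ∈ C
  lim : ∀ (c : ℕ → Ω → Fin d → ℝ) (lim : Ω → Fin d → ℝ), (∀ n, c n ∈ C) →
    (∀ᵐ ω ∂μ, Tendsto (fun n => c n ω) atTop (𝓝 (lim ω))) → lim ∈ C

/-- The sum of the values of a random map at random elements of the cone and of a set. -/
def valueSum {Ω : Type*} {mΩ : MeasurableSpace Ω} (μ : Measure Ω) {d : ℕ} (m : MeasurableSpace Ω)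
    (A : ProperCone ℝ (Mat d)) (f : Ω → Mat d → Fin d → ℝ) (C : Set (Ω → Fin d → ℝ)) :
    Set (Ω → Fin d → ℝ) :=
  {g | ∃ η ∈ L0 μ (A : Set (Mat d)) m, ∃ c ∈ C, g =ᵐ[μ] app f η + c}

/-! ### Closed cones of random vectors. -/

section Cones

variable {Ω : Type*} {mΩ : MeasurableSpace Ω} {μ : Measure Ω} {d : ℕ}
  {A : ProperCone ℝ (Mat d)} {f : Ω → Mat d → Fin d → ℝ} {C : Set (Ω → Fin d → ℝ)}

lemma IsClosedCone.mono {m m' : MeasurableSpace Ω} (hm : m' ≤ m) (h : IsClosedCone μ m C) :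
    IsClosedCone μ m' C :=
  { h with smul := fun l hl => h.smul l (hl.mono hm) }

lemma IsClosedCone.indicator {m : MeasurableSpace Ω} (h : IsClosedCone μ m C) {S : Set Ω}
    (hS : MeasurableSet[m] S) {c : Ω → Fin d → ℝ} (hc : c ∈ C) : S.indicator c ∈ C := by
  have := h.smul (S.indicator fun _ => 1)
    (stronglyMeasurable_const.indicator hS).aestronglyMeasurable
    (Eventually.of_forall fun ω => Set.indicator_nonneg (fun _ _ => zero_le_one) ω) c hc
  convert this using 1
  ext ω i
  by_cases hω : ω ∈ S <;> simp [hω]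

lemma IsClosedCone.smul_of_neg {m : MeasurableSpace Ω} (h : IsClosedCone μ m C)
    {c : Ω → Fin d → ℝ} (hc : c ∈ C) (hc' : -c ∈ C) {l : Ω → ℝ}
    (hl : AEStronglyMeasurable[m] l μ) : (fun ω => l ω • c ω) ∈ C := by
  have h1 := h.smul (fun ω => max (l ω) 0) (by
    exact (continuous_id.max continuous_const).comp_aestronglyMeasurable hl)
    (Eventually.of_forall fun ω => le_max_right _ _) c hc
  have h2 := h.smul (fun ω => max (-l ω) 0) (by
    exact (continuous_neg.max continuous_const).comp_aestronglyMeasurable hl)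
    (Eventually.of_forall fun ω => le_max_right _ _) _ hc'
  convert h.add _ h1 _ h2 using 1
  ext ω i
  simp only [Pi.add_apply, Pi.smul_apply, Pi.neg_apply, smul_eq_mul]
  have : max (l ω) 0 - max (-l ω) 0 = l ω := by
    rcases le_total 0 (l ω) with h | h
    · rw [max_eq_left h, max_eq_right (by linarith)]; ring
    · rw [max_eq_right h, max_eq_left (by linarith)]; ring
  nth_rw 1 [← this]
  ring

/-- The cone is stable under gluing along the partition into the events `{σ = n}`: finite partial
gluings belong to it, and at each `ω` they are eventually constant. -/
lemma IsClosedCone.random_index {m : MeasurableSpace Ω} (h : IsClosedCone μ m C)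
    {c : ℕ → Ω → Fin d → ℝ} (hc : ∀ n, c n ∈ C) {σ : Ω → ℕ} (hσ : Measurable[m] σ) :
    (fun ω => c (σ ω) ω) ∈ C := by
  have hsum : ∀ N : ℕ, (fun ω => ∑ n ∈ Finset.range N, (σ ⁻¹' {n}).indicator (c n) ω) ∈ C := by
    intro N
    induction N with
    | zero =>
      simp only [Finset.range_zero, Finset.sum_empty]
      exact h.zero
    | succ N ih =>
      simp only [Finset.sum_range_succ]
      exact h.add _ ih _ (h.indicator (hσ (measurableSet_singleton N)) (hc N))
  refine h.lim _ _ hsum (Eventually.of_forall fun ω => ?_)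
  refine tendsto_const_nhds.congr' ?_
  filter_upwards [eventually_gt_atTop (σ ω)] with N hN
  rw [Finset.sum_eq_single (σ ω)]
  · simp
  · intro n _ hn
    simp [Ne.symm hn]
  · intro hn
    exact absurd (Finset.mem_range.2 hN) hn

variable {m : MeasurableSpace Ω}

/-- Transferring `η + η'` at once is at least as good as transferring separately; the nonnegative
surplus is thrown away inside the solid cone `C`. -/
lemma valueSum_add (hf : IsRandomTransferMap μ A f) (hm : m ≤ mΩ) (hC : IsClosedCone μ m C)
    {g g' : Ω → Fin d → ℝ} (hg : g ∈ valueSum μ m A f C) (hg' : g' ∈ valueSum μ m A f C) :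
    g + g' ∈ valueSum μ m A f C := by
  obtain ⟨η, hη, c, hc, hg⟩ := hg
  obtain ⟨η', hη', c', hc', hg'⟩ := hg'
  have hs := L0.add hη hη'
  refine ⟨η + η', hs, c + c' - (app f (η + η') - app f η - app f η'),
    hC.sub _ (hC.add _ hc _ hc') _ ⟨?_, ?_⟩, ?_⟩
  · exact ((hf.app_aestronglyMeasurable (hs.1.mono hm)).sub
      (hf.app_aestronglyMeasurable (hη.1.mono hm))).sub
      (hf.app_aestronglyMeasurable (hη'.1.mono hm))
  · filter_upwards [hf.transfer, hη.2, hη'.2] with ω h1 h2 h3 i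
    have := h1.le_add h2 h3 i
    simp only [app, Pi.sub_apply, Pi.add_apply]
    linarith
  · filter_upwards [hg, hg'] with ω h1 h2
    simp only [Pi.add_apply, Pi.sub_apply, h1, h2]
    abel

lemma valueSum_sum (hf : IsRandomTransferMap μ A f) (hm : m ≤ mΩ) (hC : IsClosedCone μ m C)
    {ι : Type*} (s : Finset ι) {g : ι → Ω → Fin d → ℝ} (hg : ∀ i ∈ s, g i ∈ valueSum μ m A f C) :
    ∑ i ∈ s, g i ∈ valueSum μ m A f C := by
  classical
  induction s using Finset.induction_on with
  | empty =>
    refine ⟨0, L0.zero, 0, hC.zero, ?_⟩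
    filter_upwards [hf.transfer] with ω h
    simp [app, h.map_zero]
  | insert i s hi ih =>
    rw [Finset.sum_insert hi]
    exact valueSum_add hf hm hC (hg i (Finset.mem_insert_self i s))
      (ih fun j hj => hg j (Finset.mem_insert_of_mem hj))

end Cones

/-! ### Closedness when one date is added. -/

section ClosedStep

variable {Ω : Type*} {mΩ : MeasurableSpace Ω} {μ : Measure Ω} {d : ℕ}
  {A : ProperCone ℝ (Mat d)} {f : Ω → Mat d → Fin d → ℝ} {C : Set (Ω → Fin d → ℝ)}
  {m : MeasurableSpace Ω}

lemma sum_abs_entry (a : Mat d) : ∑ p : Fin d × Fin d, |a p.1 p.2| = nrm a := by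
  simp only [nrm, Fintype.sum_prod_type, coef]
  simp [posPart_add_negPart]

/-- If strategies that can be offset inside `C` are reversible, then limits of sums are sums. -/
lemma valueSum_of_tendsto (hf : IsRandomTransferMap μ A f) (hm : m ≤ mΩ)
    (hC : IsClosedCone μ m C)
    (null : ∀ η ∈ L0 μ (A : Set (Mat d)) m, ∀ c ∈ C, app f η + c =ᵐ[μ] 0 →
      -η ∈ L0 μ (A : Set (Mat d)) m ∧ app f (-η) =ᵐ[μ] -app f η ∧ -c ∈ C)
    (J : Finset (Fin d × Fin d)) :
    ∀ (η : ℕ → Ω → Mat d) (c : ℕ → Ω → Fin d → ℝ) (g : Ω → Fin d → ℝ),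
      (∀ n, η n ∈ L0 μ (A : Set (Mat d)) m) →
      (∀ n, ∀ᵐ ω ∂μ, ∀ p ∉ J, η n ω p.1 p.2 = 0) → (∀ n, c n ∈ C) →
      (∀ᵐ ω ∂μ, Tendsto (fun n => f ω (η n ω) + c n ω) atTop (𝓝 (g ω))) →
      g ∈ valueSum μ m A f C := by
  induction J using Finset.strongInduction with
  | H J ih =>
  intro η₀ c₀ g hη₀ hJ₀ hc₀ hlim₀
  choose η₁ hη₁m hη₁A hη₁ using fun n => L0.exists_version (hη₀ n)
  obtain ⟨σ, hσm, hσ, y, ν, hyν⟩ := exists_random_subseq_matrix hη₁m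
  let η : ℕ → Ω → Mat d := fun k ω => η₁ (σ k ω) ω
  let c : ℕ → Ω → Fin d → ℝ := fun k ω => c₀ (σ k ω) ω
  let u : ℕ → Ω → ℝ := fun k ω => (1 + nrm (η k ω))⁻¹
  have hηm : ∀ k, StronglyMeasurable[m] (η k) := fun k => by
    borelize (Mat d)
    exact (measurable_random_index (fun n => (hη₁m n).measurable) (hσm k)).stronglyMeasurable
  have hηA : ∀ k ω, η k ω ∈ A := fun k ω => hη₁A _ _
  have hηL : ∀ k, η k ∈ L0 μ (A : Set (Mat d)) m := fun k =>
    ⟨(hηm k).aestronglyMeasurable, Eventually.of_forall (hηA k)⟩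
  have hc : ∀ k, c k ∈ C := fun k => hC.random_index hc₀ (hσm k)
  have hlim : ∀ᵐ ω ∂μ, Tendsto (fun k => f ω (η k ω) + c k ω) atTop (𝓝 (g ω)) := by
    filter_upwards [hlim₀, ae_all_iff.2 hη₁] with ω h1 h2
    simp only [h2] at h1
    exact h1.comp (hσ ω).tendsto_atTop
  have hJ : ∀ k, ∀ᵐ ω ∂μ, ∀ p ∉ J, η k ω p.1 p.2 = 0 := fun k => by
    filter_upwards [ae_all_iff.2 hJ₀, ae_all_iff.2 hη₁] with ω h1 h2 p hp
    simp only [η, ← h2]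
    exact h1 _ p hp
  have hpos : ∀ k ω, 0 < 1 + nrm (η k ω) := fun k ω => by linarith [nrm_nonneg (η k ω)]
  have hu0 : ∀ k ω, 0 < u k ω := fun k ω => inv_pos.2 (hpos k ω)
  have huη : ∀ k ω, (u k ω)⁻¹ • (u k ω • η k ω) = η k ω := fun k ω => by
    rw [smul_smul, inv_mul_cancel₀ (hu0 k ω).ne', one_smul]
  have hum : ∀ k, StronglyMeasurable[m] (u k) := fun k =>
    ((continuous_nrm.comp_stronglyMeasurable (hηm k)).measurable.const_add
      1).inv.stronglyMeasurable
  have hy : ∀ ω, Tendsto (fun k => u k ω) atTop (𝓝 (y ω)) := fun ω => (hyν ω).1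
  have hν : ∀ ω, Tendsto (fun k => u k ω • η k ω) atTop (𝓝 (ν ω)) := fun ω => (hyν ω).2
  have hym : StronglyMeasurable[m] y :=
    stronglyMeasurable_of_tendsto atTop hum (tendsto_pi_nhds.2 hy)
  have hνm : StronglyMeasurable[m] ν :=
    stronglyMeasurable_of_tendsto atTop (fun k => (hum k).smul (hηm k)) (tendsto_pi_nhds.2 hν)
  have hνA : ∀ ω, ν ω ∈ A := fun ω => A.isClosed.mem_of_tendsto (hν ω)
    (Eventually.of_forall fun k => A.smul_mem (hηA k ω) (hu0 k ω).le)
  have hy0 : ∀ ω, 0 ≤ y ω := fun ω => ge_of_tendsto' (hy ω) fun k => (hu0 k ω).le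
  -- Thus the limit direction has norm one exactly where the norms of the strategies explode, that
  -- is, where `y` vanishes.
  have hνn : ∀ ω, nrm (ν ω) = 1 - y ω := fun ω => by
    refine tendsto_nhds_unique ((continuous_nrm.tendsto _).comp (hν ω)) ?_
    refine ((tendsto_const_nhds (x := (1 : ℝ))).sub (hy ω)).congr fun k => ?_
    simp only [Function.comp, nrm_smul (hu0 k ω).le]
    have := mul_inv_cancel₀ (hpos k ω).ne'
    change 1 - u k ω = _
    change (1 + nrm (η k ω)) * u k ω = 1 at this
    linarith
  let B : Set Ω := {ω | y ω = 0}
  have hB : MeasurableSet[m] B := hym.measurable (measurableSet_singleton 0)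
  -- the part where the strategies stay bounded
  have part1 : Bᶜ.indicator g ∈ valueSum μ m A f C := by
    let η' : Ω → Mat d := fun ω => (y ω)⁻¹ • ν ω
    have hη' : η' ∈ L0 μ (A : Set (Mat d)) m :=
      ⟨(hym.measurable.inv.stronglyMeasurable.smul hνm).aestronglyMeasurable,
        Eventually.of_forall fun ω => A.smul_mem (hνA ω) (inv_nonneg.2 (hy0 ω))⟩
    refine ⟨η', hη', Bᶜ.indicator (g - app f η'), ?_, ?_⟩
    · refine hC.lim (fun k => Bᶜ.indicator (c k)) _
        (fun k => hC.indicator (hB.compl) (hc k)) ?_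
      filter_upwards [hlim, hf.transfer] with ω h1 h2
      by_cases hω : ω ∈ B
      · simp [hω]
      · simp only [Set.indicator_of_mem (show ω ∈ Bᶜ from hω)]
        have h3 : Tendsto (fun k => η k ω) atTop (𝓝 (η' ω)) := by
          have := ((hy ω).inv₀ hω).smul (hν ω)
          simpa only [huη] using this
        have := h1.sub ((h2.continuous.tendsto _).comp h3)
        simpa [app] using this
    · filter_upwards [hf.transfer] with ω h2
      by_cases hω : ω ∈ B
      · have : y ω = 0 := hω
        simp [app, η', hω, this, h2.map_zero]
      · simp [app, hω]
  -- the part where they explode, which yields a reversible strategy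
  let ν₁ : Ω → Mat d := B.indicator ν
  have hν₁ : ν₁ ∈ L0 μ (A : Set (Mat d)) m :=
    ⟨(hνm.indicator hB).aestronglyMeasurable, Eventually.of_forall fun ω => by
      by_cases hω : ω ∈ B
      · simpa [ν₁, hω] using hνA ω
      · simp [ν₁, hω]⟩
  -- On `B` the factor `u` kills the convergent sum `f (η k) + c k`; by homogeneity `u • c k` then
  -- converges to `-f ν`.
  have hc1 : -app f ν₁ ∈ C := by
    refine hC.lim (fun k ω => (B.indicator (u k) ω) • c k ω) _ (fun k => hC.smul _
      ((hum k).indicator hB).aestronglyMeasurable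
      (Eventually.of_forall fun ω => Set.indicator_nonneg (fun _ _ => (hu0 k _).le) ω) _ (hc k)) ?_
    filter_upwards [hlim, hf.transfer] with ω h1 h2
    by_cases hω : ω ∈ B
    · have hyω : y ω = 0 := hω
      simp only [Set.indicator_of_mem hω, ν₁, app, Pi.neg_apply]
      have h3 := (hy ω).smul h1
      rw [hyω, zero_smul] at h3
      have h4 := h3.sub ((h2.continuous.tendsto _).comp (hν ω))
      rw [zero_sub] at h4
      refine h4.congr fun k => ?_
      simp only [Function.comp, h2.map_smul (hu0 k ω).le]
      rw [smul_add]; abel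
    · simp [hω, ν₁, app, h2.map_zero]
  obtain ⟨hneg, hfneg, hc2⟩ := null ν₁ hν₁ _ hc1 (by filter_upwards with ω; simp)
  have hJν : ∀ᵐ ω ∂μ, ∀ p ∉ J, ν₁ ω p.1 p.2 = 0 := by
    filter_upwards [ae_all_iff.2 hJ] with ω h p hp
    by_cases hω : ω ∈ B
    · simp only [ν₁, Set.indicator_of_mem hω]
      refine tendsto_nhds_unique (((continuous_entry p.1 p.2).tendsto _).comp (hν ω)) ?_
      refine tendsto_const_nhds.congr fun k => ?_
      simp [h k p hp]
    · simp [ν₁, hω]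
  have hν₁m : ∀ p : Fin d × Fin d, Measurable[m] fun ω => ν₁ ω p.1 p.2 := fun p =>
    ((continuous_entry p.1 p.2).comp_stronglyMeasurable (hνm.indicator hB)).measurable
  have part2 : ∀ p ∈ J, (fun ω => |ν₁ ω p.1 p.2| • g ω) ∈ valueSum μ m A f C := by
    intro p hp
    -- This multiple of `ν₁` cancels the entry `p` of `|ν_p| • η k`, because `ν_p * sign ν_p =
    -- |ν_p|`. Its sign is arbitrary, which is harmless as `ν₁` is reversible, and its transfer is
    -- compensated in `C`, which contains both `f ν₁` and `-f ν₁`.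
    let κ : ℕ → Ω → ℝ := fun k ω => -(η k ω p.1 p.2 * (SignType.sign (ν₁ ω p.1 p.2) : ℝ))
    have hκ : ∀ k, AEStronglyMeasurable[m] (κ k) μ := fun k => by
      have h1 : Measurable[m] fun ω => η k ω p.1 p.2 :=
        ((continuous_entry p.1 p.2).comp_stronglyMeasurable (hηm k)).measurable
      have h2 : Measurable fun x : ℝ => (SignType.sign x : ℝ) := by
        have : (fun x : ℝ => (SignType.sign x : ℝ)) =
            fun x => if 0 < x then 1 else if x < 0 then -1 else 0 := by
          ext x
          rw [sign_apply]
          split_ifs <;> simp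
        rw [this]
        exact Measurable.ite measurableSet_Ioi measurable_const
          (Measurable.ite measurableSet_Iio measurable_const measurable_const)
      exact (h1.mul (h2.comp (hν₁m p))).neg.stronglyMeasurable.aestronglyMeasurable
    have habs : AEStronglyMeasurable[m] (fun ω => |ν₁ ω p.1 p.2|) μ :=
      (continuous_abs.comp_stronglyMeasurable (hν₁m p).stronglyMeasurable).aestronglyMeasurable
    have split : ∀ k, ∀ᵐ ω ∂μ, κ k ω • ν₁ ω ∈ A ∧
        f ω (|ν₁ ω p.1 p.2| • η k ω + κ k ω • ν₁ ω) =
          |ν₁ ω p.1 p.2| • f ω (η k ω) + κ k ω • f ω (ν₁ ω) := fun k => by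
      filter_upwards [hf.transfer, hν₁.2, hneg.2, hfneg] with ω h1 h2 h3 h4
      have h5 : |ν₁ ω p.1 p.2| • η k ω ∈ A := A.smul_mem (hηA k ω) (abs_nonneg _)
      have := h1.add_smul_of_neg h5 h2 h3 h4 (κ k ω)
      rw [h1.map_smul (abs_nonneg _)] at this
      exact ⟨this.1, this.2.2⟩
    refine ih (J.erase p) (Finset.erase_ssubset hp)
      (fun k ω => |ν₁ ω p.1 p.2| • η k ω + κ k ω • ν₁ ω)
      (fun k ω => |ν₁ ω p.1 p.2| • c k ω - κ k ω • f ω (ν₁ ω)) _ (fun k => ?_) (fun k => ?_)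
      (fun k => ?_) ?_
    · refine ⟨(habs.smul (hηm k).aestronglyMeasurable).add ((hκ k).smul hν₁.1), ?_⟩
      filter_upwards [split k] with ω h
      exact A.add_mem (A.smul_mem (hηA k ω) (abs_nonneg _)) h.1
    · filter_upwards [hJ k, hJν] with ω h1 h2 q hq
      by_cases hqp : q = p
      · subst hqp
        simp only [Matrix.add_apply, Matrix.smul_apply, smul_eq_mul, κ]
        have := sign_mul_self (ν₁ ω q.1 q.2)
        linear_combination (-η k ω q.1 q.2) * this
      · have hq' : q ∉ J := fun h => hq (Finset.mem_erase.2 ⟨hqp, h⟩)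
        simp [h1 q hq', h2 q hq']
    · have h1 := hC.smul _ habs (Eventually.of_forall fun ω => abs_nonneg _) _ (hc k)
      have h2 := hC.smul_of_neg hc1 hc2 (hκ k)
      convert hC.add _ h1 _ h2 using 1
      ext ω i
      simp [app]
      ring
    · filter_upwards [hlim, ae_all_iff.2 split] with ω h1 h2
      refine (h1.const_smul |ν₁ ω p.1 p.2|).congr fun k => ?_
      rw [(h2 k).2, smul_add]; abel
  have htot := valueSum_add hf hm hC part1 (valueSum_sum hf hm hC J part2)
  obtain ⟨η', hη', c', hc', h'⟩ := htot
  refine ⟨η', hη', c', hc', Filter.EventuallyEq.trans ?_ h'⟩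
  filter_upwards [hJν] with ω h
  -- The weights add up to the norm of `ν₁`, so the pieces `|ν_p| • g` recombine to `g` on `B`.
  -- Hence no choice of a nonvanishing entry is needed.
  have hsum : ∑ p ∈ J, |ν₁ ω p.1 p.2| = B.indicator 1 ω := by
    have h1 : ∑ p ∈ J, |ν₁ ω p.1 p.2| = nrm (ν₁ ω) := by
      rw [← sum_abs_entry]
      exact Finset.sum_subset (Finset.subset_univ J) fun p _ hp => by simp [h p hp]
    rw [h1]
    by_cases hω : ω ∈ B
    · have hyω : y ω = 0 := hω
      simp [ν₁, hω, hνn, hyω]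
    · simp [ν₁, hω, nrm, coef]
  simp only [Pi.add_apply, Finset.sum_apply]
  rw [← Finset.sum_smul, hsum]
  by_cases hω : ω ∈ B <;> simp [hω]

/-- Adding the values of a random map to a closed cone keeps it closed if strategies that can be
offset are reversible. -/
lemma IsClosedCone.valueSum (hf : IsRandomTransferMap μ A f) (hm : m ≤ mΩ)
    (hC : IsClosedCone μ m C)
    (null : ∀ η ∈ L0 μ (A : Set (Mat d)) m, ∀ c ∈ C, app f η + c =ᵐ[μ] 0 →
      -η ∈ L0 μ (A : Set (Mat d)) m ∧ app f (-η) =ᵐ[μ] -app f η ∧ -c ∈ C) :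
    IsClosedCone μ m (valueSum μ m A f C) where
  aestronglyMeasurable := by
    rintro g ⟨η, hη, c, hc, hg⟩
    exact ((hf.app_aestronglyMeasurable (hη.1.mono hm)).add
      (hC.aestronglyMeasurable c hc)).congr hg.symm
  congr := by
    rintro g ⟨η, hη, c, hc, hg⟩ g' hg'
    exact ⟨η, hη, c, hc, hg'.symm.trans hg⟩
  zero := by
    simpa using valueSum_sum hf hm hC (∅ : Finset ℕ) (g := fun _ => 0)
      (fun i hi => absurd hi (Finset.notMem_empty i))
  add := fun c hc c' hc' => valueSum_add hf hm hC hc hc'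
  smul := by
    rintro l hl hl0 g ⟨η, hη, c, hc, hg⟩
    refine ⟨_, L0.smul hη hl hl0, _, hC.smul l hl hl0 c hc, ?_⟩
    filter_upwards [hg, hf.transfer, hl0] with ω h1 h2 h3
    simp [app, h1, h2.map_smul h3]
  sub := by
    rintro g ⟨η, hη, c, hc, hg⟩ r hr
    refine ⟨η, hη, c - r, hC.sub c hc r hr, ?_⟩
    filter_upwards [hg] with ω h1
    simp only [Pi.sub_apply, Pi.add_apply, h1]
    abel
  lim := by
    intro g g' hg hlim
    choose η hη c hc h using hg
    refine valueSum_of_tendsto hf hm hC null Finset.univ η c g' hη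
      (fun n => Eventually.of_forall fun ω p hp => absurd (Finset.mem_univ p) hp) hc ?_
    filter_upwards [hlim, ae_all_iff.2 h] with ω h1 h2
    refine h1.congr fun n => ?_
    rw [h2 n]; rfl

end ClosedStep

/-! ### Reversibility: its consequences and the no-arbitrage conditions implying it. -/

section Reversibility

variable {Ω : Type*} {mΩ : MeasurableSpace Ω} {μ : Measure Ω} {d T : ℕ}
  {H : Filtration (Fin (T + 1)) mΩ} {A : ProperCone ℝ (Mat d)}
  {F : Fin (T + 1) → Ω → Mat d → Fin d → ℝ}

/-- Strategies with a nonnegative total transfer have zero total and reversible transfers. -/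
def Reversible (μ : Measure Ω) (H : Filtration (Fin (T + 1)) mΩ) (A : ProperCone ℝ (Mat d))
    (F : Fin (T + 1) → Ω → Mat d → Fin d → ℝ) : Prop :=
  ∀ η ∈ Strategies μ H A, ∀ r ∈ L0 μ (orthant d) mΩ, ∑ s, app (F s) (η s) =ᵐ[μ] r →
    r =ᵐ[μ] 0 ∧ ∀ s, app (F s) (η s) ∈ N0 μ H A F s

lemma IsModel.isRandomTransferMap (hF : IsModel μ A F) (t : Fin (T + 1)) :
    IsRandomTransferMap μ A (F t) := ⟨hF.1 t, hF.2 t⟩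

lemma IsModel.aestronglyMeasurable (hF : IsModel μ A F) {t : Fin (T + 1)} {η : Ω → Mat d}
    (hη : η ∈ L0 μ (A : Set (Mat d)) (H t)) : AEStronglyMeasurable (app (F t) η) μ :=
  (hF.isRandomTransferMap t).app_aestronglyMeasurable (hη.1.mono (H.le t))

lemma IsModel.app_zero (hF : IsModel μ A F) (t : Fin (T + 1)) : app (F t) 0 =ᵐ[μ] 0 := by
  filter_upwards [hF.2 t] with ω h
  simp [app, h.map_zero]

lemma update_mem_strategies {η : Fin (T + 1) → Ω → Mat d} (hη : η ∈ Strategies μ H A)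
    {t : Fin (T + 1)} {θ : Ω → Mat d} (hθ : θ ∈ L0 μ (A : Set (Mat d)) (H t)) :
    Function.update η t θ ∈ Strategies μ H A := by
  intro s
  by_cases hs : s = t
  · subst hs; simpa using hθ
  · simpa [hs] using hη s

/-- The superadditivity gap of a random transfer map is nonnegative. -/
lemma IsModel.gap_mem (hF : IsModel μ A F) {t : Fin (T + 1)} {η η' : Ω → Mat d}
    (hη : η ∈ L0 μ (A : Set (Mat d)) (H t)) (hη' : η' ∈ L0 μ (A : Set (Mat d)) (H t)) :
    app (F t) (η + η') - app (F t) η - app (F t) η' ∈ L0 μ (orthant d) mΩ := by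
  refine ⟨((hF.aestronglyMeasurable (L0.add hη hη')).sub (hF.aestronglyMeasurable hη)).sub
    (hF.aestronglyMeasurable hη'), ?_⟩
  filter_upwards [hF.2 t, hη.2, hη'.2] with ω h1 h2 h3 i
  have := h1.le_add h2 h3 i
  simp only [app, Pi.sub_apply, Pi.add_apply]
  linarith

/-- Merging `η'` into the strategy at date `t` adds the superadditivity gap to `r`; reversibility
kills both. HN⁰ then reverses `η t + η'`, and `-η'` is that reversal plus `η t`. Superadditivity for
this sum and for `η' + (-η') = 0` bounds the transfer of `-η'` from both sides. -/
lemma Reversible.offset (hR : Reversible μ H A F) (hF : IsModel μ A F) (hN : HN0 μ H A F)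
    {η : Fin (T + 1) → Ω → Mat d} (hη : η ∈ Strategies μ H A) {t : Fin (T + 1)} {η' : Ω → Mat d}
    (hη' : η' ∈ L0 μ (A : Set (Mat d)) (H t)) {r : Ω → Fin d → ℝ} (hr : r ∈ L0 μ (orthant d) mΩ)
    (h : ∑ s, app (F s) (η s) + app (F t) η' =ᵐ[μ] r) :
    r =ᵐ[μ] 0 ∧ -η' ∈ L0 μ (A : Set (Mat d)) (H t) ∧ app (F t) (-η') =ᵐ[μ] -app (F t) η' := by
  have hgap := hF.gap_mem (hη t) hη'
  have hθ := L0.add (hη t) hη'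
  obtain ⟨hr0, hnull⟩ := hR _ (update_mem_strategies hη hθ) _ (orthant_add hr hgap) (by
    filter_upwards [h] with ω hω
    rw [← Finset.add_sum_erase _ _ (Finset.mem_univ t)] at hω ⊢
    have : ∑ s ∈ Finset.univ.erase t, app (F s) (Function.update η t (η t + η') s) =
        ∑ s ∈ Finset.univ.erase t, app (F s) (η s) :=
      Finset.sum_congr rfl fun s hs => by
        rw [Function.update_of_ne (Finset.ne_of_mem_erase hs)]
    simp only [this, Function.update_self]
    simp only [Pi.add_apply, Pi.sub_apply] at hω ⊢
    rw [← hω]; abel)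
  have hboth : ∀ᵐ ω ∂μ, r ω = 0 ∧
      app (F t) (η t + η') ω = app (F t) (η t) ω + app (F t) η' ω := by
    filter_upwards [hr0, hr.2, hgap.2] with ω h1 h2 h3
    have h4 : ∀ i, r ω i = 0 ∧
        (app (F t) (η t + η') - app (F t) (η t) - app (F t) η') ω i = 0 := fun i => by
      have e1 := congrFun h1 i
      have e2 := h2 i
      have e3 := h3 i
      simp only [Pi.add_apply, Pi.zero_apply] at e1
      constructor <;> linarith
    refine ⟨funext fun i => (h4 i).1, funext fun i => ?_⟩
    have := (h4 i).2
    simp only [Pi.sub_apply] at this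
    simp only [Pi.add_apply]
    linarith
  have hN' := hN t _ hθ (by simpa using hnull t)
  have hneg : -η' ∈ L0 μ (A : Set (Mat d)) (H t) := by
    convert L0.add hN'.2 (hη t) using 1
    abel
  refine ⟨hboth.mono fun ω hω => hω.1, hneg, ?_⟩
  filter_upwards [hboth, hN'.1, hF.2 t, hN'.2.2, (hη t).2, hη'.2, hneg.2]
    with ω h1 h2 h3 h4 h5 h6 h7
  ext i
  have e1 := h3.le_add h4 h5 i
  have e2 := h3.le_add h6 h7 i
  have e3 := congrFun h1.2 i
  have e4 := congrFun h2 i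
  have : (-(η t + η')) ω + η t ω = -η' ω := by simp
  rw [this] at e1
  simp only [app, Pi.add_apply, Pi.neg_apply, add_neg_cancel, h3.map_zero, Pi.zero_apply]
    at e1 e2 e3 e4 ⊢
  linarith

/-- Total transfers from time `k` on, minus nonnegative random vectors. -/
def tail (μ : Measure Ω) (H : Filtration (Fin (T + 1)) mΩ) (A : ProperCone ℝ (Mat d))
    (F : Fin (T + 1) → Ω → Mat d → Fin d → ℝ) (k : ℕ) : Set (Ω → Fin d → ℝ) :=
  {g | ∃ η ∈ Strategies μ H A, ∃ r ∈ L0 μ (orthant d) mΩ,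
    g =ᵐ[μ] ∑ s with k ≤ Fin.val s, app (F s) (η s) - r}

lemma attainable_last : Attainable μ H A F (Fin.last T) = tail μ H A F 0 := by
  have huniv : Finset.Iic (Fin.last T) = Finset.univ := by
    ext s; simp [Fin.le_last]
  ext g
  constructor
  · rintro ⟨ξ, hξ, r, hr, hg⟩
    choose η hη h using hξ
    refine ⟨η, hη, r, hr, hg.trans ?_⟩
    filter_upwards [ae_all_iff.2 h] with ω hω
    simp [V, huniv, hω]
  · rintro ⟨η, hη, r, hr, hg⟩
    refine ⟨fun s => app (F s) (η s), fun s => ⟨η s, hη s, EventuallyEq.rfl⟩, r, hr, hg.trans ?_⟩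
    filter_upwards with ω
    simp [V, huniv]

lemma tail_eq_valueSum {k : ℕ} (hk : k < T + 1) :
    tail μ H A F k = valueSum μ (H ⟨k, hk⟩) A (F ⟨k, hk⟩) (tail μ H A F (k + 1)) := by
  have hsplit : (Finset.univ.filter fun s : Fin (T + 1) => k ≤ s.val) =
      insert ⟨k, hk⟩ (Finset.univ.filter fun s : Fin (T + 1) => k + 1 ≤ s.val) := by
    ext s
    simp only [Finset.mem_filter, Finset.mem_univ, true_and, Finset.mem_insert, Fin.ext_iff]
    omega
  have hnot : (⟨k, hk⟩ : Fin (T + 1)) ∉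
      Finset.univ.filter fun s : Fin (T + 1) => k + 1 ≤ s.val := by simp
  ext g
  constructor
  · rintro ⟨η, hη, r, hr, hg⟩
    refine ⟨η ⟨k, hk⟩, hη _, _, ⟨η, hη, r, hr, EventuallyEq.rfl⟩, hg.trans ?_⟩
    rw [hsplit, Finset.sum_insert hnot, add_sub_assoc]
  · rintro ⟨η', hη', c, ⟨η, hη, r, hr, hc⟩, hg⟩
    refine ⟨_, update_mem_strategies hη hη', r, hr, hg.trans ?_⟩
    rw [hsplit, Finset.sum_insert hnot, Function.update_self]
    have : ∀ s ∈ (Finset.univ.filter fun s : Fin (T + 1) => k + 1 ≤ s.val),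
        app (F s) (Function.update η ⟨k, hk⟩ η' s) = app (F s) (η s) := fun s hs => by
      rw [Function.update_of_ne]
      rintro rfl
      exact hnot hs
    rw [Finset.sum_congr rfl this]
    filter_upwards [hc] with ω h
    simp only [Pi.add_apply, h, Pi.sub_apply, add_sub_assoc]

lemma zero_mem_strategies : (0 : Fin (T + 1) → Ω → Mat d) ∈ Strategies μ H A :=
  fun _ => L0.zero

lemma isClosedCone_tail_end {k : ℕ} (hk : T + 1 ≤ k) (m : MeasurableSpace Ω) (hm : m ≤ mΩ) :
    IsClosedCone μ m (tail μ H A F k) := by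
  have hempty : (Finset.univ.filter fun s : Fin (T + 1) => k ≤ s.val) = ∅ := by
    ext s
    simp only [Finset.mem_filter, Finset.mem_univ, true_and, Finset.notMem_empty, iff_false]
    omega
  have htail : tail μ H A F k = {g | -g ∈ L0 μ (orthant d) mΩ} := by
    ext g
    constructor
    · rintro ⟨η, hη, r, hr, hg⟩
      refine L0.congr hr ?_
      filter_upwards [hg] with ω h
      simp [h, hempty]
    · intro hg
      exact ⟨0, zero_mem_strategies, -g, hg, by simp [hempty]⟩
  rw [htail]
  refine ⟨fun c hc => by simpa using hc.1.neg, fun c hc c' h => L0.congr hc ?_, ?_, ?_, ?_, ?_, ?_⟩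
  · filter_upwards [h] with ω hω
    simp [hω]
  · simpa using orthant_zero
  · intro c hc c' hc'
    simp only [Set.mem_ofPred_eq, neg_add]
    exact orthant_add hc hc'
  · rintro l hl hl0 c ⟨h1, h2⟩
    refine ⟨?_, ?_⟩
    · convert (hl.mono hm).smul h1 using 1
      ext ω i
      simp
    · filter_upwards [hl0, h2] with ω e1 e2 i
      have := mul_nonneg e1 (e2 i)
      simpa using this
  · intro c hc r hr
    have : -(c - r) = -c + r := by abel
    simp only [Set.mem_ofPred_eq, this]
    exact orthant_add hc hr
  · intro c c' hc h
    refine ⟨(aestronglyMeasurable_of_tendsto_ae atTop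
      (fun n => by simpa using (hc n).1.neg) h).neg, ?_⟩
    filter_upwards [h, ae_all_iff.2 fun n => (hc n).2] with ω h1 h2 i
    exact ge_of_tendsto' ((tendsto_pi_nhds.1 h1 i).neg) fun n => h2 n i

/-- Backward induction through `IsClosedCone.valueSum`. If a transfer at date `k` is exactly offset
by later ones, extending the strategy by zero before `k` and applying `Reversible` shows that
nothing was thrown away and, by HN⁰, that every date can be reversed. Leaving `m` free lets the cone
from `k + 1` on accept the scalars of date `k`. -/
lemma Reversible.isClosedCone_tail (hR : Reversible μ H A F) (hF : IsModel μ A F)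
    (hN : HN0 μ H A F) (n : ℕ) : ∀ k, k + n = T + 1 → ∀ m : MeasurableSpace Ω, m ≤ mΩ →
      (∀ s : Fin (T + 1), k ≤ s.val → m ≤ H s) → IsClosedCone μ m (tail μ H A F k) := by
  induction n with
  | zero => exact fun k hk m hm _ => isClosedCone_tail_end (by omega) m hm
  | succ n ih =>
    intro k hk m _ hmH
    have hkT : k < T + 1 := by omega
    rw [tail_eq_valueSum hkT]
    refine IsClosedCone.mono (hmH ⟨k, hkT⟩ le_rfl) (IsClosedCone.valueSum
      (hF.isRandomTransferMap _) (H.le _) (ih (k + 1) (by omega) _ (H.le _) fun s hs =>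
        H.mono (Fin.le_def.2 (Nat.le_of_succ_le hs))) ?_)
    rintro η' hη' c ⟨η, hη, r, hr, hc⟩ h
    let θ : Fin (T + 1) → Ω → Mat d := fun s => if k + 1 ≤ s.val then η s else
      if s = ⟨k, hkT⟩ then η' else 0
    have hθ : θ ∈ Strategies μ H A := by
      intro s
      simp only [θ]
      split_ifs with h1 h2
      · exact hη s
      · rw [h2]; exact hη'
      · exact L0.zero
    have hθk : θ ⟨k, hkT⟩ = η' := by simp [θ]
    have hsum : ∑ s, app (F s) (θ s) =ᵐ[μ]
        app (F ⟨k, hkT⟩) η' + ∑ s with k + 1 ≤ Fin.val s, app (F s) (η s) := by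
      filter_upwards [ae_all_iff.2 fun s => hF.app_zero s] with ω h0
      rw [← Finset.sum_filter_add_sum_filter_not Finset.univ
        (fun s : Fin (T + 1) => k + 1 ≤ s.val), add_comm]
      simp only [Pi.add_apply, Finset.sum_apply]
      congr 1
      · rw [Finset.sum_eq_single ⟨k, hkT⟩, hθk]
        · intro s hs hsk
          have : θ s = 0 := by
            simp only [θ, if_neg (Finset.mem_filter.1 hs).2, if_neg hsk]
          rw [this, h0 s]; rfl
        · intro hk
          exact absurd (Finset.mem_filter.2 ⟨Finset.mem_univ _, by simp⟩) hk
      · refine Finset.sum_congr rfl fun s hs => ?_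
        simp only [θ, if_pos (Finset.mem_filter.1 hs).2]
    obtain ⟨hr0, hnull⟩ := hR θ hθ r hr (by
      filter_upwards [hsum, hc, h] with ω h1 h2 h3
      rw [h1]
      simp only [Pi.add_apply, Pi.zero_apply, Pi.sub_apply] at h2 h3 ⊢
      rw [h2, ← add_sub_assoc, sub_eq_zero] at h3
      exact h3)
    have hrev : ∀ s, app (F s) (-θ s) =ᵐ[μ] -app (F s) (θ s) ∧
        -θ s ∈ L0 μ (A : Set (Mat d)) (H s) := fun s => hN s (θ s) (hθ s) (hnull s)
    refine ⟨by simpa [hθk] using (hrev ⟨k, hkT⟩).2, by simpa [hθk] using (hrev ⟨k, hkT⟩).1,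
      fun s => -θ s, fun s => (hrev s).2, 0, orthant_zero, ?_⟩
    filter_upwards [hc, hr0, ae_all_iff.2 fun s => (hrev s).1] with ω h1 h2 h3
    simp only [Pi.neg_apply, h1, Pi.sub_apply, h2, Finset.sum_apply, Pi.zero_apply, sub_zero, h3,
      Finset.sum_neg_distrib, neg_inj]
    refine Finset.sum_congr rfl fun s hs => ?_
    simp only [θ, if_pos (Finset.mem_filter.1 hs).2]

lemma Reversible.isClosedCone_attainable (hR : Reversible μ H A F) (hF : IsModel μ A F)
    (hN : HN0 μ H A F) : IsClosedCone μ (H 0) (Attainable μ H A F (Fin.last T)) := by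
  rw [attainable_last]
  exact hR.isClosedCone_tail hF hN (T + 1) 0 (by omega) _ (H.le 0) fun s _ => H.mono (Fin.zero_le s)

lemma IsClosedCone.closedInProbability {m : MeasurableSpace Ω} {C : Set (Ω → Fin d → ℝ)}
    (hC : IsClosedCone μ m C) : ClosedInProbability μ C := by
  intro g g' hg _ h
  obtain ⟨ns, _, hns⟩ := h.exists_seq_tendsto_ae
  exact hC.lim (fun n => g (ns n)) g' (fun n => hg _) hns

/-- The same strategy evaluated under `G` yields `r` plus the nonnegative differences `G - F`. This
is attainable for `G`, so it vanishes and all differences are zero; clause (2) of NA^r then forces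
each transfer into `N0`. -/
lemma reversible_of_NAr (h : NAr μ H A F) : Reversible μ H A F := by
  obtain ⟨G, hG, hGF, hNA⟩ := h
  intro η hη r hr hsum
  have hle : ∀ᵐ ω ∂μ, ∀ s i, F s ω (η s ω) i ≤ G s ω (η s ω) i :=
    ae_all_iff.2 fun s => ae_all_iff.2 fun i => (hGF η hη s).1 i
  let g : Ω → Fin d → ℝ := ∑ s, app (G s) (η s)
  have hgF : ∀ᵐ ω ∂μ, ∀ i, g ω i = r ω i + ∑ s, (G s ω (η s ω) i - F s ω (η s ω) i) := by
    filter_upwards [hsum] with ω hω i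
    rw [← hω]
    simp [g, app, Finset.sum_apply]
  have hg : g ∈ L0 μ (orthant d) mΩ := by
    refine ⟨Finset.aestronglyMeasurable_sum _ fun s _ => hG.aestronglyMeasurable (hη s), ?_⟩
    filter_upwards [hgF, hr.2, hle] with ω h1 h2 h3 i
    rw [h1]
    exact add_nonneg (h2 i) (Finset.sum_nonneg fun s _ => sub_nonneg.2 (h3 s i))
  have hgA : g ∈ Attainable μ H A G (Fin.last T) := by
    rw [attainable_last]
    exact ⟨η, hη, 0, orthant_zero, by filter_upwards with ω; simp [g]⟩
  have hg0 : g =ᵐ[μ] 0 := by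
    have : g ∈ {g | g =ᵐ[μ] 0} := hNA ▸ ⟨hgA, hg⟩
    exact this
  have hzero : ∀ᵐ ω ∂μ, ∀ i, r ω i = 0 ∧ ∀ s, G s ω (η s ω) i = F s ω (η s ω) i := by
    filter_upwards [hgF, hr.2, hle, hg0] with ω h1 h2 h3 h4 i
    have h5 : ∀ s ∈ Finset.univ, 0 ≤ G s ω (η s ω) i - F s ω (η s ω) i :=
      fun s _ => sub_nonneg.2 (h3 s i)
    have h6 := h1 i
    have h7 := h2 i
    have h8 := Finset.sum_nonneg h5
    rw [h4, Pi.zero_apply, Pi.zero_apply] at h6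
    refine ⟨by linarith, fun s => ?_⟩
    have := (Finset.sum_eq_zero_iff_of_nonneg h5).1 (by linarith) s (Finset.mem_univ s)
    linarith
  refine ⟨hzero.mono fun ω hω => funext fun i => (hω i).1, fun s => ?_⟩
  by_contra hs
  refine ((hGF η hη s).2 hs).ne' ?_
  have : ∀ᵐ ω ∂μ, ¬∃ k, F s ω (η s ω) k < G s ω (η s ω) k := by
    filter_upwards [hzero] with ω hω ⟨k, hk⟩
    rw [(hω k).2 s] at hk
    exact lt_irrefl _ hk
  simpa [ae_iff] using this

/-- Backwards in time, once the later transfers vanish, minus the transfer at `s` equals the earlier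
transfers minus `r`. It is therefore attainable at `s` and lies in `-N_s`, so NA^s puts it in `N0`,
which is trivial by EF. -/
lemma reversible_of_NAs_EF (hF : IsModel μ A F) (h : NAs μ H A F) (hE : EF μ H A F) :
    Reversible μ H A F := by
  intro η hη r hr hsum
  have key : ∀ n k : ℕ, k + n = T + 1 → ∀ s : Fin (T + 1), k ≤ s.val →
      app (F s) (η s) =ᵐ[μ] 0 := by
    intro n
    induction n with
    | zero => intro k hk s hs; omega
    | succ n ih =>
      intro k hk s hs
      by_cases hsk : k + 1 ≤ s.val
      · exact ih (k + 1) (by omega) s hsk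
      have hlater : ∀ᵐ ω ∂μ, ∀ s' : Fin (T + 1), s < s' → app (F s') (η s') ω = 0 :=
        ae_all_iff.2 fun s' => by
          by_cases hs' : s < s'
          · filter_upwards [ih (k + 1) (by omega) s' (by
              have := Fin.lt_def.1 hs'; omega)] with ω hω _ using hω
          · exact Eventually.of_forall fun ω h => absurd h hs'
      -- The term of date `s` is moved to the other side, so the attainable position uses the zero
      -- transfer there.
      let ξ : Fin (T + 1) → Ω → Fin d → ℝ := Function.update (fun s => app (F s) (η s)) s 0
      have hξ : ∀ s', ξ s' ∈ N μ H A F s' := fun s' => by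
        by_cases h' : s' = s
        · subst h'
          exact ⟨0, L0.zero, by simpa [ξ] using (hF.app_zero s').symm⟩
        · exact ⟨η s', hη s', by simp [ξ, h']⟩
      have hV : -app (F s) (η s) =ᵐ[μ] V ξ s - r := by
        filter_upwards [hsum, hlater] with ω h1 h2
        have h3 : ∑ s', app (F s') (η s') ω = ∑ s' ∈ Finset.Iic s, app (F s') (η s') ω :=
          (Finset.sum_subset (Finset.subset_univ _) fun s' _ hs' =>
            h2 s' (by simpa using hs')).symm
        have h4 : ∑ s' ∈ (Finset.Iic s).erase s, ξ s' ω =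
            ∑ s' ∈ (Finset.Iic s).erase s, app (F s') (η s') ω :=
          Finset.sum_congr rfl fun s' hs' => by simp [ξ, Finset.ne_of_mem_erase hs']
        rw [Finset.sum_apply, h3, ← Finset.add_sum_erase _ _ (Finset.mem_Iic.2 le_rfl)] at h1
        simp only [V, Pi.sub_apply, Finset.sum_apply]
        rw [← Finset.add_sum_erase _ _ (Finset.mem_Iic.2 (le_refl s)), h4, ← h1]
        simp [ξ]
      have hmem : -app (F s) (η s) ∈ N0 μ H A F s :=
        h s ⟨⟨ξ, hξ, r, hr, hV⟩, app (F s) (η s), ⟨η s, hη s, EventuallyEq.rfl⟩, 0, orthant_zero,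
          by simp⟩
      rw [hE s] at hmem
      filter_upwards [hmem] with ω hω
      simpa using hω
  have hzero : ∀ s, app (F s) (η s) =ᵐ[μ] 0 := fun s => key (T + 1) 0 (by omega) s (Nat.zero_le _)
  refine ⟨?_, fun s => ?_⟩
  · filter_upwards [hsum, ae_all_iff.2 hzero] with ω h1 h2
    rw [← h1]
    simp [h2]
  · rw [hE s]
    exact hzero s

/-- Equating `V_t(ξ) - r` with `-ζ + r'` gives a strategy up to date `t` which, with `ζ` added, has
total `r + r' ≥ 0`; `Reversible.offset` then applies to `ζ`. -/
lemma Reversible.NAs (hR : Reversible μ H A F) (hF : IsModel μ A F) (hN : HN0 μ H A F) :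
    NAs μ H A F := by
  rintro t g ⟨⟨ξ, hξ, r, hr, hg⟩, ζ, ⟨η', hη', hζ⟩, r', hr', hg'⟩
  choose η hη hξη using hξ
  let θ : Fin (T + 1) → Ω → Mat d := fun s => if s ≤ t then η s else 0
  have hθ : θ ∈ Strategies μ H A := fun s => by
    simp only [θ]
    split_ifs
    · exact hη s
    · exact L0.zero
  obtain ⟨h0, hneg, hfneg⟩ := hR.offset hF hN hθ hη' (orthant_add hr hr') (by
    filter_upwards [hg, hg', hζ, ae_all_iff.2 hξη, ae_all_iff.2 fun s => hF.app_zero s]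
      with ω h1 h2 h3 h4 h5
    have h6 : ∑ s, app (F s) (θ s) ω = V ξ t ω := by
      simp only [V, Finset.sum_apply, h4]
      rw [← Finset.sum_subset (Finset.subset_univ (Finset.Iic t))]
      · exact Finset.sum_congr rfl fun s hs => by simp only [θ, if_pos (Finset.mem_Iic.1 hs)]
      · intro s _ hs
        simp only [θ, if_neg (fun h => hs (Finset.mem_Iic.2 h))]
        exact h5 s
    simp only [Pi.add_apply, Pi.sub_apply, Pi.neg_apply, Finset.sum_apply] at h1 h2 ⊢
    rw [h6, ← h3]
    rw [h1] at h2
    ext i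
    have := congrFun h2 i
    simp at this ⊢
    linarith)
  have hgη : g =ᵐ[μ] app (F t) (-η') := by
    filter_upwards [hg', hζ, hfneg, h0, hr.2, hr'.2] with ω h1 h2 h3 h4 h5 h6
    rw [h1, h3]
    ext i
    have e1 := congrFun h4 i
    have e2 := h5 i
    have e3 := h6 i
    simp only [Pi.add_apply, Pi.neg_apply, Pi.zero_apply, h2] at e1 ⊢
    linarith
  refine ⟨⟨-η', hneg, hgη⟩, η', hη', ?_⟩
  filter_upwards [hgη, hfneg] with ω h1 h2
  simp [h1, h2]

end Reversibility

/-! ### Generalized conditional expectations and localization. -/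

section ConditionalExpectation

variable {Ω : Type*} {mΩ : MeasurableSpace Ω} {μ : Measure Ω}
  {m : MeasurableSpace Ω}

lemma condLExp_indicator [IsFiniteMeasure μ] (hm : m ≤ mΩ) (X : Ω → ENNReal) {S : Set Ω}
    (hS : MeasurableSet[m] S) :
    S.indicator (condLExp m μ X) =ᵐ[μ] condLExp m μ (S.indicator X) := by
  refine ae_eq_condLExp hm μ _ ((measurable_condLExp m μ X).indicator hS) fun s hs => ?_
  rw [setLIntegral_indicator (hm _ hS), setLIntegral_indicator (hm _ hS),
    setLIntegral_condLExp hm μ X (hS.inter hs)]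

lemma genCondExp_congr {X Y : Ω → ℝ} (h : X =ᵐ[μ] Y) :
    genCondExp μ m X =ᵐ[μ] genCondExp μ m Y := by
  have h1 : condLExp m μ (fun ω => ENNReal.ofReal (X ω)) =ᵐ[μ]
      condLExp m μ (fun ω => ENNReal.ofReal (Y ω)) :=
    condLExp_congr_ae (by filter_upwards [h] with ω hω; rw [hω])
  have h2 : condLExp m μ (fun ω => ENNReal.ofReal (-X ω)) =ᵐ[μ]
      condLExp m μ (fun ω => ENNReal.ofReal (-Y ω)) :=
    condLExp_congr_ae (by filter_upwards [h] with ω hω; rw [hω])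
  filter_upwards [h1, h2] with ω e1 e2
  simp only [genCondExp, e1, e2]

lemma genCondExp_indicator [IsFiniteMeasure μ] (hm : m ≤ mΩ) (X : Ω → ℝ) {S : Set Ω} (hS : MeasurableSet[m] S) :
    ∀ᵐ ω ∂μ, ω ∈ S → genCondExp μ m X ω = genCondExp μ m (S.indicator X) ω := by
  have e : ∀ c : ℝ → ℝ, c 0 = 0 → (fun ω => ENNReal.ofReal (c (S.indicator X ω))) =
      S.indicator fun ω => ENNReal.ofReal (c (X ω)) := by
    intro c hc
    ext ω
    by_cases hω : ω ∈ S <;> simp [hω, hc]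
  have h1 := condLExp_indicator (μ := μ) hm (fun ω => ENNReal.ofReal (X ω)) hS
  have h2 := condLExp_indicator (μ := μ) hm (fun ω => ENNReal.ofReal (-X ω)) hS
  filter_upwards [h1, h2] with ω e1 e2 hω
  simp only [genCondExp]
  rw [e (fun x => x) rfl, e (fun x => -x) (by simp), ← e1, ← e2, Set.indicator_of_mem hω,
    Set.indicator_of_mem hω]

lemma genCondExp_eq_condExp {X : Ω → ℝ} (hX : Integrable X μ) :
    genCondExp μ m X =ᵐ[μ] μ[X | m] := by
  have hfin : ∀ Y : Ω → ℝ, Integrable Y μ → ∫⁻ ω, ENNReal.ofReal (Y ω) ∂μ ≠ ⊤ := fun Y hY =>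
    ((lintegral_mono fun ω => Real.ofReal_le_enorm (Y ω)).trans_lt hY.2).ne
  have h1 := toReal_condLExp m hX.aemeasurable.ennreal_ofReal (hfin X hX)
  have h2 := toReal_condLExp m hX.neg.aemeasurable.ennreal_ofReal (hfin _ hX.neg)
  have h3 : X = (fun ω => (ENNReal.ofReal (X ω)).toReal) -
      fun ω => (ENNReal.ofReal ((-X) ω)).toReal := by
    ext ω
    simp only [Pi.sub_apply, Pi.neg_apply, ENNReal.toReal_ofReal']
    rcases le_total 0 (X ω) with h | h
    · rw [max_eq_left h, max_eq_right (by linarith)]; ring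
    · rw [max_eq_right h, max_eq_left (by linarith)]; ring
  have i1 : Integrable (fun ω => (ENNReal.ofReal (X ω)).toReal) μ := by
    simpa only [ENNReal.toReal_ofReal'] using hX.pos_part
  have i2 : Integrable (fun ω => (ENNReal.ofReal ((-X) ω)).toReal) μ := by
    simpa only [ENNReal.toReal_ofReal'] using hX.neg.pos_part
  have h4 := condExp_sub i1 i2 m
  rw [← h3] at h4
  filter_upwards [h1, h2, h4] with ω e1 e2 e4
  rw [e4, Pi.sub_apply, ← e1, ← e2]
  rfl

variable {ι : Type*}

/-- The event that finitely many random variables are bounded by `n`. -/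
def boundedSet (l : ι → Ω → ℝ) (n : ℕ) : Set Ω := {ω | ∀ i, |l i ω| ≤ n}

lemma measurableSet_boundedSet [Countable ι] {l : ι → Ω → ℝ} (hl : ∀ i, StronglyMeasurable[m] (l i)) (n : ℕ) :
    MeasurableSet[m] (boundedSet l n) := by
  have : boundedSet l n = ⋂ i, {ω | |l i ω| ≤ n} := by ext; simp [boundedSet]
  rw [this]
  exact MeasurableSet.iInter fun i => measurableSet_le
    (continuous_abs.comp_stronglyMeasurable (hl i)).measurable measurable_const

lemma monotone_boundedSet (l : ι → Ω → ℝ) : Monotone (boundedSet l) := fun _ _ hab _ hω i =>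
  (hω i).trans (Nat.cast_le.2 hab)

lemma exists_mem_boundedSet [Fintype ι] (l : ι → Ω → ℝ) (ω : Ω) : ∃ n, ω ∈ boundedSet l n := by
  obtain ⟨n, hn⟩ := exists_nat_ge (∑ i, |l i ω|)
  exact ⟨n, fun i => (Finset.single_le_sum (f := fun i => |l i ω|)
    (fun i _ => abs_nonneg _) (Finset.mem_univ i)).trans hn⟩

lemma integrable_indicator_boundedSet_mul [Countable ι] (hm : m ≤ mΩ) {l : ι → Ω → ℝ}
    (hl : ∀ i, StronglyMeasurable[m] (l i)) (n : ℕ) (i : ι) {Y : Ω → ℝ} (hY : Integrable Y μ) :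
    Integrable (fun ω => (boundedSet l n).indicator (l i) ω * Y ω) μ := by
  refine hY.bdd_mul (c := n) (((hl i).indicator
    (measurableSet_boundedSet hl n)).mono hm).aestronglyMeasurable (Eventually.of_forall fun ω => ?_)
  by_cases hω : ω ∈ boundedSet l n
  · rw [Set.indicator_of_mem hω]; exact hω i
  · rw [Set.indicator_of_notMem hω]; simp

variable [Fintype ι]

lemma indicator_sum_mul (S : Set Ω) (l Y : ι → Ω → ℝ) :
    S.indicator (fun ω => ∑ i, l i ω * Y i ω) = fun ω => ∑ i, S.indicator (l i) ω * Y i ω := by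
  ext ω
  by_cases hω : ω ∈ S <;> simp [hω]

lemma condExp_indicator_boundedSet [IsFiniteMeasure μ] (hm : m ≤ mΩ) {l Y : ι → Ω → ℝ}
    (hl : ∀ i, StronglyMeasurable[m] (l i)) (hY : ∀ i, Integrable (Y i) μ) (n : ℕ) :
    μ[fun ω => ∑ i, (boundedSet l n).indicator (l i) ω * Y i ω | m] =ᵐ[μ]
      fun ω => ∑ i, (boundedSet l n).indicator (l i) ω * (μ[Y i | m]) ω := by
  have hint := fun i => integrable_indicator_boundedSet_mul hm hl n i (hY i)
  have h1 : (fun ω => ∑ i, (boundedSet l n).indicator (l i) ω * Y i ω) =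
      ∑ i, fun ω => (boundedSet l n).indicator (l i) ω * Y i ω := by
    ext ω; simp
  have h2 := condExp_finsetSum (s := Finset.univ) (fun i _ => hint i) m
  have h3 : ∀ i, μ[fun ω => (boundedSet l n).indicator (l i) ω * Y i ω | m] =ᵐ[μ]
      fun ω => (boundedSet l n).indicator (l i) ω * (μ[Y i | m]) ω := fun i =>
    condExp_mul_of_stronglyMeasurable_left
      ((hl i).indicator (measurableSet_boundedSet hl n)) (hint i) (hY i)
  rw [h1]
  filter_upwards [h2, ae_all_iff.2 h3] with ω e2 e3
  rw [e2, Finset.sum_apply]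
  exact Finset.sum_congr rfl fun i _ => e3 i

/-- The generalized conditional expectation of a combination of integrable random variables with
`m`-measurable coefficients. -/
lemma genCondExp_sum_mul [IsFiniteMeasure μ] (hm : m ≤ mΩ) {l Y : ι → Ω → ℝ}
    (hl : ∀ i, AEStronglyMeasurable[m] (l i) μ) (hY : ∀ i, Integrable (Y i) μ) :
    genCondExp μ m (fun ω => ∑ i, l i ω * Y i ω) =ᵐ[μ]
      fun ω => ∑ i, l i ω * (μ[Y i | m]) ω := by
  choose l' hl' hll' using hl
  have h0 : (fun ω => ∑ i, l i ω * Y i ω) =ᵐ[μ] fun ω => ∑ i, l' i ω * Y i ω := by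
    filter_upwards [ae_all_iff.2 hll'] with ω h
    simp [h]
  -- The products need not be integrable, but on the `m`-measurable event where all coefficients are
  -- at most `n` the usual pull-out rule applies, and these events exhaust `Ω`.
  have h1 : ∀ n : ℕ, ∀ᵐ ω ∂μ, ω ∈ boundedSet l' n →
      genCondExp μ m (fun ω => ∑ i, l' i ω * Y i ω) ω = ∑ i, l' i ω * (μ[Y i | m]) ω := by
    intro n
    have e1 := genCondExp_indicator (μ := μ) hm (fun ω => ∑ i, l' i ω * Y i ω)
      (measurableSet_boundedSet hl' n)
    rw [indicator_sum_mul] at e1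
    have e2 := genCondExp_eq_condExp (m := m) (integrable_finsetSum Finset.univ fun i _ =>
      integrable_indicator_boundedSet_mul (μ := μ) hm hl' n i (hY i))
    filter_upwards [e1, e2, condExp_indicator_boundedSet hm hl' hY n] with ω k1 k2 k3 hω
    rw [k1 hω, k2, k3]
    simp [hω]
  filter_upwards [genCondExp_congr (m := m) h0, ae_all_iff.2 h1, ae_all_iff.2 hll'] with ω e0 e1 e2
  obtain ⟨n, hn⟩ := exists_mem_boundedSet l' ω
  rw [e0, e1 n hn]
  simp [e2]

/-- Random variables that are integrable with nonpositive integrals on the `m`-measurable subsets of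
the elements of an exhausting sequence. -/
def LocSuper (μ : Measure Ω) (m : MeasurableSpace Ω) (X : Ω → ℝ) : Prop :=
  ∃ B : ℕ → Set Ω, Monotone B ∧ (∀ n, MeasurableSet[m] (B n)) ∧ (∀ ω, ∃ n, ω ∈ B n) ∧
    ∀ n, IntegrableOn X (B n) μ ∧ ∀ S, MeasurableSet[m] S → ∫ ω in S ∩ B n, X ω ∂μ ≤ 0

lemma LocSuper.congr {X X' : Ω → ℝ} (h : LocSuper μ m X) (hX : X =ᵐ[μ] X') : LocSuper μ m X' := by
  obtain ⟨B, h1, h2, h3, h4⟩ := h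
  refine ⟨B, h1, h2, h3, fun n => ⟨(h4 n).1.congr (ae_restrict_of_ae hX), fun S hS => ?_⟩⟩
  rw [← integral_congr_ae (ae_restrict_of_ae hX)]
  exact (h4 n).2 S hS

lemma LocSuper.indicator {m' : MeasurableSpace Ω} (hm : m ≤ mΩ) (hm' : m' ≤ m) {X : Ω → ℝ}
    (h : LocSuper μ m X) {E : Set Ω} (hE : MeasurableSet[m'] E) : LocSuper μ m (E.indicator X) := by
  obtain ⟨B, h1, h2, h3, h4⟩ := h
  have hE' := hm' _ hE
  refine ⟨B, h1, h2, h3, fun n => ⟨(h4 n).1.indicator (hm _ hE'), fun S hS => ?_⟩⟩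
  rw [setIntegral_indicator (hm _ hE'), Set.inter_right_comm]
  exact (h4 n).2 _ (hS.inter hE')

lemma locSuper_sum_mul_sub_condExp [IsFiniteMeasure μ] (hm : m ≤ mΩ) {l Y : ι → Ω → ℝ}
    (hl : ∀ i, AEStronglyMeasurable[m] (l i) μ) (hY : ∀ i, Integrable (Y i) μ) :
    LocSuper μ m fun ω => ∑ i, l i ω * (Y i ω - (μ[Y i | m]) ω) := by
  choose l' hl' hll' using hl
  refine LocSuper.congr (X := fun ω => ∑ i, l' i ω * (Y i ω - (μ[Y i | m]) ω)) ?_ (by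
    filter_upwards [ae_all_iff.2 hll'] with ω h
    simp [h])
  have hB := measurableSet_boundedSet hl'
  refine ⟨boundedSet l', monotone_boundedSet l', hB, exists_mem_boundedSet l', fun n => ?_⟩
  have hint := fun i => integrable_indicator_boundedSet_mul (μ := μ) hm hl' n i (hY i)
  have hint' := fun i => integrable_indicator_boundedSet_mul (μ := μ) hm hl' n i
    (integrable_condExp (m := m) (μ := μ) (f := Y i))
  have hsum := integrable_finsetSum Finset.univ fun i _ => hint i
  have hsum' := integrable_finsetSum Finset.univ fun i _ => hint' i
  have hrw : (boundedSet l' n).indicator (fun ω => ∑ i, l' i ω * (Y i ω - (μ[Y i | m]) ω)) =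
      fun ω => ∑ i, (boundedSet l' n).indicator (l' i) ω * Y i ω -
        ∑ i, (boundedSet l' n).indicator (l' i) ω * (μ[Y i | m]) ω := by
    rw [indicator_sum_mul (boundedSet l' n) l' fun i ω => Y i ω - (μ[Y i | m]) ω]
    ext ω
    rw [← Finset.sum_sub_distrib]
    exact Finset.sum_congr rfl fun i _ => mul_sub _ _ _
  refine ⟨?_, fun S hS => ?_⟩
  · rw [← integrable_indicator_iff (hm _ (hB n)), hrw]
    exact hsum.sub hsum'
  · rw [← setIntegral_indicator (hm _ (hB n)), hrw,
      integral_sub hsum.integrableOn hsum'.integrableOn, sub_nonpos]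
    rw [← setIntegral_condExp hm hsum hS]
    exact (setIntegral_congr_ae (hm _ hS) ((condExp_indicator_boundedSet hm hl' hY n).mono
      fun ω h _ => h)).le

end ConditionalExpectation

/-! ### Sums of local supermartingale differences bounded from below. -/

section Supermartingale

variable {Ω : Type*} {mΩ : MeasurableSpace Ω} {μ : Measure Ω} [IsFiniteMeasure μ] {T : ℕ}
  {H : Filtration (Fin (T + 1)) mΩ}

lemma sum_filter_succ {M : Type*} [AddCommMonoid M] {k : ℕ} (hk : k < T + 1)
    (x : Fin (T + 1) → M) :
    ∑ s with k ≤ Fin.val s, x s = x ⟨k, hk⟩ + ∑ s with k + 1 ≤ Fin.val s, x s := by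
  have hsplit : (Finset.univ.filter fun s : Fin (T + 1) => k ≤ s.val) =
      insert ⟨k, hk⟩ (Finset.univ.filter fun s : Fin (T + 1) => k + 1 ≤ s.val) := by
    ext s
    simp only [Finset.mem_filter, Finset.mem_univ, true_and, Finset.mem_insert, Fin.ext_iff]
    omega
  rw [hsplit, Finset.sum_insert (by simp)]

/-- Sums of local supermartingale differences that are bounded from below by an integrable random
variable are integrable, with nonpositive expectation. -/
lemma LocSuper.integrable_sum (n : ℕ) : ∀ k, k + n = T + 1 → ∀ X : Fin (T + 1) → Ω → ℝ,
    (∀ s, k ≤ s.val → LocSuper μ (H s) (X s)) → ∀ Y : Ω → ℝ, Integrable Y μ →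
    (∀ᵐ ω ∂μ, -Y ω ≤ ∑ s with k ≤ Fin.val s, X s ω) →
    Integrable (fun ω => ∑ s with k ≤ Fin.val s, X s ω) μ ∧
      ∫ ω, ∑ s with k ≤ Fin.val s, X s ω ∂μ ≤ 0 := by
  induction n with
  | zero =>
    intro k hk X _ Y _ _
    have hempty : (Finset.univ.filter fun s : Fin (T + 1) => k ≤ s.val) = ∅ := by
      ext s
      simp only [Finset.mem_filter, Finset.mem_univ, true_and, Finset.notMem_empty, iff_false]
      omega
    simp [hempty]
  | succ n ih =>
    intro k hk X hX Y hY hle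
    have hkT : k < T + 1 := by omega
    obtain ⟨B, hBmono, hBm, hBex, hB⟩ := hX ⟨k, hkT⟩ le_rfl
    have hBm' : ∀ j, MeasurableSet (B j) := fun j => H.le _ _ (hBm j)
    set S : Ω → ℝ := fun ω => ∑ s with k ≤ Fin.val s, X s ω with hS
    have hSk : ∀ ω, S ω = X ⟨k, hkT⟩ ω + ∑ s with k + 1 ≤ Fin.val s, X s ω := fun ω =>
      sum_filter_succ hkT fun s => X s ω
    have hloc : ∀ j, IntegrableOn S (B j) μ ∧ ∫ ω in B j, S ω ∂μ ≤ 0 := by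
      intro j
      have hXk : Integrable ((B j).indicator (X ⟨k, hkT⟩)) μ :=
        (integrable_indicator_iff (hBm' j)).2 (hB j).1
      -- `B j` is known at date `k`, so restricting the later terms to it keeps their local
      -- supermartingale property. The term of date `k` is integrable there and can be moved into
      -- the lower bound.
      obtain ⟨i1, i2⟩ := ih (k + 1) (by omega) (fun s => (B j).indicator (X s))
        (fun s hs => (hX s (by omega)).indicator (H.le s)
          (H.mono (Fin.le_def.2 (Nat.le_of_succ_le hs))) (hBm j))
        (fun ω => |Y ω| + |(B j).indicator (X ⟨k, hkT⟩) ω|) (hY.abs.add hXk.abs) (by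
          filter_upwards [hle] with ω hω
          have e1 := le_abs_self (Y ω)
          by_cases h : ω ∈ B j
          · simp only [Set.indicator_of_mem h]
            have e2 := le_abs_self (X ⟨k, hkT⟩ ω)
            have e3 := hSk ω
            simp only [hS] at e3
            linarith
          · simp only [Set.indicator_of_notMem h, Finset.sum_const_zero, abs_zero]
            have e2 := abs_nonneg (Y ω)
            linarith)
      have hrw : (B j).indicator S = fun ω => (B j).indicator (X ⟨k, hkT⟩) ω +
          ∑ s with k + 1 ≤ Fin.val s, (B j).indicator (X s) ω := by
        ext ω
        by_cases h : ω ∈ B j <;> simp [h, hSk]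
      refine ⟨?_, ?_⟩
      · rw [← integrable_indicator_iff (hBm' j), hrw]
        exact hXk.add i1
      · rw [← integral_indicator (hBm' j), hrw, integral_add hXk i1,
          integral_indicator (hBm' j)]
        have := (hB j).2 Set.univ MeasurableSet.univ
        rw [Set.univ_inter] at this
        linarith
    have hcover : AECover μ atTop B :=
      ⟨Eventually.of_forall fun ω => by
        obtain ⟨j, hj⟩ := hBex ω
        filter_upwards [eventually_ge_atTop j] with i hi using hBmono hi hj, hBm'⟩
    have hint : Integrable S μ := by
      -- The lower bound gives `|S| ≤ S + 2|Y|`, and `S` has nonpositive integral on `B j`; hence an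
      -- `L¹` bound independent of `j`.
      refine hcover.integrable_of_integral_norm_bounded (2 * ∫ ω, |Y ω| ∂μ) (fun j => (hloc j).1)
        (Eventually.of_forall fun j => ?_)
      have h1 : ∫ ω in B j, ‖S ω‖ ∂μ ≤ ∫ ω in B j, (S ω + 2 * |Y ω|) ∂μ := by
        refine integral_mono_ae (hloc j).1.norm ((hloc j).1.add
          (hY.abs.const_mul 2).integrableOn) (ae_restrict_of_ae ?_)
        filter_upwards [hle] with ω hω
        have e1 := le_abs_self (Y ω)
        have e2 := abs_nonneg (Y ω)
        change |S ω| ≤ S ω + 2 * |Y ω|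
        change -Y ω ≤ S ω at hω
        rcases abs_cases (S ω) with h | h <;> linarith
      have h2 : ∫ ω in B j, |Y ω| ∂μ ≤ ∫ ω, |Y ω| ∂μ :=
        setIntegral_le_integral hY.abs (Eventually.of_forall fun ω => abs_nonneg _)
      rw [integral_add (hloc j).1 (hY.abs.const_mul 2).integrableOn, integral_const_mul] at h1
      linarith [(hloc j).2]
    exact ⟨hint, le_of_tendsto' (hcover.integral_tendsto_of_countably_generated hint)
      fun j => (hloc j).2⟩

lemma LocSuper.sum_eq_zero {X : Fin (T + 1) → Ω → ℝ} (hX : ∀ s, LocSuper μ (H s) (X s))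
    (hle : ∀ᵐ ω ∂μ, 0 ≤ ∑ s, X s ω) : ∀ᵐ ω ∂μ, ∑ s, X s ω = 0 := by
  obtain ⟨h1, h2⟩ := LocSuper.integrable_sum (H := H) (T + 1) 0 (by omega) X (fun s _ => hX s)
    (fun _ => 0) (integrable_zero _ _ _) (by simpa using hle)
  simp only [Nat.zero_le, Finset.filter_true] at h1 h2
  have h3 := (integral_eq_zero_iff_of_nonneg_ae hle h1).1
    (le_antisymm h2 (integral_nonneg_of_ae hle))
  filter_upwards [h3] with ω h using h

end Supermartingale

/-! ### Conditional prices of signed units and a reformulation of the dual set. -/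

section Prices

variable {Ω : Type*} {mΩ : MeasurableSpace Ω} {μ : Measure Ω} {d T : ℕ}
  {H : Filtration (Fin (T + 1)) mΩ} {A : ProperCone ℝ (Mat d)}
  {F : Fin (T + 1) → Ω → Mat d → Fin d → ℝ} {Z : Ω → Fin d → ℝ}

/-- The value under `Z` of the transfer of a signed matrix unit. -/
def unitValue (F : Fin (T + 1) → Ω → Mat d → Fin d → ℝ) (Z : Ω → Fin d → ℝ) (t : Fin (T + 1))
    (k : Idx d) : Ω → ℝ := fun ω => Z ω ⬝ᵥ F t ω (unit k)

/-- The conditional expectation of the value of a signed matrix unit. -/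
noncomputable def unitPrice (μ : Measure Ω) (H : Filtration (Fin (T + 1)) mΩ)
    (F : Fin (T + 1) → Ω → Mat d → Fin d → ℝ) (Z : Ω → Fin d → ℝ) (t : Fin (T + 1))
    (k : Idx d) : Ω → ℝ := μ[unitValue F Z t k | H t]

/-- The positively homogeneous extension of the prices of the signed matrix units. -/
noncomputable def price (μ : Measure Ω) (H : Filtration (Fin (T + 1)) mΩ)
    (F : Fin (T + 1) → Ω → Mat d → Fin d → ℝ) (Z : Ω → Fin d → ℝ) (t : Fin (T + 1))
    (ω : Ω) (a : Mat d) : ℝ := ∑ k, coef k a * unitPrice μ H F Z t k ω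

/-- HA is applied to the constant matrices of a dense sequence; continuity of both sides gives one
null set valid for all matrices. -/
lemma HA.formula (hA : HA μ A F) (hF : IsModel μ A F) (t : Fin (T + 1)) :
    ∀ᵐ ω ∂μ, ∀ a, F t ω a = ∑ k, coef k a • F t ω (unit k) := by
  have h : ∀ n : ℕ, ∀ᵐ ω ∂μ, F t ω (TopologicalSpace.denseSeq (Mat d) n) =
      ∑ k, coef k (TopologicalSpace.denseSeq (Mat d) n) • F t ω (unit k) := fun n => by
    filter_upwards [hA.2 t (fun _ => TopologicalSpace.denseSeq (Mat d) n)
      ⟨aestronglyMeasurable_const, Eventually.of_forall fun _ => Set.mem_univ _⟩] with ω hω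
    rw [sum_idx]
    simpa [coef, unit, app] using hω
  filter_upwards [ae_all_iff.2 h, hF.2 t] with ω h1 h2 a
  have hcont : Continuous fun a : Mat d => ∑ k, coef k a • F t ω (unit k) :=
    continuous_finsetSum _ fun k _ => (continuous_coef k).smul continuous_const
  have := Continuous.ext_on (TopologicalSpace.denseRange_denseSeq (Mat d)) h2.continuous hcont
    (by rintro _ ⟨n, rfl⟩; exact h1 n)
  exact congrFun this a

lemma HA.unit_eq_zero (hA : HA μ A F) (t : Fin (T + 1)) {k : Idx d} (hk : unit k ∉ A) :
    ∀ᵐ ω ∂μ, F t ω (unit k) = 0 := by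
  rcases k with ⟨⟨i, j⟩, b⟩
  cases b
  · simpa [unit] using! (hA.1 t i j).2 (by simpa [unit] using hk)
  · simpa [unit] using! (hA.1 t i j).1 (by simpa [unit] using hk)

lemma UnitIntegrable.unit (hI : UnitIntegrable μ F) (t : Fin (T + 1)) (k : Idx d) :
    Integrable (fun ω => F t ω (unit k)) μ := by
  rcases k with ⟨⟨i, j⟩, b⟩
  cases b
  · simpa [ImperfectInfo.unit] using (hI t i j).2
  · simpa [ImperfectInfo.unit] using (hI t i j).1

lemma integrable_dotProduct (hZ : MemLp Z ⊤ μ) {X : Ω → Fin d → ℝ} (hX : Integrable X μ) :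
    Integrable (fun ω => Z ω ⬝ᵥ X ω) μ := by
  refine integrable_finsetSum _ fun i _ => ?_
  exact (hX.eval i).mul_of_top_right (memLp_pi_iff.1 hZ i)

lemma UnitIntegrable.unitValue (hI : UnitIntegrable μ F) (hZ : MemLp Z ⊤ μ) (t : Fin (T + 1))
    (k : Idx d) : Integrable (unitValue F Z t k) μ :=
  integrable_dotProduct hZ (hI.unit t k)

lemma HA.dotProduct (hA : HA μ A F) (hF : IsModel μ A F) (t : Fin (T + 1)) :
    ∀ᵐ ω ∂μ, ∀ a, Z ω ⬝ᵥ F t ω a = ∑ k, coef k a * unitValue F Z t k ω := by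
  filter_upwards [hA.formula hF t] with ω h a
  rw [h a, dotProduct_sum]
  exact Finset.sum_congr rfl fun k _ => by rw [dotProduct_smul, smul_eq_mul, unitValue]

lemma aestronglyMeasurable_coef {m : MeasurableSpace Ω} {η : Ω → Mat d}
    (hη : AEStronglyMeasurable[m] η μ) (k : Idx d) :
    AEStronglyMeasurable[m] (fun ω => coef k (η ω)) μ :=
  (continuous_coef k).comp_aestronglyMeasurable hη

lemma UnitIntegrable.app (hI : UnitIntegrable μ F) (hF : IsModel μ A F) (hA : HA μ A F)
    {t : Fin (T + 1)} {η : Ω → Mat d} (hη : AEStronglyMeasurable η μ) {c : ℝ}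
    (hc : ∀ᵐ ω ∂μ, nrm (η ω) ≤ c) : Integrable (app (F t) η) μ := by
  have h : Integrable (fun ω => ∑ k, coef k (η ω) • F t ω (ImperfectInfo.unit k)) μ :=
    integrable_finsetSum _ fun k _ => (hI.unit t k).bdd_smul c (aestronglyMeasurable_coef hη k) (by
      filter_upwards [hc] with ω hω
      rw [Real.norm_of_nonneg (coef_nonneg k _)]
      exact (coef_le_nrm k _).trans hω)
  refine h.congr ?_
  filter_upwards [hA.formula hF t] with ω h1
  exact (h1 (η ω)).symm

lemma price_smul (t : Fin (T + 1)) (ω : Ω) {c : ℝ} (hc : 0 ≤ c) (a : Mat d) :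
    price μ H F Z t ω (c • a) = c * price μ H F Z t ω a := by
  simp [price, coef_smul _ hc, Finset.mul_sum, mul_assoc]

lemma Fbar_eq_price [IsFiniteMeasure μ] (hI : UnitIntegrable μ F) (hF : IsModel μ A F)
    (hA : HA μ A F) (hZ : MemLp Z ⊤ μ) {t : Fin (T + 1)} {η : Ω → Mat d}
    (hη : AEStronglyMeasurable[H t] η μ) :
    Fbar μ H F Z t η =ᵐ[μ] fun ω => price μ H F Z t ω (η ω) := by
  have h1 : (fun ω => Z ω ⬝ᵥ F t ω (η ω)) =ᵐ[μ]
      fun ω => ∑ k, coef k (η ω) * unitValue F Z t k ω := by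
    filter_upwards [hA.dotProduct hF t] with ω h using h _
  exact (genCondExp_congr h1).trans (genCondExp_sum_mul (H.le t)
    (fun k => aestronglyMeasurable_coef hη k) fun k => hI.unitValue hZ t k)

lemma unitPrice_eq_zero (hA : HA μ A F) (t : Fin (T + 1)) {k : Idx d} (hk : unit k ∉ A) :
    unitPrice μ H F Z t k =ᵐ[μ] 0 := by
  have : unitValue F Z t k =ᵐ[μ] 0 := by
    filter_upwards [hA.unit_eq_zero t hk] with ω h
    simp [unitValue, h]
  have h := condExp_congr_ae (m := H t) this
  rw [condExp_zero] at h
  exact h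

lemma coef_unit [DecidableEq (Idx d)] (k l : Idx d) :
    coef k (unit l : Mat d) = if k = l then 1 else 0 := by
  obtain ⟨⟨i, j⟩, b⟩ := k
  obtain ⟨⟨i', j'⟩, b'⟩ := l
  by_cases h : i = i' ∧ j = j'
  · obtain ⟨rfl, rfl⟩ := h
    cases b <;> cases b' <;> simp [coef, unit]
  · have h' : ¬(i' = i ∧ j' = j) := fun h2 => h ⟨h2.1.symm, h2.2.symm⟩
    have h2 : ¬(((i, j), b) : Idx d) = ((i', j'), b') := fun h3 => by
      simp only [Prod.mk.injEq] at h3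
      exact h h3.1
    rw [if_neg h2]
    cases b <;> cases b' <;> simp [coef, unit, Matrix.single_apply_of_ne _ _ _ _ _ h']

lemma price_unit (t : Fin (T + 1)) (ω : Ω) (k : Idx d) :
    price μ H F Z t ω (unit k) = unitPrice μ H F Z t k ω := by
  classical
  simp [price, coef_unit]

lemma price_nonpos {t : Fin (T + 1)} {ω : Ω} (h : ∀ k, unitPrice μ H F Z t k ω ≤ 0) (a : Mat d) :
    price μ H F Z t ω a ≤ 0 :=
  Finset.sum_nonpos fun k _ => mul_nonpos_of_nonneg_of_nonpos (coef_nonneg k a) (h k)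

lemma price_eq_zero_iff {t : Fin (T + 1)} {ω : Ω} (h : ∀ k, unitPrice μ H F Z t k ω ≤ 0)
    (a : Mat d) : price μ H F Z t ω a = 0 ↔ ∀ k, coef k a = 0 ∨ unitPrice μ H F Z t k ω = 0 := by
  rw [price, Finset.sum_eq_zero_iff_of_nonpos fun k _ =>
    mul_nonpos_of_nonneg_of_nonpos (coef_nonneg k a) (h k)]
  simp [mul_eq_zero]

/-- The excess of the value of a strategy over its price is a local martingale difference. -/
lemma locSuper_value_sub_price [IsFiniteMeasure μ] (hI : UnitIntegrable μ F) (hF : IsModel μ A F)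
    (hA : HA μ A F) (hZ : MemLp Z ⊤ μ) {t : Fin (T + 1)} {η : Ω → Mat d}
    (hη : AEStronglyMeasurable[H t] η μ) :
    LocSuper μ (H t) fun ω => Z ω ⬝ᵥ F t ω (η ω) - price μ H F Z t ω (η ω) := by
  refine (locSuper_sum_mul_sub_condExp (H.le t) (fun k => aestronglyMeasurable_coef hη k)
    fun k => hI.unitValue hZ t k).congr ?_
  filter_upwards [hA.dotProduct hF t] with ω h
  rw [h, price, ← Finset.sum_sub_distrib]
  exact Finset.sum_congr rfl fun k _ => mul_sub _ _ _

/-- Strategies whose total value is at least their total price have equal value and price. -/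
lemma sum_value_sub_price_eq_zero [IsFiniteMeasure μ] (hI : UnitIntegrable μ F)
    (hF : IsModel μ A F) (hA : HA μ A F) (hZ : MemLp Z ⊤ μ) {η : Fin (T + 1) → Ω → Mat d}
    (hη : η ∈ Strategies μ H A)
    (h : ∀ᵐ ω ∂μ, 0 ≤ ∑ s, (Z ω ⬝ᵥ F s ω (η s ω) - price μ H F Z s ω (η s ω))) :
    ∀ᵐ ω ∂μ, ∑ s, (Z ω ⬝ᵥ F s ω (η s ω) - price μ H F Z s ω (η s ω)) = 0 :=
  LocSuper.sum_eq_zero (fun s => locSuper_value_sub_price hI hF hA hZ (hη s).1) h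

/-- The conditional value is a nonnegative combination of unit prices, so its sign need only be
tested on units (those outside `A` have price zero). The indicator condition reduces to zero-price
strategies by restricting a strategy to its zero-price event. -/
lemma mem_D_iff [IsFiniteMeasure μ] (hI : UnitIntegrable μ F) (hF : IsModel μ A F)
    (hA : HA μ A F) : Z ∈ D μ H A F ↔ MemLp Z ⊤ μ ∧ (∀ᵐ ω ∂μ, ∀ i, 0 < Z ω i) ∧
      (∀ t, ∀ᵐ ω ∂μ, ∀ k, unitPrice μ H F Z t k ω ≤ 0) ∧
      ∀ t, ∀ η ∈ L0 μ (A : Set (Mat d)) (H t), (∀ᵐ ω ∂μ, price μ H F Z t ω (η ω) = 0) →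
        app (F t) η ∈ N0 μ H A F t := by
  have congr0 : ∀ {t} {ξ ξ' : Ω → Fin d → ℝ}, ξ ∈ N0 μ H A F t → ξ =ᵐ[μ] ξ' →
      ξ' ∈ N0 μ H A F t := by
    rintro t ξ ξ' ⟨⟨η, hη, h1⟩, η', hη', h2⟩ h
    exact ⟨⟨η, hη, h.symm.trans h1⟩, η', hη', h.symm.neg.trans h2⟩
  constructor
  · rintro ⟨hZ, hpos, h⟩
    refine ⟨hZ, hpos, fun t => ae_all_iff.2 fun k => ?_, fun t η hη hp => ?_⟩
    · by_cases hk : unit k ∈ A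
      · have hk' : (fun _ => unit k : Ω → Mat d) ∈ L0 μ (A : Set (Mat d)) (H t) := L0.const hk
        have := (h _ (update_mem_strategies zero_mem_strategies hk') t).1
        rw [Function.update_self] at this
        filter_upwards [this, Fbar_eq_price hI hF hA hZ hk'.1] with ω h1 h2
        rw [h2, price_unit] at h1
        exact h1
      · filter_upwards [unitPrice_eq_zero (H := H) (Z := Z) hA t hk] with ω h1
        exact h1.le
    · have := (h _ (update_mem_strategies zero_mem_strategies hη) t).2
      rw [Function.update_self] at this
      refine congr0 this ?_
      filter_upwards [hp, Fbar_eq_price hI hF hA hZ hη.1] with ω h1 h2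
      rw [Set.indicator_of_mem]
      change _ = _
      rw [h2, h1]
  · rintro ⟨hZ, hpos, hp, hnull⟩
    refine ⟨hZ, hpos, fun η hη t => ⟨?_, ?_⟩⟩
    · filter_upwards [Fbar_eq_price hI hF hA hZ (hη t).1, hp t] with ω h1 h2
      rw [h1]
      exact price_nonpos h2 _
    -- A genuinely `H t`-measurable version makes the zero-price event belong to `H t`.
    · obtain ⟨η', hη', -, hηη'⟩ := L0.exists_version (hη t)
      let S : Set Ω := {ω | price μ H F Z t ω (η' ω) = 0}
      have hS : MeasurableSet[H t] S := by
        have : StronglyMeasurable[H t] fun ω => price μ H F Z t ω (η' ω) :=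
          Finset.stronglyMeasurable_fun_sum _ fun k _ =>
            ((continuous_coef k).comp_stronglyMeasurable hη').mul stronglyMeasurable_condExp
        exact this.measurable (measurableSet_singleton 0)
      have h1 := L0.smul (L0.congr (hη t) hηη') (c := S.indicator fun _ => 1)
        (stronglyMeasurable_const.indicator hS).aestronglyMeasurable
        (Eventually.of_forall fun ω => Set.indicator_nonneg (fun _ _ => zero_le_one) ω)
      refine congr0 (hnull t _ h1 (Eventually.of_forall fun ω => ?_)) ?_
      · by_cases hω : ω ∈ S
        · simp only [Set.indicator_of_mem hω, one_smul]; exact hω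
        · simp only [Set.indicator_of_notMem hω, zero_smul]
          simpa using price_smul (μ := μ) (H := H) (F := F) (Z := Z) t ω le_rfl (0 : Mat d)
      · filter_upwards [hηη', Fbar_eq_price hI hF hA hZ (hη t).1, hF.2 t] with ω h2 h3 h4
        have h5 : (ω ∈ {ω | Fbar μ H F Z t (η t) ω = 0}) ↔ ω ∈ S := by
          change _ = _ ↔ _ = _
          rw [h3, h2]
        by_cases hω : ω ∈ S
        · rw [Set.indicator_of_mem (h5.2 hω)]
          simp [app, hω, h2]
        · rw [Set.indicator_of_notMem (fun h => hω (h5.1 h))]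
          simp [app, hω, h4.map_zero]

lemma dotProduct_nonneg_of_pos {z x : Fin d → ℝ} (hz : ∀ i, 0 < z i) (hx : x ∈ orthant d) :
    0 ≤ z ⬝ᵥ x := Finset.sum_nonneg fun i _ => mul_nonneg (hz i).le (hx i)

lemma eq_zero_of_dotProduct {z x : Fin d → ℝ} (hz : ∀ i, 0 < z i) (hx : x ∈ orthant d)
    (h : z ⬝ᵥ x = 0) : x = 0 := by
  ext i
  have := (Finset.sum_eq_zero_iff_of_nonneg fun i _ => mul_nonneg (hz i).le (hx i)).1 h i
    (Finset.mem_univ i)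
  exact (mul_eq_zero.1 this).resolve_left (hz i).ne'

/-- Value minus price sums to `Z · r` plus the nonnegative terms `-price`. A nonnegative sum of
local martingale differences is zero, so `r` and every price vanish, and zero price means membership
in `N0`. -/
lemma reversible_of_mem_D [IsFiniteMeasure μ] (hI : UnitIntegrable μ F)
    (hF : IsModel μ A F) (hA : HA μ A F) (hZ : Z ∈ D μ H A F) : Reversible μ H A F := by
  obtain ⟨hZ, hpos, hp, hnull⟩ := (mem_D_iff hI hF hA).1 hZ
  intro η hη r hr hsum
  have hsplit : ∀ᵐ ω ∂μ, ∑ s, (Z ω ⬝ᵥ F s ω (η s ω) - price μ H F Z s ω (η s ω)) =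
      Z ω ⬝ᵥ r ω + ∑ s, -price μ H F Z s ω (η s ω) := by
    filter_upwards [hsum] with ω h
    rw [← h, Finset.sum_apply, dotProduct_sum, ← Finset.sum_add_distrib]
    rfl
  have hprice : ∀ᵐ ω ∂μ, ∀ s ∈ Finset.univ, 0 ≤ -price μ H F Z s ω (η s ω) := by
    filter_upwards [ae_all_iff.2 hp] with ω h s _
    exact neg_nonneg.2 (price_nonpos (h s) _)
  have h0 := sum_value_sub_price_eq_zero hI hF hA hZ hη (by
    filter_upwards [hsplit, hprice, hpos, hr.2] with ω h1 h2 h3 h4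
    rw [h1]
    exact add_nonneg (dotProduct_nonneg_of_pos h3 h4) (Finset.sum_nonneg h2))
  have hall : ∀ᵐ ω ∂μ, r ω = 0 ∧ ∀ s, price μ H F Z s ω (η s ω) = 0 := by
    filter_upwards [hsplit, hprice, hpos, hr.2, h0] with ω h1 h2 h3 h4 h5
    have h6 := dotProduct_nonneg_of_pos h3 h4
    have h7 := Finset.sum_nonneg h2
    rw [h5] at h1
    refine ⟨eq_zero_of_dotProduct h3 h4 (by linarith), fun s => ?_⟩
    have := (Finset.sum_eq_zero_iff_of_nonneg h2).1 (by linarith) s (Finset.mem_univ s)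
    linarith
  exact ⟨hall.mono fun ω h => h.1, fun s => hnull s _ (hη s) (hall.mono fun ω h => h.2 s)⟩

end Prices

/-! ### Bounded densities for functionals on `L¹`. -/

section Duality

variable {Ω : Type*} {mΩ : MeasurableSpace Ω} {μ : Measure Ω} [IsProbabilityMeasure μ]

/-- The inclusion of `L²` into `L¹`. -/
noncomputable def inclusionL2 (μ : Measure Ω) [IsProbabilityMeasure μ] : Lp ℝ 2 μ →L[ℝ] Lp ℝ 1 μ :=
  LinearMap.mkContinuous
    { toFun := fun f => ((Lp.memLp f).mono_exponent one_le_two).toLp f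
      map_add' := fun f g => by
        rw [← MemLp.toLp_add]
        exact MemLp.toLp_congr _ _ (Lp.coeFn_add f g)
      map_smul' := fun c f => by
        rw [RingHom.id_apply, ← MemLp.toLp_const_smul]
        exact MemLp.toLp_congr _ _ (Lp.coeFn_smul c f) } 1 fun f => by
    rw [one_mul]
    change ‖((Lp.memLp f).mono_exponent one_le_two).toLp f‖ ≤ ‖f‖
    rw [Lp.norm_toLp, Lp.norm_def]
    exact ENNReal.toReal_mono (Lp.memLp f).2.ne
      (eLpNorm_le_eLpNorm_of_exponent_le one_le_two (Lp.memLp f).1)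

lemma inclusionL2_indicator {S : Set Ω} (hS : MeasurableSet S) (c : ℝ) :
    inclusionL2 μ (indicatorConstLp 2 hS (measure_ne_top μ S) c) =
      indicatorConstLp 1 hS (measure_ne_top μ S) c := by
  change ((Lp.memLp (indicatorConstLp 2 hS (measure_ne_top μ S) c)).mono_exponent
    one_le_two).toLp _ = _
  exact MemLp.toLp_congr _ _ indicatorConstLp_coeFn

/-- Continuous linear functionals on `L¹` are given by bounded random variables. -/
lemma exists_bounded_density (ψ : Lp ℝ 1 μ →L[ℝ] ℝ) :
    ∃ z : Ω → ℝ, MemLp z ⊤ μ ∧ ∀ g : Lp ℝ 1 μ, ψ g = ∫ ω, z ω * g ω ∂μ := by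
  -- Riesz representation in `L²` supplies the density; testing against indicators shows that it is
  -- bounded by the norm of `ψ`.
  let z : Lp ℝ 2 μ := (InnerProductSpace.toDual ℝ (Lp ℝ 2 μ)).symm (ψ.comp (inclusionL2 μ))
  have hzint : Integrable z μ := (Lp.memLp z).integrable one_le_two
  have hind : ∀ (S : Set Ω) (hS : MeasurableSet S) (c : ℝ),
      ψ (indicatorConstLp 1 hS (measure_ne_top μ S) c) = c * ∫ ω in S, z ω ∂μ := by
    intro S hS c
    rw [← inclusionL2_indicator hS]
    change (ψ.comp (inclusionL2 μ)) _ = _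
    rw [← InnerProductSpace.toDual_symm_apply, real_inner_comm,
      L2.inner_indicatorConstLp_eq_inner_setIntegral]
    simp [mul_comm, z]
  have hbound : ∀ᵐ ω ∂μ, ‖z ω‖ ≤ ‖ψ‖ := by
    have hle : ∀ S, MeasurableSet S → |∫ ω in S, z ω ∂μ| ≤ ∫ _ in S, ‖ψ‖ ∂μ := by
      intro S hS
      have h1 := ψ.le_opNorm (indicatorConstLp 1 hS (measure_ne_top μ S) 1)
      rw [hind, one_mul, norm_indicatorConstLp one_ne_zero ENNReal.one_ne_top] at h1
      simpa [mul_comm] using h1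
    have h1 := ae_le_of_forall_setIntegral_le hzint (integrable_const ‖ψ‖)
      fun S hS _ => (le_abs_self _).trans (hle S hS)
    have h2 := ae_le_of_forall_setIntegral_le hzint.neg (integrable_const ‖ψ‖)
      fun S hS _ => by
        simp only [Pi.neg_apply, integral_neg]
        exact (neg_le_abs _).trans (hle S hS)
    filter_upwards [h1, h2] with ω e1 e2
    rw [Real.norm_eq_abs, abs_le]
    have : -z ω ≤ ‖ψ‖ := e2
    exact ⟨by linarith, e1⟩
  have hz : MemLp z ⊤ μ := memLp_top_of_bound (Lp.aestronglyMeasurable z) _ hbound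
  have hmul : ∀ g : Lp ℝ 1 μ, Integrable (fun ω => z ω * g ω) μ := fun g =>
    (L1.integrable_coeFn g).bdd_mul (Lp.aestronglyMeasurable z) hbound
  -- Continuity of the integral functional allows the identity to be extended from indicators to all
  -- of `L¹`.
  let R : Lp ℝ 1 μ →L[ℝ] ℝ := LinearMap.mkContinuous
    { toFun := fun g => ∫ ω, z ω * g ω ∂μ
      map_add' := fun f g => by
        rw [← integral_add (hmul f) (hmul g)]
        refine integral_congr_ae ?_
        filter_upwards [Lp.coeFn_add f g] with ω h
        rw [h, Pi.add_apply, mul_add]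
      map_smul' := fun c f => by
        rw [RingHom.id_apply, smul_eq_mul, ← integral_const_mul]
        refine integral_congr_ae ?_
        filter_upwards [Lp.coeFn_smul c f] with ω h
        rw [h, Pi.smul_apply, smul_eq_mul]
        ring } ‖ψ‖ fun g => by
    rw [L1.norm_eq_integral_norm, ← integral_const_mul]
    refine (norm_integral_le_integral_norm _).trans (integral_mono_ae (hmul g).norm
      ((L1.integrable_coeFn g).norm.const_mul _) ?_)
    filter_upwards [hbound] with ω h
    simp only [norm_mul]
    exact mul_le_mul_of_nonneg_right h (norm_nonneg _)
  refine ⟨z, hz, fun g => ?_⟩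
  change ψ g = R g
  refine Lp.induction ENNReal.one_ne_top (motive := fun g => ψ g = R g) ?_ ?_ ?_ g
  · intro c S hS hμS
    rw [Lp.simpleFunc.coe_indicatorConst, hind]
    change _ = ∫ ω, z ω * _ ∂μ
    rw [← integral_const_mul, ← integral_indicator hS]
    refine integral_congr_ae ?_
    filter_upwards [indicatorConstLp_coeFn (p := 1) (hs := hS) (hμs := hμS.ne) (c := c)] with ω h
    rw [h]
    by_cases hω : ω ∈ S <;> simp [hω, mul_comm]
  · intro f g hf hg _ h1 h2
    rw [map_add, map_add, h1, h2]
  · exact isClosed_eq ψ.continuous R.continuous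

lemma exists_bounded_density_pi {d : ℕ} (ψ : Lp (Fin d → ℝ) 1 μ →L[ℝ] ℝ) :
    ∃ Z : Ω → Fin d → ℝ, MemLp Z ⊤ μ ∧ ∀ g : Lp (Fin d → ℝ) 1 μ,
      ψ g = ∫ ω, Z ω ⬝ᵥ g ω ∂μ := by
  let e : ∀ i : Fin d, ℝ →L[ℝ] (Fin d → ℝ) := fun i => ContinuousLinearMap.single ℝ (fun _ => ℝ) i
  let p : ∀ i : Fin d, (Fin d → ℝ) →L[ℝ] ℝ := fun i => ContinuousLinearMap.proj i
  choose z hz hzψ using fun i => exists_bounded_density (ψ.comp ((e i).compLpL 1 μ))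
  refine ⟨fun ω i => z i ω, memLp_pi_iff.2 hz, fun g => ?_⟩
  have hp : ∀ i, ((p i).compLpL 1 μ g : Ω → ℝ) =ᵐ[μ] fun ω => g ω i := fun i =>
    (p i).coeFn_compLpL g
  have hg : g = ∑ i, (e i).compLpL 1 μ ((p i).compLpL 1 μ g) := by
    refine Lp.ext ?_
    have h1 : ∀ i, ((e i).compLpL 1 μ ((p i).compLpL 1 μ g) : Ω → Fin d → ℝ) =ᵐ[μ]
        fun ω => Pi.single i (g ω i) := fun i => by
      filter_upwards [(e i).coeFn_compLpL ((p i).compLpL 1 μ g), hp i] with ω h1 h2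
      rw [h1, h2]; rfl
    filter_upwards [Lp.coeFn_finsetSum Finset.univ
      (fun i => (e i).compLpL 1 μ ((p i).compLpL 1 μ g)), ae_all_iff.2 h1] with ω h2 h3
    rw [h2, Finset.sum_apply]
    simp only [h3]
    exact (Finset.univ_sum_single _).symm
  have hint : ∀ i, Integrable (fun ω => z i ω * g ω i) μ := fun i =>
    ((L1.integrable_coeFn g).eval i).mul_of_top_right (hz i)
  conv_lhs => rw [hg, map_sum]
  simp only [dotProduct]
  rw [integral_finsetSum _ fun i _ => hint i]
  refine Finset.sum_congr rfl fun i _ => ?_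
  refine (hzψ i _).trans (integral_congr_ae ?_)
  filter_upwards [hp i] with ω h
  rw [h]

end Duality

/-! ### Polar cones, separation and exhaustion. -/

section Polar

variable {Ω : Type*} {mΩ : MeasurableSpace Ω} {μ : Measure Ω} {d : ℕ}
  {C : Set (Ω → Fin d → ℝ)}

/-- The bounded nonnegative random vectors that are nonpositive on the integrable elements of a
set. -/
def polar (μ : Measure Ω) (C : Set (Ω → Fin d → ℝ)) : Set (Ω → Fin d → ℝ) :=
  {Z | MemLp Z ⊤ μ ∧ (∀ᵐ ω ∂μ, ∀ i, 0 ≤ Z ω i) ∧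
    ∀ g ∈ C, Integrable g μ → ∫ ω, Z ω ⬝ᵥ g ω ∂μ ≤ 0}

/-- The integrable elements of a closed cone, as a closed cone in `L¹`. -/
noncomputable def IsClosedCone.toProperCone {m : MeasurableSpace Ω} (hC : IsClosedCone μ m C) :
    ProperCone ℝ (Lp (Fin d → ℝ) 1 μ) where
  carrier := {g | (g : Ω → Fin d → ℝ) ∈ C}
  add_mem' := fun {f g} hf hg => hC.congr _ (hC.add _ hf _ hg) _ (Lp.coeFn_add f g).symm
  zero_mem' := hC.congr _ hC.zero _ (Lp.coeFn_zero _ _ _).symm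
  smul_mem' := fun c g hg => hC.congr _ (hC.smul (fun _ => (c : ℝ)) aestronglyMeasurable_const
    (Eventually.of_forall fun _ => c.2) _ hg) _ (Lp.coeFn_smul (c : ℝ) g).symm
  isClosed' := by
    refine IsSeqClosed.isClosed fun g g' hg h => ?_
    obtain ⟨ns, _, hns⟩ := (tendstoInMeasure_of_tendsto_Lp h).exists_seq_tendsto_ae
    exact hC.lim _ _ (fun n => hg (ns n)) hns

/-- Integrable random vectors outside a closed cone are separated from it by its polar. -/
lemma IsClosedCone.exists_polar [IsProbabilityMeasure μ] {m : MeasurableSpace Ω}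
    (hC : IsClosedCone μ m C) {h : Ω → Fin d → ℝ} (hh : Integrable h μ) (hhC : h ∉ C) :
    ∃ Z ∈ polar μ C, 0 < ∫ ω, Z ω ⬝ᵥ h ω ∂μ := by
  have h1 : hh.toL1 h ∉ hC.toProperCone := fun h' => hhC (hC.congr _ h' _ hh.coeFn_toL1)
  obtain ⟨φ, hφ, hφh⟩ := ProperCone.hyperplane_separation_point _ h1
  -- The separating functional is nonnegative on the cone and negative at `h`, hence the change of
  -- sign.
  obtain ⟨Z, hZ, hZφ⟩ := exists_bounded_density_pi (-φ)
  have hint : ∀ g : Ω → Fin d → ℝ, ∀ hg : Integrable g μ,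
      ∫ ω, Z ω ⬝ᵥ g ω ∂μ = -φ (hg.toL1 g) := by
    intro g hg
    have := hZφ (hg.toL1 g)
    rw [neg_apply] at this
    rw [this]
    refine integral_congr_ae ?_
    filter_upwards [hg.coeFn_toL1] with ω e
    rw [e]
  have hneg : ∀ g ∈ C, Integrable g μ → ∫ ω, Z ω ⬝ᵥ g ω ∂μ ≤ 0 := by
    intro g hg hgi
    rw [hint g hgi, neg_nonpos]
    exact hφ _ (hC.congr _ hg _ hgi.coeFn_toL1.symm)
  refine ⟨Z, ⟨hZ, ae_all_iff.2 fun i => ?_, hneg⟩, ?_⟩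
  · have hZi : MemLp (fun ω => Z ω i) ⊤ μ := memLp_pi_iff.1 hZ i
    refine ae_nonneg_of_forall_setIntegral_nonneg (hZi.integrable le_top) fun S hS _ => ?_
    -- Solidity puts `-r` in the cone, and testing against it gives the sign of the `i`-th component
    -- on `S`.
    let r : Ω → Fin d → ℝ := S.indicator fun _ => Pi.single i 1
    have hr : r ∈ L0 μ (orthant d) mΩ := by
      refine ⟨(stronglyMeasurable_const.indicator hS).aestronglyMeasurable,
        Eventually.of_forall fun ω j => ?_⟩
      by_cases hω : ω ∈ S
      · simp only [r, Set.indicator_of_mem hω]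
        by_cases hj : j = i
        · subst hj; simp
        · simp [hj]
      · simp [r, hω]
    have hri : Integrable r μ := (integrable_const _).indicator hS
    have h2 := hneg _ (hC.sub 0 hC.zero r hr) (by simpa using hri.neg)
    have h3 : ∀ ω, Z ω ⬝ᵥ (0 - r) ω = -S.indicator (fun ω => Z ω i) ω := fun ω => by
      by_cases hω : ω ∈ S <;> simp [r, hω]
    simp only [h3] at h2
    rw [integral_neg, integral_indicator hS] at h2
    linarith
  · rw [hint h hh]
    linarith

lemma polar_smul {Z : Ω → Fin d → ℝ} (hZ : Z ∈ polar μ C) {c : ℝ} (hc : 0 ≤ c) :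
    c • Z ∈ polar μ C := by
  refine ⟨hZ.1.const_smul c, ?_, fun g hg hgi => ?_⟩
  · filter_upwards [hZ.2.1] with ω h i using mul_nonneg hc (h i)
  · simp only [Pi.smul_apply, smul_dotProduct]
    rw [integral_smul]
    exact mul_nonpos_of_nonneg_of_nonpos hc (hZ.2.2 g hg hgi)

lemma zero_mem_polar : (0 : Ω → Fin d → ℝ) ∈ polar μ C := by
  refine ⟨MemLp.zero, by simp, fun g _ _ => by simp⟩

lemma summable_of_le_half_pow {x : ℕ → ℝ} (h0 : ∀ n, 0 ≤ x n) (h : ∀ n, x n ≤ (1 / 2) ^ n) :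
    Summable x := Summable.of_nonneg_of_le h0 h summable_geometric_two

/-- The geometric bounds make the sum bounded and the series of integrals against an integrable
vector absolutely convergent, so sum and integral can be exchanged. -/
lemma polar_tsum {Z : ℕ → Ω → Fin d → ℝ} (hZ : ∀ n, Z n ∈ polar μ C)
    (hb : ∀ n, ∀ᵐ ω ∂μ, ∀ i, Z n ω i ≤ (1 / 2) ^ n) :
    (fun ω i => ∑' n, Z n ω i) ∈ polar μ C := by
  have hsum : ∀ᵐ ω ∂μ, ∀ i, (∀ n, 0 ≤ Z n ω i) ∧ (∀ n, Z n ω i ≤ (1 / 2) ^ n) ∧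
      Summable fun n => Z n ω i := by
    filter_upwards [ae_all_iff.2 hb, ae_all_iff.2 fun n => (hZ n).2.1] with ω h1 h2 i
    exact ⟨fun n => h2 n i, fun n => h1 n i,
      summable_of_le_half_pow (fun n => h2 n i) fun n => h1 n i⟩
  refine ⟨memLp_pi_iff.2 fun i => ?_, ?_, fun g hg hgi => ?_⟩
  · refine memLp_top_of_bound ?_ 2 ?_
    · refine aestronglyMeasurable_of_tendsto_ae atTop
        (f := fun N ω => ∑ n ∈ Finset.range N, Z n ω i) (fun N => ?_) ?_
      · exact Finset.aestronglyMeasurable_fun_sum _ fun n _ => (memLp_pi_iff.1 (hZ n).1 i).1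
      · filter_upwards [hsum] with ω h using (h i).2.2.hasSum.tendsto_sum_nat
    · filter_upwards [hsum] with ω h
      rw [Real.norm_of_nonneg (tsum_nonneg (h i).1)]
      refine ((h i).2.2.tsum_le_tsum (h i).2.1 summable_geometric_two).trans ?_
      rw [tsum_geometric_two]
  · filter_upwards [hsum] with ω h i using tsum_nonneg (h i).1
  · have hint : ∀ n, Integrable (fun ω => Z n ω ⬝ᵥ g ω) μ := fun n =>
      integrable_dotProduct (hZ n).1 hgi
    have hgabs : Integrable (fun ω => ∑ i, |g ω i|) μ :=
      integrable_finsetSum _ fun i _ => (hgi.eval i).abs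
    have hnorm : ∀ n, ∫ ω, ‖Z n ω ⬝ᵥ g ω‖ ∂μ ≤ (1 / 2) ^ n * ∫ ω, ∑ i, |g ω i| ∂μ := by
      intro n
      rw [← integral_const_mul]
      refine integral_mono_ae (hint n).norm (hgabs.const_mul _) ?_
      filter_upwards [hsum] with ω h
      simp only [Real.norm_eq_abs, dotProduct, Finset.mul_sum]
      refine (Finset.abs_sum_le_sum_abs _ _).trans (Finset.sum_le_sum fun i _ => ?_)
      rw [abs_mul, abs_of_nonneg ((h i).1 n)]
      exact mul_le_mul_of_nonneg_right ((h i).2.1 n) (abs_nonneg _)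
    have h1 := hasSum_integral_of_summable_integral_norm hint
      (Summable.of_nonneg_of_le (fun n => integral_nonneg fun ω => norm_nonneg _) hnorm
        (summable_geometric_two.mul_right _))
    have h2 : ∫ ω, (fun i => ∑' n, Z n ω i) ⬝ᵥ g ω ∂μ = ∫ ω, ∑' n, Z n ω ⬝ᵥ g ω ∂μ := by
      refine integral_congr_ae ?_
      filter_upwards [hsum] with ω h
      simp only [dotProduct]
      rw [Summable.tsum_finsetSum fun i _ => (h i).2.2.mul_right _]
      exact Finset.sum_congr rfl fun i _ => tsum_mul_right.symm
    rw [h2]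
    exact hasSum_le (fun n => (hZ n).2.2 g hg hgi) h1 hasSum_zero

/-- A family that is directed with respect to countably many notions of support has an element whose
supports are maximal. -/
lemma exists_maximal_support [IsFiniteMeasure μ] {α ι : Type*} [Countable ι] {P : Set α}
    (hne : P.Nonempty) (S : ι → α → Set Ω) (hS : ∀ i, ∀ z ∈ P, NullMeasurableSet (S i z) μ)
    (hdir : ∀ z : ℕ → α, (∀ n, z n ∈ P) → ∃ z' ∈ P, ∀ i n, S i (z n) ≤ᵐ[μ] S i z') :
    ∃ z' ∈ P, ∀ z ∈ P, ∀ i, S i z ≤ᵐ[μ] S i z' := by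
  have hdir2 : ∀ z ∈ P, ∀ w ∈ P, ∃ z' ∈ P, ∀ i, S i z ≤ᵐ[μ] S i z' ∧ S i w ≤ᵐ[μ] S i z' := by
    intro z hz w hw
    obtain ⟨z', hz', h⟩ := hdir (fun n => if n = 0 then z else w) fun n => by
      by_cases hn : n = 0 <;> simp [hn, hz, hw]
    exact ⟨z', hz', fun i => ⟨by simpa using h i 0, by simpa using h i 1⟩⟩
  have single : ∀ i, ∃ z' ∈ P, ∀ z ∈ P, S i z ≤ᵐ[μ] S i z' := by
    intro i
    let s : ENNReal := ⨆ z ∈ P, μ (S i z)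
    have hs : ∀ z ∈ P, μ (S i z) ≤ s := fun z hz => le_iSup₂ (f := fun z _ => μ (S i z)) z hz
    have happrox : ∃ z : ℕ → α, (∀ n, z n ∈ P) ∧ s ≤ ⨆ n, μ (S i (z n)) := by
      have hsne : ((fun z => μ (S i z)) '' P).Nonempty := hne.image _
      obtain ⟨u, -, hu, hmem⟩ := exists_seq_tendsto_sSup hsne (OrderTop.bddAbove _)
      choose z hz hzu using hmem
      refine ⟨z, hz, ?_⟩
      have hsS : s = sSup ((fun z => μ (S i z)) '' P) := by rw [sSup_image]
      rw [hsS]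
      refine le_of_tendsto' hu fun n => ?_
      rw [← hzu n]
      exact le_iSup (fun n => μ (S i (z n))) n
    obtain ⟨z, hz, hsz⟩ := happrox
    obtain ⟨z', hz', h'⟩ := hdir z hz
    -- An element dominating a maximising sequence attains the supremum. Any further enlargement has
    -- the same measure, hence is the same event up to null sets.
    have hmax : s ≤ μ (S i z') := hsz.trans (iSup_le fun n => measure_mono_ae (h' i n))
    refine ⟨z', hz', fun w hw => ?_⟩
    obtain ⟨v, hv, hvi⟩ := hdir2 z' hz' w hw
    have heq : S i z' =ᵐ[μ] S i v := ae_eq_of_ae_subset_of_measure_ge (hvi i).1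
      ((hs v hv).trans hmax) (hS i z' hz') (measure_ne_top _ _)
    exact (hvi i).2.trans heq.symm.le
  choose z hz hzmax using single
  cases isEmpty_or_nonempty ι with
  | inl h =>
    obtain ⟨z₀, hz₀⟩ := hne
    exact ⟨z₀, hz₀, fun _ _ i => isEmptyElim i⟩
  | inr h =>
    obtain ⟨u, hu⟩ := exists_surjective_nat ι
    obtain ⟨z', hz', h'⟩ := hdir (fun n => z (u n)) fun n => hz _
    refine ⟨z', hz', fun w hw i => ?_⟩
    obtain ⟨n, rfl⟩ := hu i
    exact (hzmax (u n) w hw).trans (h' (u n) n)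

end Polar

/-! ### Construction of a dual element from reversibility. -/

section DualElement

variable {Ω : Type*} {mΩ : MeasurableSpace Ω} {μ : Measure Ω} {d T : ℕ}
  {H : Filtration (Fin (T + 1)) mΩ} {A : ProperCone ℝ (Mat d)}
  {F : Fin (T + 1) → Ω → Mat d → Fin d → ℝ} {Z : Ω → Fin d → ℝ}

lemma app_mem_attainable (hF : IsModel μ A F) {t : Fin (T + 1)} {η : Ω → Mat d}
    (hη : η ∈ L0 μ (A : Set (Mat d)) (H t)) : app (F t) η ∈ Attainable μ H A F (Fin.last T) := by
  rw [attainable_last]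
  refine ⟨_, update_mem_strategies zero_mem_strategies hη, 0, orthant_zero, ?_⟩
  filter_upwards [ae_all_iff.2 fun s => hF.app_zero s] with ω h
  simp only [Nat.zero_le, Finset.filter_true, Pi.sub_apply, Finset.sum_apply, Pi.zero_apply,
    sub_zero]
  rw [Finset.sum_eq_single t]
  · simp
  · intro s _ hs
    rw [Function.update_of_ne hs]
    exact h s
  · simp

lemma Reversible.eq_zero_of_attainable (hR : Reversible μ H A F) {g : Ω → Fin d → ℝ}
    (hg : g ∈ Attainable μ H A F (Fin.last T)) (hg0 : g ∈ L0 μ (orthant d) mΩ) : g =ᵐ[μ] 0 := by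
  rw [attainable_last] at hg
  obtain ⟨η, hη, r, hr, h⟩ := hg
  obtain ⟨h0, -⟩ := hR η hη _ (orthant_add hg0 hr) (by
    filter_upwards [h] with ω e
    simp [e])
  filter_upwards [h0, hg0.2, hr.2] with ω h1 h2 h3
  ext i
  have e1 := congrFun h1 i
  have e2 := h2 i
  have e3 := h3 i
  simp only [Pi.add_apply, Pi.zero_apply] at e1 ⊢
  linarith

lemma unitPrice_add (hI : UnitIntegrable μ F) {Z Z' : Ω → Fin d → ℝ} (hZ : MemLp Z ⊤ μ)
    (hZ' : MemLp Z' ⊤ μ) (t : Fin (T + 1)) (k : Idx d) :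
    unitPrice μ H F (Z + Z') t k =ᵐ[μ] unitPrice μ H F Z t k + unitPrice μ H F Z' t k := by
  have : unitValue F (Z + Z') t k = unitValue F Z t k + unitValue F Z' t k := by
    ext ω
    simp [unitValue, add_dotProduct]
  rw [unitPrice, this]
  exact condExp_add (hI.unitValue hZ t k) (hI.unitValue hZ' t k) _

lemma unitPrice_smul (c : ℝ) (Z : Ω → Fin d → ℝ) (t : Fin (T + 1)) (k : Idx d) :
    unitPrice μ H F (c • Z) t k =ᵐ[μ] c • unitPrice μ H F Z t k := by
  have : unitValue F (c • Z) t k = c • unitValue F Z t k := by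
    ext ω
    simp [unitValue, smul_dotProduct]
  rw [unitPrice, this]
  exact condExp_smul c _ _

/-- For a unit in `A` and `S` in `H t`, using the unit on `S` only is a strategy, so its transfer is
attainable and has nonpositive mean under `Z`. That mean is the integral of the price over `S`. -/
lemma unitPrice_nonpos_of_mem_polar [IsFiniteMeasure μ] (hI : UnitIntegrable μ F)
    (hF : IsModel μ A F) (hA : HA μ A F) (hZ : Z ∈ polar μ (Attainable μ H A F (Fin.last T)))
    (t : Fin (T + 1)) (k : Idx d) : ∀ᵐ ω ∂μ, unitPrice μ H F Z t k ω ≤ 0 := by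
  by_cases hk : unit k ∈ A
  · have hint : Integrable (unitPrice μ H F Z t k) μ := integrable_condExp
    have hval := hI.unitValue hZ.1 t k
    have key : ∀ᵐ ω ∂(μ.trim (H.le t)), 0 ≤ -unitPrice μ H F Z t k ω := by
      have hintT : Integrable (unitPrice μ H F Z t k) (μ.trim (H.le t)) :=
        hint.trim (H.le t) stronglyMeasurable_condExp
      refine ae_nonneg_of_forall_setIntegral_nonneg hintT.neg fun S hS _ => ?_
      rw [integral_neg, neg_nonneg, ← setIntegral_trim (H.le t) (f := unitPrice μ H F Z t k)
        stronglyMeasurable_condExp hS, unitPrice, setIntegral_condExp (H.le t) hval hS]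
      have hη := L0.smul (L0.const (m := H t) (μ := μ) hk) (c := S.indicator fun _ => 1)
        (stronglyMeasurable_const.indicator hS).aestronglyMeasurable
        (Eventually.of_forall fun ω => Set.indicator_nonneg (fun _ _ => zero_le_one) ω)
      have happ : app (F t) (fun ω => (S.indicator (fun _ => (1 : ℝ)) ω) • unit k) =ᵐ[μ]
          S.indicator fun ω => F t ω (unit k) := by
        filter_upwards [hF.2 t] with ω h
        by_cases hω : ω ∈ S <;> simp [app, hω, h.map_zero]
      have hint' := (((hI.unit t k).indicator (H.le t _ hS)).congr happ.symm)
      have := hZ.2.2 _ (app_mem_attainable hF hη) hint'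
      rw [← integral_indicator (H.le t _ hS)]
      refine le_of_eq_of_le (integral_congr_ae ?_) this
      filter_upwards [happ] with ω h
      rw [h]
      by_cases hω : ω ∈ S <;> simp [hω, unitValue]
    filter_upwards [ae_of_ae_trim (H.le t) key] with ω h
    linarith
  · filter_upwards [unitPrice_eq_zero (H := H) (Z := Z) hA t hk] with ω h
    exact h.le

/-- The supports to be maximised: positivity of the components, negativity of the unit prices. -/
def supports (μ : Measure Ω) (H : Filtration (Fin (T + 1)) mΩ)
    (F : Fin (T + 1) → Ω → Mat d → Fin d → ℝ) (j : Fin d ⊕ (Fin (T + 1) × Idx d))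
    (Z : Ω → Fin d → ℝ) : Set Ω :=
  match j with
  | .inl i => {ω | 0 < Z ω i}
  | .inr p => {ω | unitPrice μ H F Z p.1 p.2 ω < 0}

/-- A weighted series of countably many polar elements dominates the supports of all of them:
neither components nor unit prices can cancel, since all components are nonnegative and all unit
prices nonpositive. -/
lemma exists_maximal_polar [IsFiniteMeasure μ] (hI : UnitIntegrable μ F) (hF : IsModel μ A F)
    (hA : HA μ A F) : ∃ Z' ∈ polar μ (Attainable μ H A F (Fin.last T)),
      ∀ Z ∈ polar μ (Attainable μ H A F (Fin.last T)), ∀ j,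
        supports μ H F j Z ≤ᵐ[μ] supports μ H F j Z' := by
  refine exists_maximal_support ⟨0, zero_mem_polar⟩ (supports μ H F) (fun j Z hZ => ?_)
    fun Z hZ => ?_
  · rcases j with i | ⟨t, k⟩
    · exact nullMeasurableSet_lt aemeasurable_const
        ((memLp_pi_iff.1 hZ.1 i).1.aemeasurable)
    · exact nullMeasurableSet_lt
        ((stronglyMeasurable_condExp.mono (H.le t)).aestronglyMeasurable.aemeasurable)
        aemeasurable_const
  · have hbound : ∀ n, ∃ M : ℝ, 0 < M ∧ ∀ᵐ ω ∂μ, ∀ i, Z n ω i ≤ M := by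
      intro n
      have hfin : eLpNormEssSup (Z n) μ ≠ ⊤ := by
        rw [← eLpNorm_exponent_top]
        exact (hZ n).1.2.ne
      refine ⟨max (eLpNormEssSup (Z n) μ).toReal 1, lt_max_of_lt_right one_pos, ?_⟩
      filter_upwards [ae_le_eLpNormEssSup (f := Z n) (μ := μ)] with ω h i
      have h' : ‖Z n ω‖ ≤ (eLpNormEssSup (Z n) μ).toReal := by
        rw [← toReal_enorm]
        exact ENNReal.toReal_mono hfin h
      exact ((le_abs_self _).trans (norm_le_pi_norm (Z n ω) i)).trans (h'.trans (le_max_left _ _))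
    choose M hM hZM using hbound
    let w : ℕ → ℝ := fun n => (1 / 2) ^ n / M n
    have hw : ∀ n, 0 < w n := fun n => div_pos (by positivity) (hM n)
    have hwZ : ∀ n, w n • Z n ∈ polar μ (Attainable μ H A F (Fin.last T)) := fun n =>
      polar_smul (hZ n) (hw n).le
    have hwb : ∀ n, ∀ᵐ ω ∂μ, ∀ i, (w n • Z n) ω i ≤ (1 / 2) ^ n := fun n => by
      filter_upwards [hZM n] with ω h i
      have := mul_le_mul_of_nonneg_left (h i) (hw n).le
      rw [div_mul_cancel₀ _ (hM n).ne'] at this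
      exact this
    refine ⟨_, polar_tsum hwZ hwb, fun j n => ?_⟩
    -- The series without its `n`-th term is again polar, so adding it cannot destroy a support of
    -- the `n`-th term.
    have hrest : (fun ω i => ∑' l, (if l = n then 0 else w l • Z l) ω i) ∈
        polar μ (Attainable μ H A F (Fin.last T)) := by
      refine polar_tsum (fun l => ?_) fun l => ?_
      · split_ifs
        · exact zero_mem_polar
        · exact hwZ l
      · split_ifs
        · exact Eventually.of_forall fun ω i => by simp
        · exact hwb l
    have hsplit : (fun ω i => ∑' l, (w l • Z l) ω i) =ᵐ[μ]
        w n • Z n + fun ω i => ∑' l, (if l = n then 0 else w l • Z l) ω i := by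
      filter_upwards [ae_all_iff.2 hwb, ae_all_iff.2 fun l => (hwZ l).2.1] with ω h1 h2
      ext i
      have hs := summable_of_le_half_pow (fun l => h2 l i) fun l => h1 l i
      rw [hs.tsum_eq_add_tsum_ite n]
      simp only [Pi.add_apply]
      congr 1
      refine tsum_congr fun l => ?_
      split_ifs <;> rfl
    rcases j with i | ⟨t, k⟩
    · filter_upwards [hsplit, hrest.2.1] with ω h1 h2 (h3 : 0 < Z n ω i)
      refine lt_of_lt_of_eq ?_ (congrFun h1 i).symm
      exact add_pos_of_pos_of_nonneg (mul_pos (hw n) h3) (h2 i)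
    · have h1 : unitPrice μ H F (fun ω i => ∑' l, (w l • Z l) ω i) t k =ᵐ[μ] unitPrice μ H F
          (w n • Z n + fun ω i => ∑' l, (if l = n then 0 else w l • Z l) ω i) t k :=
        condExp_congr_ae (by
          filter_upwards [hsplit] with ω h
          simp only [unitValue, h])
      filter_upwards [h1, unitPrice_add (H := H) hI (hwZ n).1 hrest.1 t k,
        unitPrice_smul (μ := μ) (H := H) (F := F) (w n) (Z n) t k,
        unitPrice_nonpos_of_mem_polar hI hF hA hrest t k]
        with ω e1 e2 e3 e4 (e5 : unitPrice μ H F (Z n) t k ω < 0)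
      change _ < 0
      rw [e1, e2, Pi.add_apply, e3, Pi.smul_apply, smul_eq_mul]
      linarith [mul_neg_of_pos_of_neg (hw n) e5]

/-- The mean of the value of a bounded strategy is the mean of its price. -/
lemma integral_value [IsFiniteMeasure μ] (hI : UnitIntegrable μ F) (hF : IsModel μ A F)
    (hA : HA μ A F) (hZ : MemLp Z ⊤ μ) {t : Fin (T + 1)} {η : Ω → Mat d}
    (hη : AEStronglyMeasurable[H t] η μ) {c : ℝ} (hc : ∀ᵐ ω ∂μ, nrm (η ω) ≤ c) :
    ∫ ω, Z ω ⬝ᵥ app (F t) η ω ∂μ = ∫ ω, price μ H F Z t ω (η ω) ∂μ := by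
  have hint := integrable_dotProduct hZ (hI.app hF hA (t := t) (hη.mono (H.le t)) hc)
  rw [← integral_condExp (H.le t)]
  exact integral_congr_ae ((genCondExp_eq_condExp hint).symm.trans
    (Fbar_eq_price hI hF hA hZ hη))

/-- The polar element with maximal supports is the candidate. Each remaining property is proved by
showing that a certain vector is attainable: otherwise a separating polar element would have a
larger support. -/
lemma Reversible.D_nonempty [IsProbabilityMeasure μ] (hR : Reversible μ H A F)
    (hI : UnitIntegrable μ F) (hF : IsModel μ A F) (hA : HA μ A F) (hN : HN0 μ H A F) :
    (D μ H A F).Nonempty := by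
  have hC := hR.isClosedCone_attainable hF hN
  obtain ⟨Z, hZ, hmax⟩ := exists_maximal_polar (H := H) hI hF hA
  have hprice : ∀ Z' ∈ polar μ (Attainable μ H A F (Fin.last T)), ∀ t, ∀ᵐ ω ∂μ, ∀ k,
      unitPrice μ H F Z' t k ω ≤ 0 := fun Z' hZ' t =>
    ae_all_iff.2 fun k => unitPrice_nonpos_of_mem_polar hI hF hA hZ' t k
  refine ⟨Z, (mem_D_iff hI hF hA).2 ⟨hZ.1, ae_all_iff.2 fun i => ?_, hprice Z hZ, ?_⟩⟩
  · let B : Set Ω := {ω | ¬0 < Z ω i}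
    have hB : NullMeasurableSet B μ := (nullMeasurableSet_lt aemeasurable_const
      ((memLp_pi_iff.1 hZ.1 i).1.aemeasurable)).compl
    let h : Ω → Fin d → ℝ := B.indicator fun _ => Pi.single i 1
    have hh : Integrable h μ := (integrable_const _).indicator₀ hB
    have hh0 : h ∈ L0 μ (orthant d) mΩ := by
      refine ⟨hh.1, Eventually.of_forall fun ω j => ?_⟩
      by_cases hω : ω ∈ B
      · simp only [h, Set.indicator_of_mem hω]
        by_cases hj : j = i
        · subst hj; simp
        · simp [hj]
      · simp [h, hω]
    have hmem : h ∈ Attainable μ H A F (Fin.last T) := by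
      by_contra hcon
      obtain ⟨Z', hZ', hpos⟩ := hC.exists_polar hh hcon
      refine hpos.not_ge (integral_nonpos_of_ae ?_)
      filter_upwards [hmax Z' hZ' (.inl i)] with ω h1
      by_cases hω : ω ∈ B
      · simp only [h, Set.indicator_of_mem hω, Pi.zero_apply, dotProduct_single, mul_one]
        exact not_lt.1 fun h2 => hω (h1 h2)
      · simp [h, hω]
    filter_upwards [hR.eq_zero_of_attainable hmem hh0] with ω h1
    by_contra hω
    have := congrFun h1 i
    simp only [h, Set.indicator_of_mem (show ω ∈ B from hω)] at this
    simp at this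
  · intro t η hη hη0
    let u : Ω → ℝ := fun ω => 1 + nrm (η ω)
    have hu : ∀ ω, 0 < u ω := fun ω => by linarith [nrm_nonneg (η ω)]
    have hum : AEStronglyMeasurable[H t] u μ :=
      (continuous_const.add continuous_nrm).comp_aestronglyMeasurable hη.1
    -- Normalising makes the transfer integrable, as separation requires; homogeneity restores `η`
    -- at the end.
    let θ : Ω → Mat d := fun ω => (u ω)⁻¹ • η ω
    have hθ : θ ∈ L0 μ (A : Set (Mat d)) (H t) := L0.smul hη
      (by exact ((continuous_const.add continuous_nrm).inv₀ fun a =>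
        ne_of_gt (show (0 : ℝ) < 1 + nrm a by linarith [nrm_nonneg a]) : Continuous fun a : Mat d =>
          (1 + nrm a)⁻¹).comp_aestronglyMeasurable hη.1)
      (Eventually.of_forall fun ω => (inv_pos.2 (hu ω)).le)
    have hηθ : ∀ ω, η ω = u ω • θ ω := fun ω => by
      simp only [θ, smul_smul, mul_inv_cancel₀ (hu ω).ne', one_smul]
    have hθb : ∀ᵐ ω ∂μ, nrm (θ ω) ≤ 1 := Eventually.of_forall fun ω => by
      simp only [θ, nrm_smul (inv_pos.2 (hu ω)).le]
      rw [inv_mul_le_iff₀ (hu ω)]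
      simp only [u]
      linarith
    have hθint : Integrable (app (F t) θ) μ := hI.app hF hA (hθ.1.mono (H.le t)) hθb
    have hmem : -app (F t) θ ∈ Attainable μ H A F (Fin.last T) := by
      by_contra hcon
      obtain ⟨Z', hZ', hpos⟩ := hC.exists_polar hθint.neg hcon
      -- By maximality, a unit with zero price under `Z` also has zero price under `Z'`. Zero
      -- `Z`-price strategies therefore have zero `Z'`-price and zero mean, against strict
      -- separation.
      have h0 : ∀ᵐ ω ∂μ, price μ H F Z' t ω (θ ω) = 0 := by
        filter_upwards [hη0, hprice Z hZ t, hprice Z' hZ' t,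
          ae_all_iff.2 fun k => hmax Z' hZ' (.inr (t, k))] with ω h1 h2 h3 h4
        have h5 : price μ H F Z t ω (θ ω) = 0 := by
          simp only [θ]
          rw [price_smul t ω (inv_pos.2 (hu ω)).le, h1, mul_zero]
        rw [price_eq_zero_iff h2] at h5
        rw [price_eq_zero_iff h3]
        refine fun k => (h5 k).imp_right fun h6 => le_antisymm (h3 k) (not_lt.1 fun h7 => ?_)
        have : unitPrice μ H F Z t k ω < 0 := h4 k h7
        exact this.ne h6
      have h1 := integral_value hI hF hA hZ'.1 hθ.1 hθb
      rw [integral_congr_ae h0, integral_zero] at h1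
      simp only [Pi.neg_apply, dotProduct_neg] at hpos
      rw [integral_neg, h1] at hpos
      simp at hpos
    rw [attainable_last] at hmem
    obtain ⟨ξ, hξ, r, hr, hsum⟩ := hmem
    obtain ⟨-, hneg, hfneg⟩ := hR.offset hF hN hξ hθ hr (by
      filter_upwards [hsum] with ω h
      simp only [Nat.zero_le, Finset.filter_true, Pi.sub_apply, Pi.neg_apply] at h
      rw [Pi.add_apply, ← sub_neg_eq_add, h]
      abel)
    have hnegη : (fun ω => u ω • (-θ) ω) = -η := by
      ext1 ω
      rw [Pi.neg_apply, Pi.neg_apply, smul_neg, ← hηθ]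
    have hη' : -η ∈ L0 μ (A : Set (Mat d)) (H t) := by
      rw [← hnegη]
      exact L0.smul hneg hum (Eventually.of_forall fun ω => (hu ω).le)
    refine ⟨⟨η, hη, EventuallyEq.rfl⟩, -η, hη', ?_⟩
    filter_upwards [hfneg, hF.2 t] with ω h1 h2
    have e1 : (-η) ω = u ω • (-θ) ω := (congrFun hnegη ω).symm
    simp only [app, Pi.neg_apply] at h1 ⊢
    rw [Pi.neg_apply, Pi.neg_apply] at e1
    rw [e1, h2.map_smul (hu ω).le, h1, hηθ ω, h2.map_smul (hu ω).le, smul_neg]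

end DualElement

/-! ### Directional derivatives of piecewise linear transfer maps. -/

section Slopes

variable {d : ℕ}

/-- The signed entry of a matrix along a signed matrix unit. -/
def ent (k : Idx d) (a : Mat d) : ℝ := if k.2 then a k.1.1 k.1.2 else -a k.1.1 k.1.2

lemma coef_eq_max (k : Idx d) (a : Mat d) : coef k a = max (ent k a) 0 := by
  unfold coef ent
  split_ifs <;> rfl

lemma ent_add (k : Idx d) (a b : Mat d) : ent k (a + b) = ent k a + ent k b := by
  unfold ent
  split_ifs <;> simp [add_comm]

lemma ent_smul (k : Idx d) (c : ℝ) (a : Mat d) : ent k (c • a) = c * ent k a := by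
  unfold ent
  split_ifs <;> simp

lemma continuous_ent (k : Idx d) : Continuous (ent k : Mat d → ℝ) := by
  have h := continuous_entry k.1.1 k.1.2
  unfold ent
  split_ifs
  · exact h
  · exact h.neg

/-- The signs of the entries of a matrix. -/
noncomputable def signs (b : Mat d) : Fin d × Fin d → SignType := fun p => SignType.sign (b p.1 p.2)

/-- The sign of the signed entries of the matrices with given entry signs. -/
def entSign (σ : Fin d × Fin d → SignType) (k : Idx d) : SignType := if k.2 then σ k.1 else -σ k.1

lemma entSign_signs (b : Mat d) (k : Idx d) : entSign (signs b) k = SignType.sign (ent k b) := by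
  unfold entSign signs ent
  split_ifs
  · rfl
  · rw [Left.sign_neg]

/-- The directional derivatives of `coef k` at the matrices with given entry signs. -/
noncomputable def dcoef (σ : Fin d × Fin d → SignType) (k : Idx d) (a : Mat d) : ℝ :=
  if entSign σ k = 1 then ent k a else if entSign σ k = -1 then 0 else coef k a

lemma continuous_dcoef (σ : Fin d × Fin d → SignType) (k : Idx d) : Continuous (dcoef σ k) := by
  unfold dcoef
  split_ifs
  · exact continuous_ent k
  · exact continuous_const
  · exact continuous_coef k

lemma dcoef_smul (σ : Fin d × Fin d → SignType) (k : Idx d) {c : ℝ} (hc : 0 ≤ c) (a : Mat d) :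
    dcoef σ k (c • a) = c * dcoef σ k a := by
  unfold dcoef
  split_ifs
  · exact ent_smul k c a
  · simp
  · exact coef_smul k hc a

lemma dcoef_signs_neg (k : Idx d) (a : Mat d) : dcoef (signs (-a)) k a = -coef k (-a) := by
  have h : ent k (-a) = -ent k a := by
    rw [← neg_one_smul ℝ a, ent_smul, neg_one_mul]
  unfold dcoef
  rw [entSign_signs, coef_eq_max, coef_eq_max, h]
  rcases lt_trichotomy (ent k a) 0 with h' | h' | h'
  · rw [if_pos (sign_pos (by linarith)), max_eq_left (by linarith)]; ring
  · simp [h']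
  · rw [sign_neg (by linarith), if_neg (by decide), if_pos rfl, max_eq_right (by linarith)]; ring

/-- For large `n` the nonzero entries of `n • b` fix the signs, so the first-order expansion at `n •
b` is exact. -/
lemma eventually_coef_eq (k : Idx d) (b a : Mat d) :
    ∀ᶠ n : ℕ in atTop, coef k ((n : ℝ) • b + a) = n * coef k b + dcoef (signs b) k a := by
  simp only [coef_eq_max, dcoef, entSign_signs, ent_add, ent_smul]
  rcases lt_trichotomy (ent k b) 0 with h | h | h
  · filter_upwards [(tendsto_natCast_atTop_atTop (R := ℝ)).eventually_ge_atTop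
      (ent k a / -ent k b)] with n hn
    rw [div_le_iff₀ (by linarith)] at hn
    rw [sign_neg h, if_neg (by decide), if_pos rfl, max_eq_right (by linarith),
      max_eq_right h.le]
    ring
  · simp [h]
  · filter_upwards [(tendsto_natCast_atTop_atTop (R := ℝ)).eventually_ge_atTop
      (-ent k a / ent k b)] with n hn
    rw [div_le_iff₀ h] at hn
    rw [sign_pos h, if_pos rfl, max_eq_left (by linarith), max_eq_left h.le]

/-- The directional derivative of a map that is determined by the signed matrix units. -/
noncomputable def slope (f : Mat d → Fin d → ℝ) (σ : Fin d × Fin d → SignType) (a : Mat d) :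
    Fin d → ℝ := ∑ k, dcoef σ k a • f (unit k)

variable {A : ProperCone ℝ (Mat d)} {f : Mat d → Fin d → ℝ}

lemma continuous_slope (σ : Fin d × Fin d → SignType) : Continuous (slope f σ) :=
  continuous_finsetSum _ fun k _ => (continuous_dcoef σ k).smul continuous_const

lemma slope_smul (σ : Fin d × Fin d → SignType) {c : ℝ} (hc : 0 ≤ c) (a : Mat d) :
    slope f σ (c • a) = c • slope f σ a := by
  simp [slope, dcoef_smul _ _ hc, Finset.smul_sum, mul_smul]

lemma slope_signs_neg (hform : ∀ a, f a = ∑ k, coef k a • f (unit k)) (a : Mat d) :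
    slope f (signs (-a)) a = -f (-a) := by
  rw [hform (-a), slope, ← Finset.sum_neg_distrib]
  exact Finset.sum_congr rfl fun k _ => by rw [dcoef_signs_neg, neg_smul]

lemma eventually_eq_slope (hform : ∀ a, f a = ∑ k, coef k a • f (unit k)) (b a : Mat d) :
    ∀ᶠ n : ℕ in atTop, f ((n : ℝ) • b + a) = (n : ℝ) • f b + slope f (signs b) a := by
  filter_upwards [eventually_all.2 fun k => eventually_coef_eq k b a] with n hn
  rw [hform, hform b, slope, Finset.smul_sum, ← Finset.sum_add_distrib]
  exact Finset.sum_congr rfl fun k _ => by rw [hn k, add_smul, smul_smul]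

/-- The slope is `f (n • b + a) - n • f b` for large `n`, which superadditivity bounds below by `f
a`. -/
lemma IsTransferMap.le_slope (hf : IsTransferMap A f)
    (hform : ∀ a, f a = ∑ k, coef k a • f (unit k)) {a b : Mat d} (ha : a ∈ A) (hb : b ∈ A)
    (i : Fin d) : f a i ≤ slope f (signs b) a i := by
  obtain ⟨n, hn⟩ := (eventually_eq_slope hform b a).exists
  have h := hf.le_add (A.smul_mem hb (Nat.cast_nonneg n)) ha i
  rw [hn, hf.map_smul (Nat.cast_nonneg n)] at h
  simpa using h

/-- Superadditivity at `n • b + a` and `n • b + a'` compares them with `2n • b + (a + a')`; the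
multiples of `f b` cancel. -/
lemma IsTransferMap.slope_superadditive (hf : IsTransferMap A f)
    (hform : ∀ a, f a = ∑ k, coef k a • f (unit k)) {a a' b : Mat d} (ha : a ∈ A) (ha' : a' ∈ A)
    (hb : b ∈ A) (i : Fin d) :
    slope f (signs b) a i + slope f (signs b) a' i ≤ slope f (signs b) (a + a') i := by
  have h2 : Tendsto (fun n : ℕ => 2 * n) atTop atTop :=
    tendsto_id.const_mul_atTop' (by norm_num)
  obtain ⟨n, h1, h1', h3⟩ := ((eventually_eq_slope hform b a).and
    ((eventually_eq_slope hform b a').and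
      (h2.eventually (eventually_eq_slope hform b (a + a'))))).exists
  have hnb := A.smul_mem hb (Nat.cast_nonneg (α := ℝ) n)
  have h := hf.le_add (A.add_mem hnb ha) (A.add_mem hnb ha') i
  have e : (n : ℝ) • b + a + ((n : ℝ) • b + a') = ((2 * n : ℕ) : ℝ) • b + (a + a') := by
    push_cast
    rw [two_mul, add_smul]
    abel
  rw [e, h1, h1', h3] at h
  simp only [Pi.add_apply, Pi.smul_apply, smul_eq_mul] at h
  push_cast at h
  linarith

lemma IsTransferMap.slope_add (hf : IsTransferMap A f)
    (hform : ∀ a, f a = ∑ k, coef k a • f (unit k)) {a b l : Mat d} (ha : a ∈ A) (hb : b ∈ A)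
    (hl : l ∈ A) (hl' : -l ∈ A) (hn : f (-l) = -f l) :
    slope f (signs b) (a + l) = slope f (signs b) a + f l := by
  obtain ⟨n, h1, h2⟩ := ((eventually_eq_slope hform b a).and
    (eventually_eq_slope hform b (a + l))).exists
  have h := (hf.add_smul_of_neg (A.add_mem (A.smul_mem hb (Nat.cast_nonneg (α := ℝ) n)) ha)
    hl hl' hn 1).2.2
  rw [one_smul, one_smul, add_assoc, h1, h2, add_assoc] at h
  exact add_left_cancel h

end Slopes

/-! ### Nonnegative functionals and domination on closed cones. -/

section Domination

variable {d : ℕ} {A : ProperCone ℝ (Mat d)}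

instance : LocallyConvexSpace ℝ (Mat d) :=
  inferInstanceAs (LocallyConvexSpace ℝ (Fin d → Fin d → ℝ))

/-- There is a nonnegative linear functional on a closed cone that vanishes only on its lineality
space. -/
lemma exists_nonneg_functional (A : ProperCone ℝ (Mat d)) :
    ∃ l : StrongDual ℝ (Mat d), (∀ a ∈ A, 0 ≤ l a) ∧ ∀ a ∈ A, l a = 0 → -a ∈ A := by
  classical
  let zeros : StrongDual ℝ (Mat d) → Submodule ℝ (Mat d) := fun l =>
    Submodule.span ℝ {a | a ∈ A ∧ l a = 0}
  have hex : ∃ n : ℕ, ∃ l : StrongDual ℝ (Mat d), (∀ a ∈ A, 0 ≤ l a) ∧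
      Module.finrank ℝ (zeros l) = n := ⟨_, 0, by simp, rfl⟩
  -- The functional is chosen with zero set in `A` spanning a space of least dimension. If some zero
  -- `a` had `-a ∉ A`, adding a functional separating `-a` from `A` would lower that dimension.
  obtain ⟨l, hl, hln⟩ := Nat.find_spec hex
  refine ⟨l, hl, fun a ha hla => ?_⟩
  by_contra hna
  obtain ⟨l', hl', hl'a⟩ := A.hyperplane_separation_point hna
  have hzero : ∀ b ∈ A, (l + l') b = 0 → l b = 0 ∧ l' b = 0 := fun b hb h => by
    have h1 := hl b hb
    have h2 := hl' b hb
    rw [add_apply] at h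
    constructor <;> linarith
  have hle : zeros (l + l') ≤ zeros l :=
    Submodule.span_mono fun b hb => ⟨hb.1, (hzero b hb.1 hb.2).1⟩
  have hlt : zeros (l + l') < zeros l := by
    refine lt_of_le_of_ne hle fun heq => ?_
    have h1 : a ∈ zeros (l + l') := heq ▸ Submodule.subset_span ⟨ha, hla⟩
    have h2 : zeros (l + l') ≤ LinearMap.ker (l' : Mat d →ₗ[ℝ] ℝ) :=
      Submodule.span_le.2 fun b hb => (hzero b hb.1 hb.2).2
    have h3 : l' a = 0 := h2 h1
    rw [map_neg, h3] at hl'a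
    simp at hl'a
  refine Nat.find_min hex (hln ▸ Submodule.finrank_lt_finrank_of_lt hlt) ⟨l + l', fun b hb => ?_, rfl⟩
  exact add_nonneg (hl b hb) (hl' b hb)

lemma isCompact_nrm_eq_one : IsCompact {a : Mat d | nrm a = 1} := by
  have hbox : IsCompact (Set.univ.pi fun _ : Fin d => Set.univ.pi fun _ : Fin d =>
      Set.Icc (-1 : ℝ) 1) :=
    isCompact_univ_pi fun _ => isCompact_univ_pi fun _ => isCompact_Icc
  refine IsCompact.of_isClosed_subset (X := Mat d) hbox
    (isClosed_eq continuous_nrm continuous_const) fun a ha i _ j _ => ?_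
  have := abs_entry_le_nrm i j a
  rw [show nrm a = 1 from ha] at this
  exact abs_le.1 this

/-- Domination of positively homogeneous functions on a closed cone, modulo a linear subspace. -/
lemma exists_domination (L : Submodule ℝ (Mat d)) (hLA : ∀ l ∈ L, l ∈ A) {p g : Mat d → ℝ}
    (hp : Continuous p) (hg : Continuous g) (hp1 : ∀ c : ℝ, 0 ≤ c → ∀ a, p (c • a) = c * p a)
    (hg1 : ∀ c : ℝ, 0 ≤ c → ∀ a, g (c • a) = c * g a)
    (hpL : ∀ a ∈ A, ∀ l ∈ L, p (a + l) = p a) (hgL : ∀ a ∈ A, ∀ l ∈ L, g (a + l) = g a)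
    (hpos : ∀ a ∈ A, a ∉ L → 0 < g a) : ∃ n : ℕ, ∀ a ∈ A, p a ≤ n * g a := by
  -- On a complement of `L`, `g` is positive on the compact unit sphere of `A ∩ W`, so `p / g` is
  -- bounded there; invariance along `L` covers the rest of the cone.
  obtain ⟨W, hW⟩ := Submodule.exists_isCompl L
  let K : Set (Mat d) := {a | nrm a = 1} ∩ ((A : Set (Mat d)) ∩ (W : Set (Mat d)))
  have hK : IsCompact K := isCompact_nrm_eq_one.inter_right
    (A.isClosed.inter W.closed_of_finiteDimensional)
  have hKg : ∀ a ∈ K, 0 < g a := fun a ha => hpos a ha.2.1 fun haL => by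
    have h0 : a = 0 := (Submodule.disjoint_def.1 hW.disjoint) a haL ha.2.2
    have h1 : nrm a = 1 := ha.1
    rw [h0] at h1
    simp [nrm, coef] at h1
  obtain ⟨M, hM⟩ := hK.bddAbove_image (f := fun a => p a / g a)
    (hp.continuousOn.div hg.continuousOn fun a ha => (hKg a ha).ne')
  obtain ⟨n, hn⟩ := exists_nat_ge M
  have h0 : ∀ q : Mat d → ℝ, (∀ c : ℝ, 0 ≤ c → ∀ a, q (c • a) = c * q a) → q 0 = 0 :=
    fun q hq => by simpa using hq 0 le_rfl 0
  have hWA : ∀ a ∈ A, a ∈ W → p a ≤ n * g a := by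
    intro a ha haW
    rcases (nrm_nonneg a).eq_or_lt with h | h
    · rw [eq_zero_of_nrm h.symm, h0 p hp1, h0 g hg1, mul_zero]
    · have hinv := inv_pos.2 h
      have hmem : (nrm a)⁻¹ • a ∈ K := ⟨by
        change nrm _ = 1
        rw [nrm_smul hinv.le, inv_mul_cancel₀ h.ne'], A.smul_mem ha hinv.le, W.smul_mem _ haW⟩
      have h1 := (hM ⟨_, hmem, rfl⟩).trans hn
      rw [div_le_iff₀ (hKg _ hmem), hp1 _ hinv.le, hg1 _ hinv.le, ← mul_assoc, mul_comm (n : ℝ),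
        mul_assoc] at h1
      exact le_of_mul_le_mul_left h1 hinv
  refine ⟨n, fun a ha => ?_⟩
  obtain ⟨l, hl, w, hw, rfl⟩ := Submodule.mem_sup.1 (hW.sup_eq_top ▸ Submodule.mem_top (x := a))
  have hwA : w ∈ A := by
    have := A.add_mem ha (hLA (-l) (L.neg_mem hl))
    simpa using this
  rw [add_comm l w, hpL w hwA l hl, hgL w hwA l hl]
  exact hWA w hwA hw

end Domination

/-! ### The bonus and its enlargement of a transfer map. -/

section Bonus

variable {d : ℕ} {A : ProperCone ℝ (Mat d)} {f : Mat d → Fin d → ℝ}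
  {l : StrongDual ℝ (Mat d)}

open scoped Classical in
/-- The sign patterns of the elements of a cone. -/
noncomputable def patterns (A : ProperCone ℝ (Mat d)) : Finset (Fin d × Fin d → SignType) :=
  Finset.univ.filter fun σ => ∃ b ∈ A, signs b = σ

lemma mem_patterns {σ : Fin d × Fin d → SignType} :
    σ ∈ patterns A ↔ ∃ b ∈ A, signs b = σ := by
  simp [patterns]

/-- The gain from replacing a transfer map by its directional derivatives and adding a linear
functional. -/
noncomputable def bonus (A : ProperCone ℝ (Mat d)) (l : StrongDual ℝ (Mat d))
    (f : Mat d → Fin d → ℝ) (a : Mat d) : Fin d → ℝ :=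
  fun i => ∑ σ ∈ patterns A, (slope f σ a i - f a i) + l a

lemma continuous_bonus (hf : Continuous f) : Continuous (bonus A l f) := by
  refine continuous_pi fun i => ?_
  refine (continuous_finsetSum _ fun σ _ => ?_).add l.continuous
  exact ((continuous_apply i).comp (continuous_slope σ)).sub ((continuous_apply i).comp hf)

lemma bonus_smul (hf : IsTransferMap A f) {c : ℝ} (hc : 0 ≤ c) (a : Mat d) :
    bonus A l f (c • a) = c • bonus A l f a := by
  ext i
  simp [bonus, slope_smul _ hc, hf.map_smul hc, mul_add, Finset.mul_sum, mul_sub]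
  ring

lemma bonus_nonneg (hf : IsTransferMap A f)
    (hform : ∀ a, f a = ∑ k, coef k a • f (unit k))
    (hl : ∀ a ∈ A, 0 ≤ l a) {a : Mat d} (ha : a ∈ A) (i : Fin d) :
    0 ≤ bonus A l f a i := by
  refine add_nonneg (Finset.sum_nonneg fun σ hσ => ?_) (hl a ha)
  obtain ⟨b, hb, rfl⟩ := mem_patterns.1 hσ
  exact sub_nonneg.2 (hf.le_slope hform ha hb i)

/-- All summands are nonnegative, so all vanish. The functional gives `-a ∈ A`; then the sign
pattern of `-a` occurs in the sum, and its slope at `a` is `-f (-a)`. -/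
lemma reversible_of_bonus_eq_zero (hf : IsTransferMap A f)
    (hform : ∀ a, f a = ∑ k, coef k a • f (unit k))
    (hd : 0 < d) (hl : ∀ a ∈ A, 0 ≤ l a)
    (hl0 : ∀ a ∈ A, l a = 0 → -a ∈ A) {a : Mat d} (ha : a ∈ A) (h : ∀ i, bonus A l f a i = 0) :
    -a ∈ A ∧ f (-a) = -f a := by
  have hnn : ∀ i, ∀ σ ∈ patterns A, 0 ≤ slope f σ a i - f a i := fun i σ hσ => by
    obtain ⟨b, hb, rfl⟩ := mem_patterns.1 hσ
    exact sub_nonneg.2 (hf.le_slope hform ha hb i)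
  have hsplit : ∀ i, ∑ σ ∈ patterns A, (slope f σ a i - f a i) = 0 ∧ l a = 0 := fun i => by
    have h1 := h i
    have h2 := Finset.sum_nonneg (hnn i)
    have h3 := hl a ha
    simp only [bonus] at h1
    constructor <;> linarith
  have hna := hl0 a ha (hsplit ⟨0, hd⟩).2
  refine ⟨hna, ?_⟩
  ext i
  have h1 := (Finset.sum_eq_zero_iff_of_nonneg (hnn i)).1 (hsplit i).1 (signs (-a))
    (mem_patterns.2 ⟨-a, hna, rfl⟩)
  rw [slope_signs_neg hform] at h1
  simp only [Pi.neg_apply] at h1 ⊢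
  linarith

lemma bonus_add (hf : IsTransferMap A f)
    (hform : ∀ a, f a = ∑ k, coef k a • f (unit k))
    (hl : ∀ a ∈ A, 0 ≤ l a) {a b : Mat d} (ha : a ∈ A) (hb : b ∈ A) (hb' : -b ∈ A)
    (hn : f (-b) = -f b) : bonus A l f (a + b) = bonus A l f a := by
  have hlb : l b = 0 := by
    have h1 := hl b hb
    have h2 := hl (-b) hb'
    rw [map_neg] at h2
    linarith
  have hfab : f (a + b) = f a + f b := by
    simpa using (hf.add_smul_of_neg ha hb hb' hn 1).2.2
  ext i
  simp only [bonus, map_add, hlb, add_zero, hfab]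
  congr 1
  refine Finset.sum_congr rfl fun σ hσ => ?_
  obtain ⟨c, hc, rfl⟩ := mem_patterns.1 hσ
  rw [hf.slope_add hform ha hc hb hb' hn]
  simp

/-- The bonus subtracts one copy of `f` per sign pattern. When `c` times their number is at most
one, the coefficient of `f` stays nonnegative, leaving a nonnegative combination of superadditive
maps. -/
lemma isTransferMap_add_bonus (hf : IsTransferMap A f)
    (hform : ∀ a, f a = ∑ k, coef k a • f (unit k))
    {c : ℝ} (hc : 0 ≤ c) (hc1 : c * (patterns A).card ≤ 1) :
    IsTransferMap A fun a => f a + c • bonus A l f a where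
  continuous := hf.continuous.add ((continuous_bonus hf.continuous).const_smul c)
  homogeneous := fun x hx a => by
    rw [hf.map_smul hx, bonus_smul hf hx, smul_add, smul_comm]
  superadditive := by
    have hadd : ∀ a ∈ A, ∀ b ∈ A, ∀ i, (f a + c • bonus A l f a) i + (f b + c • bonus A l f b) i ≤
        (f (a + b) + c • bonus A l f (a + b)) i := by
      intro a ha b hb i
      have key : ∀ a, (f a + c • bonus A l f a) i = (1 - c * (patterns A).card) * f a i +
          c * ∑ σ ∈ patterns A, slope f σ a i + c * l a := fun a => by
        simp only [bonus, Pi.add_apply, Pi.smul_apply, smul_eq_mul, Finset.sum_sub_distrib,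
          Finset.sum_const, nsmul_eq_mul]
        ring
      rw [key, key, key, map_add]
      have h1 := mul_le_mul_of_nonneg_left (hf.le_add ha hb i)
        (show 0 ≤ 1 - c * (patterns A).card by linarith)
      have h2 : ∑ σ ∈ patterns A, slope f σ a i + ∑ σ ∈ patterns A, slope f σ b i ≤
          ∑ σ ∈ patterns A, slope f σ (a + b) i := by
        rw [← Finset.sum_add_distrib]
        refine Finset.sum_le_sum fun σ hσ => ?_
        obtain ⟨e, he, rfl⟩ := mem_patterns.1 hσ
        exact hf.slope_superadditive hform ha hb he i
      have h3 := mul_le_mul_of_nonneg_left h2 hc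
      linarith
    intro x y hx hy a ha b hb i
    have h := hadd _ (A.smul_mem ha hx) _ (A.smul_mem hb hy) i
    rw [hf.map_smul hx, hf.map_smul hy, bonus_smul hf hx, bonus_smul hf hy] at h
    simp only [Pi.add_apply, Pi.sub_apply, Pi.smul_apply, smul_eq_mul] at h ⊢
    linarith

end Bonus

/-! ### The dominating model and robust no-arbitrage. -/

section RobustModel

variable {Ω : Type*} {mΩ : MeasurableSpace Ω} {μ : Measure Ω} {d T : ℕ}
  {H : Filtration (Fin (T + 1)) mΩ} {A : ProperCone ℝ (Mat d)}
  {F : Fin (T + 1) → Ω → Mat d → Fin d → ℝ} {Z : Ω → Fin d → ℝ}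

lemma continuous_price (t : Fin (T + 1)) (ω : Ω) : Continuous (price μ H F Z t ω) :=
  continuous_finsetSum _ fun k _ => (continuous_coef k).mul continuous_const

lemma measurable_bonus (hF : IsModel μ A F) (l : StrongDual ℝ (Mat d)) (t : Fin (T + 1))
    (a : Mat d) : Measurable fun ω => bonus A l (F t ω) a := by
  refine measurable_pi_lambda _ fun i => ?_
  refine (Finset.measurable_fun_sum _ fun σ _ => ?_).add measurable_const
  refine Measurable.sub ?_ ((measurable_pi_apply i).comp (hF.1 t a))
  simp only [slope, Finset.sum_apply, Pi.smul_apply, smul_eq_mul]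
  exact Finset.measurable_fun_sum _ fun k _ =>
    ((measurable_pi_apply i).comp (hF.1 t (unit k))).const_mul _

variable [IsFiniteMeasure μ]

lemma condExp_value (hI : UnitIntegrable μ F) (hF : IsModel μ A F)
    (hA : HA μ A F) (hZ : MemLp Z ⊤ μ) {t : Fin (T + 1)} {η : Ω → Mat d}
    (hη : AEStronglyMeasurable[H t] η μ) {c : ℝ} (hc : ∀ᵐ ω ∂μ, nrm (η ω) ≤ c) :
    Integrable (fun ω => Z ω ⬝ᵥ app (F t) η ω) μ ∧
      μ[fun ω => Z ω ⬝ᵥ app (F t) η ω | H t] =ᵐ[μ] fun ω => price μ H F Z t ω (η ω) := by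
  have hint := integrable_dotProduct hZ (hI.app hF hA (t := t) (hη.mono (H.le t)) hc)
  exact ⟨hint, (genCondExp_eq_condExp hint).symm.trans (Fbar_eq_price hI hF hA hZ hη)⟩

/-- For constant matrices this is monotonicity of conditional expectation, as `Z` is positive;
density and continuity make the null set independent of the matrices. -/
lemma price_superadditive (hI : UnitIntegrable μ F) (hF : IsModel μ A F)
    (hA : HA μ A F) (hZ : Z ∈ D μ H A F) (t : Fin (T + 1)) :
    ∀ᵐ ω ∂μ, ∀ a ∈ A, ∀ b ∈ A,
      price μ H F Z t ω a + price μ H F Z t ω b ≤ price μ H F Z t ω (a + b) := by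
  have hconst : ∀ a ∈ A, ∀ b ∈ A, ∀ᵐ ω ∂μ,
      price μ H F Z t ω a + price μ H F Z t ω b ≤ price μ H F Z t ω (a + b) := by
    intro a ha b hb
    have h := fun a : Mat d => condExp_value (H := H) hI hF hA hZ.1 (t := t) (η := fun _ => a)
      aestronglyMeasurable_const (c := nrm a) (Eventually.of_forall fun _ => le_rfl)
    have hle : (fun ω => Z ω ⬝ᵥ app (F t) (fun _ => a) ω) +
        (fun ω => Z ω ⬝ᵥ app (F t) (fun _ => b) ω) ≤ᵐ[μ]
        fun ω => Z ω ⬝ᵥ app (F t) (fun _ => a + b) ω := by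
      filter_upwards [hZ.2.1, hF.2 t] with ω h1 h2
      rw [Pi.add_apply, ← dotProduct_add]
      exact Finset.sum_le_sum fun i _ => mul_le_mul_of_nonneg_left (h2.le_add ha hb i) (h1 i).le
    filter_upwards [condExp_mono (m := H t) ((h a).1.add (h b).1) (h (a + b)).1 hle,
      condExp_add (h a).1 (h b).1 (H t), (h a).2, (h b).2, (h (a + b)).2] with ω e1 e2 e3 e4 e5
    rw [e2, e5, Pi.add_apply, e3, e4] at e1
    exact e1
  have : Nonempty (A : Set (Mat d)) := ⟨⟨0, A.zero_mem⟩⟩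
  let s := TopologicalSpace.denseSeq (A : Set (Mat d))
  filter_upwards [ae_all_iff.2 fun n => ae_all_iff.2 fun m =>
    hconst (s n) (s n).2 (s m) (s m).2] with ω h a ha b hb
  have hc := continuous_price (μ := μ) (H := H) (F := F) (Z := Z) t ω
  have h1 : ∀ m, ∀ x : (A : Set (Mat d)), price μ H F Z t ω x + price μ H F Z t ω (s m) ≤
      price μ H F Z t ω (x + s m) := fun m x =>
    (TopologicalSpace.denseRange_denseSeq (A : Set (Mat d))).induction_on x
      (isClosed_le ((hc.comp continuous_subtype_val).add continuous_const)
        (hc.comp (continuous_subtype_val.add continuous_const))) fun n => h n m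
  exact (TopologicalSpace.denseRange_denseSeq (A : Set (Mat d))).induction_on
    (p := fun x : (A : Set (Mat d)) => price μ H F Z t ω a + price μ H F Z t ω x ≤
      price μ H F Z t ω (a + x)) ⟨b, hb⟩
      (isClosed_le (continuous_const.add (hc.comp continuous_subtype_val))
        (hc.comp (continuous_const.add continuous_subtype_val))) fun m => h1 m ⟨a, ha⟩

/-- Almost surely, the matrices with zero price are reversible. -/
lemma reversible_of_price_eq_zero (hI : UnitIntegrable μ F) (hF : IsModel μ A F)
    (hA : HA μ A F) (hN : HN0 μ H A F) (hZ : Z ∈ D μ H A F) (t : Fin (T + 1)) :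
    ∀ᵐ ω ∂μ, ∀ a ∈ A, price μ H F Z t ω a = 0 →
      -a ∈ A ∧ F t ω (-a) = -F t ω a ∧ price μ H F Z t ω (-a) = 0 := by
  classical
  obtain ⟨hZb, hpos, hp, hnull⟩ := (mem_D_iff hI hF hA).1 hZ
  -- The zero-price matrices vary with `ω` only through the finite set `π` of units with negative
  -- price. On each event `B π` they form the fixed set `K π`, for which a countable dense subset
  -- suffices.
  let K : Finset (Idx d) → Set (Mat d) := fun π => {a | a ∈ A ∧ ∀ k ∈ π, coef k a = 0}
  let B : Finset (Idx d) → Set Ω := fun π => {ω | ∀ k, k ∈ π ↔ unitPrice μ H F Z t k ω < 0}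
  have hB : ∀ π, MeasurableSet[H t] (B π) := fun π => by
    have : B π = ⋂ k, {ω | k ∈ π ↔ unitPrice μ H F Z t k ω < 0} := by ext; simp [B]
    rw [this]
    refine MeasurableSet.iInter fun k => ?_
    have hsm : StronglyMeasurable[H t] (unitPrice μ H F Z t k) := stronglyMeasurable_condExp
    have hm : MeasurableSet[H t] {ω | unitPrice μ H F Z t k ω < 0} :=
      hsm.measurable measurableSet_Iio
    by_cases hk : k ∈ π
    · simpa only [hk, true_iff] using hm
    · simpa only [hk, false_iff, Set.compl_ofPred] using hm.compl
  have hconst : ∀ π, ∀ a ∈ K π, ∀ᵐ ω ∂μ, ω ∈ B π →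
      -a ∈ A ∧ F t ω (-a) = -F t ω a ∧ price μ H F Z t ω (-a) = 0 := by
    intro π a ha
    let η : Ω → Mat d := (B π).indicator fun _ => a
    have hη : η ∈ L0 μ (A : Set (Mat d)) (H t) := by
      refine ⟨(stronglyMeasurable_const.indicator (hB π)).aestronglyMeasurable,
        Eventually.of_forall fun ω => ?_⟩
      by_cases hω : ω ∈ B π
      · simpa [η, hω] using ha.1
      · simp [η, hω]
    have hη0 : ∀ᵐ ω ∂μ, price μ H F Z t ω (η ω) = 0 := by
      filter_upwards [hp t] with ω h
      by_cases hω : ω ∈ B π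
      · simp only [η, Set.indicator_of_mem hω]
        rw [price_eq_zero_iff h]
        intro k
        by_cases hk : k ∈ π
        · exact Or.inl (ha.2 k hk)
        · exact Or.inr (le_antisymm (h k) (not_lt.1 fun h' => hk ((hω k).2 h')))
      · simp only [η, Set.indicator_of_notMem hω]
        simpa using price_smul (μ := μ) (H := H) (F := F) (Z := Z) t ω le_rfl (0 : Mat d)
    obtain ⟨h1, h2⟩ := hN t η hη (hnull t η hη hη0)
    have hbd : ∀ c : Mat d, ∀ᵐ ω ∂μ, nrm ((B π).indicator (fun _ => c) ω) ≤ nrm c := fun c =>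
      Eventually.of_forall fun ω => by
        by_cases hω : ω ∈ B π
        · simp [hω]
        · rw [Set.indicator_of_notMem hω]
          have : nrm (0 : Mat d) = 0 := by simp [nrm, coef]
          rw [this]
          exact nrm_nonneg c
    have hneg : -η = (B π).indicator fun _ => -a := by
      ext1 ω
      by_cases hω : ω ∈ B π <;> simp [η, hω]
    have e1 := (condExp_value (H := H) hI hF hA hZb hη.1 (hbd a)).2
    have e2 := (condExp_value (H := H) hI hF hA hZb h2.1 (c := nrm (-a)) (by
      rw [hneg]; exact hbd (-a))).2
    have e3 : (fun ω => Z ω ⬝ᵥ app (F t) (-η) ω) =ᵐ[μ] -fun ω => Z ω ⬝ᵥ app (F t) η ω := by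
      filter_upwards [h1] with ω h
      rw [h, Pi.neg_apply, Pi.neg_apply, dotProduct_neg]
    filter_upwards [h1, h2.2, hη0, e1, e2, condExp_congr_ae (m := H t) e3,
      condExp_neg (μ := μ) (fun ω => Z ω ⬝ᵥ app (F t) η ω) (H t)] with ω k1 k2 k3 k4 k5 k6 k7 hω
    have hηω : η ω = a := by simp [η, hω]
    simp only [app, Pi.neg_apply, hηω] at k1 k2
    refine ⟨k2, k1, ?_⟩
    rw [Pi.neg_apply, hηω] at k5
    rw [← k5, k6, k7, Pi.neg_apply, k4, k3, neg_zero]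
  have hall : ∀ π, ∀ᵐ ω ∂μ, ω ∈ B π → ∀ a ∈ K π,
      -a ∈ A ∧ F t ω (-a) = -F t ω a ∧ price μ H F Z t ω (-a) = 0 := by
    intro π
    have : Nonempty (K π) := ⟨⟨0, A.zero_mem, fun k _ => by simp [coef]⟩⟩
    let s := TopologicalSpace.denseSeq (K π)
    filter_upwards [ae_all_iff.2 fun n => hconst π (s n) (s n).2, hF.2 t] with ω h1 h2 hω a ha
    have hc := continuous_price (μ := μ) (H := H) (F := F) (Z := Z) t ω
    have hneg : Continuous fun x : K π => -(x : Mat d) := continuous_subtype_val.neg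
    exact (TopologicalSpace.denseRange_denseSeq (K π)).induction_on
      (p := fun x : K π => -(x : Mat d) ∈ A ∧ F t ω (-x) = -F t ω x ∧
        price μ H F Z t ω (-x) = 0) ⟨a, ha⟩
      ((A.isClosed.preimage hneg).inter
        ((isClosed_eq (h2.continuous.comp hneg)
          (h2.continuous.comp continuous_subtype_val).neg).inter
          (isClosed_eq (hc.comp hneg) continuous_const))) fun n => h1 n hω
  filter_upwards [ae_all_iff.2 hall, hp t] with ω h1 h2 a ha ha0
  let π : Finset (Idx d) := Finset.univ.filter fun k => unitPrice μ H F Z t k ω < 0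
  refine h1 π (fun k => by simp [π]) a ⟨ha, fun k hk => ?_⟩
  exact ((price_eq_zero_iff h2 a).1 ha0 k).resolve_right (Finset.mem_filter.1 hk).2.ne

/-- Almost surely, the value of the bonus is at most a multiple of the negative of the price. -/
lemma exists_factor (hI : UnitIntegrable μ F) (hF : IsModel μ A F)
    (hA : HA μ A F) (hN : HN0 μ H A F) (hZ : Z ∈ D μ H A F) {l : StrongDual ℝ (Mat d)}
    (hl : ∀ a ∈ A, 0 ≤ l a) (t : Fin (T + 1)) :
    ∀ᵐ ω ∂μ, ∃ n : ℕ, ∀ a ∈ A,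
      Z ω ⬝ᵥ bonus A l (F t ω) a ≤ n * -price μ H F Z t ω a := by
  obtain ⟨hZb, hpos, hp, hnull⟩ := (mem_D_iff hI hF hA).1 hZ
  filter_upwards [hp t, hF.2 t, hA.formula hF t, price_superadditive hI hF hA hZ t,
    reversible_of_price_eq_zero hI hF hA hN hZ t] with ω h1 h2 h3 h4 h5
  have hsmul : ∀ c : ℝ, 0 ≤ c → ∀ a, price μ H F Z t ω (c • a) = c * price μ H F Z t ω a :=
    fun c hc a => price_smul t ω hc a
  -- Reversibility of zero-price matrices makes them a linear subspace, modulo which both the bonus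
  -- and the price are constant.
  let L : Submodule ℝ (Mat d) :=
    { carrier := {a | a ∈ A ∧ price μ H F Z t ω a = 0}
      add_mem' := fun {a b} ha hb => ⟨A.add_mem ha.1 hb.1, le_antisymm (price_nonpos h1 _) (by
        have := h4 a ha.1 b hb.1
        rwa [ha.2, hb.2, add_zero] at this)⟩
      zero_mem' := ⟨A.zero_mem, by simpa using hsmul 0 le_rfl 0⟩
      smul_mem' := fun c a ha => by
        rcases le_total 0 c with hc | hc
        · exact ⟨A.smul_mem ha.1 hc, by rw [hsmul c hc, ha.2, mul_zero]⟩
        · have hr := h5 a ha.1 ha.2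
          have hc' : 0 ≤ -c := by linarith
          rw [← neg_smul_neg]
          exact ⟨A.smul_mem hr.1 hc', by rw [hsmul _ hc', hr.2.2, mul_zero]⟩ }
  refine exists_domination (A := A) L (fun a ha => ha.1) (p := fun a => Z ω ⬝ᵥ bonus A l (F t ω) a)
    (g := fun a => -price μ H F Z t ω a) ?_ (continuous_price t ω).neg ?_ ?_ ?_ ?_ ?_
  · exact continuous_const.dotProduct (continuous_bonus h2.continuous)
  · intro c hc a
    simp only [bonus_smul h2 hc, dotProduct_smul, smul_eq_mul]
  · intro c hc a
    simp only [hsmul c hc, mul_neg]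
  · intro a ha b hb
    have hr := h5 b hb.1 hb.2
    simp only [bonus_add h2 h3 hl ha hb.1 hr.1 hr.2.1]
  · intro a ha b hb
    have hr := h5 b hb.1 hb.2
    have e1 := h4 a ha b hb.1
    have e2 := h4 (a + b) (A.add_mem ha hb.1) (-b) hr.1
    rw [add_neg_cancel_right, hr.2.2] at e2
    rw [hb.2] at e1
    simp only [neg_inj]
    linarith
  · intro a ha haL
    have := price_nonpos h1 a
    exact neg_pos.2 (lt_of_le_of_ne this fun h => haL ⟨ha, h⟩)

/-- The factor is the least `n` that works on a dense sequence of the cone. It is only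
`mΩ`-measurable, which suffices because models need not be adapted. -/
lemma exists_measurable_factor (hI : UnitIntegrable μ F) (hF : IsModel μ A F)
    (hA : HA μ A F) (hN : HN0 μ H A F) (hZ : Z ∈ D μ H A F) {l : StrongDual ℝ (Mat d)}
    (hl : ∀ a ∈ A, 0 ≤ l a) (t : Fin (T + 1)) :
    ∃ N : Ω → ℕ, Measurable N ∧ ∀ᵐ ω ∂μ, ∀ a ∈ A,
      Z ω ⬝ᵥ bonus A l (F t ω) a ≤ N ω * -price μ H F Z t ω a := by
  classical
  have : Nonempty (A : Set (Mat d)) := ⟨⟨0, A.zero_mem⟩⟩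
  let s := TopologicalSpace.denseSeq (A : Set (Mat d))
  have hZm := hZ.1.1
  let E : ℕ → Set Ω := fun n => {ω | ∀ j, hZm.mk Z ω ⬝ᵥ bonus A l (F t ω) (s j) ≤
    n * -price μ H F Z t ω (s j)}
  have hE : ∀ n, MeasurableSet (E n) := fun n => by
    have : E n = ⋂ j, {ω | hZm.mk Z ω ⬝ᵥ bonus A l (F t ω) (s j) ≤
        n * -price μ H F Z t ω (s j)} := by ext; simp [E]
    rw [this]
    refine MeasurableSet.iInter fun j => measurableSet_le ?_ ?_
    · simp only [dotProduct]
      exact Finset.measurable_fun_sum _ fun i _ =>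
        ((measurable_pi_apply i).comp hZm.stronglyMeasurable_mk.measurable).mul
        ((measurable_pi_apply i).comp (measurable_bonus hF l t (s j)))
    · refine Measurable.const_mul (Measurable.neg ?_) _
      simp only [price]
      exact Finset.measurable_fun_sum _ fun k _ =>
        ((stronglyMeasurable_condExp.mono (H.le t)).measurable).const_mul _
  -- The second alternative assigns `0` on the exceptional event where no factor works, so that the
  -- minimum is defined everywhere.
  have hex : ∀ ω, ∃ n, ω ∈ E n ∨ ∀ m, ω ∉ E m := fun ω => by
    by_cases h : ∃ n, ω ∈ E n
    · exact h.imp fun n hn => Or.inl hn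
    · exact ⟨0, Or.inr fun m hm => h ⟨m, hm⟩⟩
  refine ⟨fun ω => Nat.find (hex ω), measurable_find hex fun n => ?_, ?_⟩
  · refine (hE n).union ?_
    have : {ω | ∀ m, ω ∉ E m} = ⋂ m, (E m)ᶜ := by ext; simp
    change MeasurableSet {ω | ∀ m, ω ∉ E m}
    rw [this]
    exact MeasurableSet.iInter fun m => (hE m).compl
  filter_upwards [exists_factor hI hF hA hN hZ hl t, hZm.ae_eq_mk, hF.2 t] with ω h1 h2 h3 a ha
  obtain ⟨n, hn⟩ := h1
  have hmem : ω ∈ E (Nat.find (hex ω)) := by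
    refine (Nat.find_spec (hex ω)).resolve_right fun h => h n fun j => ?_
    rw [← h2]
    exact hn _ (s j).2
  exact (TopologicalSpace.denseRange_denseSeq (A : Set (Mat d))).induction_on
    (p := fun x : (A : Set (Mat d)) => Z ω ⬝ᵥ bonus A l (F t ω) x ≤
      (Nat.find (hex ω) : ℝ) * -price μ H F Z t ω x) ⟨a, ha⟩
    (isClosed_le (continuous_const.dotProduct ((continuous_bonus h3.continuous).comp
      continuous_subtype_val)) (continuous_const.mul ((continuous_price t ω).comp
      continuous_subtype_val).neg)) fun j => by
        exact (congrArg (fun z => z ⬝ᵥ bonus A l (F t ω) (s j)) h2).le.trans (hmem j)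

lemma NAr_of_mem_D (hd : 0 < d) (hI : UnitIntegrable μ F) (hF : IsModel μ A F)
    (hA : HA μ A F) (hN : HN0 μ H A F) (hZ : Z ∈ D μ H A F) : NAr μ H A F := by
  obtain ⟨hZb, hpos, hp, hnull⟩ := (mem_D_iff hI hF hA).1 hZ
  obtain ⟨l, hl, hl0⟩ := exists_nonneg_functional A
  choose N hN' hNle using fun t => exists_measurable_factor hI hF hA hN hZ hl t
  -- The number of patterns ensures that `G` is superadditive, the term `N` that the added value is
  -- at most minus the price, and the `1` that the sum is positive.
  let ε : Fin (T + 1) → Ω → ℝ := fun t ω => ((N t ω : ℝ) + (patterns A).card + 1)⁻¹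
  have hε : ∀ t ω, 0 < ε t ω := fun t ω => by positivity
  let G : Fin (T + 1) → Ω → Mat d → Fin d → ℝ := fun t ω a =>
    F t ω a + ε t ω • bonus A l (F t ω) a
  have hG : IsModel μ A G := by
    refine ⟨fun t a => ?_, fun t => ?_⟩
    · have hεm : Measurable (ε t) := by
        have : Measurable fun ω => (N t ω : ℝ) := measurable_from_nat.comp (hN' t)
        exact ((this.add_const _).add_const 1).inv
      exact (hF.1 t a).add (hεm.smul (measurable_bonus hF l t a))
    · filter_upwards [hF.2 t, hA.formula hF t] with ω h1 h2
      refine isTransferMap_add_bonus h1 h2 (hε t ω).le ?_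
      rw [inv_mul_le_iff₀ (by positivity)]
      have : (0 : ℝ) ≤ N t ω := Nat.cast_nonneg _
      linarith
  have hbonus : ∀ η ∈ Strategies μ H A, ∀ t, ∀ᵐ ω ∂μ, ∀ i,
      0 ≤ bonus A l (F t ω) (η t ω) i := fun η hη t => by
    filter_upwards [hF.2 t, hA.formula hF t, (hη t).2] with ω h1 h2 h3 i
    exact bonus_nonneg h1 h2 hl h3 i
  refine ⟨G, hG, fun η hη t => ⟨fun i => ?_, fun hnot => ?_⟩, ?_⟩
  · filter_upwards [hbonus η hη t] with ω h
    simp only [G, Pi.add_apply, Pi.smul_apply, smul_eq_mul, le_add_iff_nonneg_right]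
    exact mul_nonneg (hε t ω).le (h i)
  · by_contra hcon
    have hzero : ∀ᵐ ω ∂μ, ¬∃ k, F t ω (η t ω) k < G t ω (η t ω) k := by
      rw [ae_iff]
      simpa using hcon
    have hrev : ∀ᵐ ω ∂μ, -η t ω ∈ A ∧ F t ω (-η t ω) = -F t ω (η t ω) := by
      filter_upwards [hF.2 t, hA.formula hF t, (hη t).2, hbonus η hη t, hzero]
        with ω h1 h2 h3 h4 h5
      refine reversible_of_bonus_eq_zero h1 h2 hd hl hl0 h3 fun i => ?_
      refine le_antisymm (not_lt.1 fun h => h5 ⟨i, ?_⟩) (h4 i)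
      simp only [G, Pi.add_apply, Pi.smul_apply, smul_eq_mul, lt_add_iff_pos_right]
      exact mul_pos (hε t ω) h
    refine hnot ⟨⟨η t, hη t, EventuallyEq.rfl⟩, -η t, ⟨(hη t).1.neg, ?_⟩, ?_⟩
    · filter_upwards [hrev] with ω h using h.1
    · filter_upwards [hrev] with ω h
      simp [app, h.2]
  · ext g
    constructor
    · rintro ⟨hgA, hg0⟩
      rw [attainable_last] at hgA
      obtain ⟨η, hη, r, hr, hg⟩ := hgA
      -- The bonus uses up no more than the slack `-price`, so even under `G` the value is dominated
      -- by a sum of local martingale differences for `F`.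
      have hval : ∀ᵐ ω ∂μ, Z ω ⬝ᵥ (g ω + r ω) ≤
          ∑ s, (Z ω ⬝ᵥ F s ω (η s ω) - price μ H F Z s ω (η s ω)) := by
        filter_upwards [hg, ae_all_iff.2 hNle, ae_all_iff.2 fun s => (hη s).2,
          ae_all_iff.2 hp] with ω h1 h2 h3 h4
        have h5 : g ω + r ω = ∑ s, G s ω (η s ω) := by
          rw [h1]
          simp [app]
        rw [h5, dotProduct_sum]
        refine Finset.sum_le_sum fun s _ => ?_
        simp only [G, dotProduct_add, dotProduct_smul, smul_eq_mul, sub_eq_add_neg]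
        refine add_le_add le_rfl ?_
        have h6 := mul_le_mul_of_nonneg_left (h2 s _ (h3 s)) (hε s ω).le
        have h7 : ε s ω * N s ω ≤ 1 := by
          rw [inv_mul_le_iff₀ (by positivity)]
          have : (0 : ℝ) ≤ (patterns A).card := Nat.cast_nonneg _
          linarith
        have h8 : 0 ≤ -price μ H F Z s ω (η s ω) := neg_nonneg.2 (price_nonpos (h4 s) _)
        rw [← mul_assoc] at h6
        exact h6.trans (mul_le_of_le_one_left h8 h7)
      have hgr := orthant_add hg0 hr
      have hsum := sum_value_sub_price_eq_zero hI hF hA hZb hη (by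
        filter_upwards [hval, hpos, hgr.2] with ω h1 h2 h3
        exact (dotProduct_nonneg_of_pos h2 h3).trans h1)
      change g =ᵐ[μ] 0
      filter_upwards [hval, hpos, hgr.2, hsum, hg0.2, hr.2] with ω h1 h2 h3 h4 h5 h6
      rw [h4] at h1
      have h7 := eq_zero_of_dotProduct h2 h3 (le_antisymm h1 (dotProduct_nonneg_of_pos h2 h3))
      ext i
      have e1 := congrFun h7 i
      have e2 := h5 i
      have e3 := h6 i
      simp only [Pi.add_apply, Pi.zero_apply] at e1 ⊢
      linarith
    · intro hg
      have hg : g =ᵐ[μ] 0 := hg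
      refine ⟨?_, L0.congr orthant_zero hg.symm⟩
      rw [attainable_last]
      refine ⟨0, zero_mem_strategies, 0, orthant_zero, hg.trans ?_⟩
      filter_upwards [ae_all_iff.2 fun s => hG.app_zero s] with ω h
      simp [h]

end RobustModel

end ImperfectInfo

theorem theorem2p2 {Ω : Type*} {mΩ : MeasurableSpace Ω} (μ : MeasureTheory.Measure Ω)
    [MeasureTheory.IsProbabilityMeasure μ] [μ.IsComplete] (d T : ℕ) (hd : 1 ≤ d)
    (H : MeasureTheory.Filtration (Fin (T + 1)) mΩ) (A : ProperCone ℝ (ImperfectInfo.Mat d))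
    (F : Fin (T + 1) → Ω → ImperfectInfo.Mat d → Fin d → ℝ)
    (hF : ImperfectInfo.IsModel μ A F)
    (hInt : ImperfectInfo.UnitIntegrable μ F)
    (hN0 : ImperfectInfo.HN0 μ H A F)
    (hA : ImperfectInfo.HA μ A F) :
    (ImperfectInfo.NAr μ H A F ∨ (ImperfectInfo.NAs μ H A F ∧ ImperfectInfo.EF μ H A F) →
      (ImperfectInfo.D μ H A F).Nonempty ∧
        ImperfectInfo.ClosedInProbability μ (ImperfectInfo.Attainable μ H A F (Fin.last T))) ∧
    ((ImperfectInfo.D μ H A F).Nonempty →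
      ImperfectInfo.NAs μ H A F ∧ ImperfectInfo.NAr μ H A F) := by
  refine ⟨fun h => ?_, ?_⟩
  · have hR : ImperfectInfo.Reversible μ H A F := h.elim ImperfectInfo.reversible_of_NAr
      fun h => ImperfectInfo.reversible_of_NAs_EF hF h.1 h.2
    exact ⟨hR.D_nonempty hInt hF hA hN0, (hR.isClosedCone_attainable hF hN0).closedInProbability⟩
  · rintro ⟨Z, hZ⟩
    exact ⟨(ImperfectInfo.reversible_of_mem_D hInt hF hA hZ).NAs hF hN0,
      ImperfectInfo.NAr_of_mem_D hd hInt hF hA hN0 hZ⟩
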